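/- Let $d\ge 2$, $T=[0,2\pi]$, and let $\Lambda=\{\lambda_n\}_{n\ge1}$ satisfy $1<\lambda_1\le\lambda_2\le\cdots$, $\lim_{n\to\infty}\lambda_n=\infty$. Let $PBV_\Lambda$ be the class of measurable functions $f$ on $\mathbb R^d$, $2\pi$-periodic in each variable, such that $$PV_\Lambda(f)=\sum_{i=1}^{d}\ \sup\ \sum_{k=1}^{m}\frac{|f(x^1,\dots,x^{i-1},b_k,x^{i+1},\dots,x^d)-f(x^1,\dots,x^{i-1},a_k,x^{i+1},\dots,x^d)|}{\lambda_k}<\infty ,$$ where the $i$-th supremum is over all $x^j\in T$ ($j\ne i$) and all finite collections, in arbitrary order, of nonoverlapping intervals $(a_k,b_k)\subset T$, $k=1,\dots,m$. Convergence of the Fourier series of $f$ means convergence of its rectangular partial sums $$S_{N_1,\dots,N_d}(f;x)=\sum_{|n_1|\le N_1}\cdots\sum_{|n_d|\le N_d}\widehat f(n)\,e^{i(n_1x^1+\cdots+n_dx^d)},\qquad \widehat f(n)=\frac1{(2\pi)^d}\int_{T^d}f(x)e^{-i(n_1x^1+\cdots+n_dx^d)}\,dx,$$ as $\min_j N_j\to\infty$.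 A point $x$ is regular for $f$ if all $2^d$ limits $f(x^1\pm0,\dots,x^d\pm0)=\lim_{t^1,\dots,t^d\downarrow0}f(x^1\pm t^1,\dots,x^d\pm t^d)$ exist; $f^*(x)$ denotes their arithmetic mean. (a) If $\sum_{n=1}^\infty \lambda_n\log^{d-2}n/n^2<\infty$, then $PBV_\Lambda$ is a class of convergence on $T^d$: every $f\in PBV_\Lambda$ is integrable over $T^d$, its Fourier series converges to $f^*(x)$ at every regular point $x\in T^d$, and the convergence is uniform on every compact $K\subset T^d$ such that $f$ is continuous on a neighbourhood of $K$. (b) Suppose that $\lambda_n/n$ is nonincreasing in $n$, that $\lambda_n/n=O\big(\lambda_{[n^\delta]}/[n^\delta]\big)$ as $n\to\infty$ for some $\delta>1$ (where $[\cdot]$ is the integer part), and that $\sum_{n=1}^\infty \lambda_n\log^{d-2}n/n^2=\infty$. Then there is a continuous (real-valued) $f\in PBV_\Lambda$ whose Fourier series diverges at $(0,\dots,0)$. -/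

import Mathlib

open Set Filter Topology MeasureTheory
open scoped ENNReal BigOperators

noncomputable section

/-- The cube `T^d = [0, 2π]^d`. -/
def torusCube (d : ℕ) : Set (Fin d → ℝ) :=
  {x | ∀ j, x j ∈ Icc 0 (2 * Real.pi)}

/-- `f` is `2π`-periodic with respect to each variable. -/
def IsPeriodicEach {d : ℕ} (f : (Fin d → ℝ) → ℂ) : Prop :=
  ∀ (x : Fin d → ℝ) (j : Fin d), f (Function.update x j (x j + 2 * Real.pi)) = f x

/-- `(a 0, b 0), …, (a (m-1), b (m-1))` is a finite collection, in an arbitrary order,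
of nonoverlapping intervals contained in `T = [0, 2π]`. -/
structure IsIntervalCollection {m : ℕ} (a b : Fin m → ℝ) : Prop where
  lt : ∀ k, a k < b k
  subset : ∀ k, 0 ≤ a k ∧ b k ≤ 2 * Real.pi
  disjoint : ∀ k l, k ≠ l → Disjoint (Ioo (a k) (b k)) (Ioo (a l) (b l))

/-- The `Λ`-variation of `f` with respect to the single variable `x^i`: the supremum over all
values in `[0, 2π]` of the other variables and over all finite collections of nonoverlapping
intervals of `∑_k |f(I_k, x)| / λ_k`. The sequence is `lam 1, lam 2, …`
(the value `lam 0` is never used). The coordinate `x i` of the base point plays no role. -/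
def partialVariation {d : ℕ} (lam : ℕ → ℝ) (i : Fin d) (f : (Fin d → ℝ) → ℂ) : ℝ≥0∞ :=
  ⨆ (x : Fin d → ℝ) (_ : x ∈ torusCube d) (m : ℕ) (a : Fin m → ℝ) (b : Fin m → ℝ)
    (_ : IsIntervalCollection a b),
    ∑ k : Fin m, ENNReal.ofReal
      (‖f (Function.update x i (b k)) - f (Function.update x i (a k))‖ / lam ((k : ℕ) + 1))

/-- `PV_Λ(f)`, the sum of the `d` partial variations. -/
def totalPartialVariation {d : ℕ} (lam : ℕ → ℝ) (f : (Fin d → ℝ) → ℂ) : ℝ≥0∞ :=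
  ∑ i : Fin d, partialVariation lam i f

/-- `PBV_Λ`: the (Lebesgue) measurable functions on `ℝ^d`, `2π`-periodic in each variable, with
`PV_Λ(f) < ∞`. -/
def PBV (d : ℕ) (lam : ℕ → ℝ) : Set ((Fin d → ℝ) → ℂ) :=
  {f | AEMeasurable f volume ∧ IsPeriodicEach f ∧ totalPartialVariation lam f < ∞}

/-- The Fourier coefficient
`(2π)^{-d} ∫_{T^d} f(x) e^{-i (n_1 x^1 + ⋯ + n_d x^d)} dx`. -/
def multiFourierCoeff {d : ℕ} (f : (Fin d → ℝ) → ℂ) (n : Fin d → ℤ) : ℂ :=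
  (1 / (2 * (Real.pi : ℂ)) ^ d) *
    ∫ x in torusCube d, f x * Complex.exp (-Complex.I * ∑ j, (n j : ℂ) * (x j : ℂ))

/-- The rectangular partial sum `S_{N_1, …, N_d}(f; x)` of the Fourier series. -/
def rectPartialSum {d : ℕ} (f : (Fin d → ℝ) → ℂ) (N : Fin d → ℕ) (x : Fin d → ℝ) : ℂ :=
  ∑ n ∈ Fintype.piFinset (fun j => Finset.Icc (-(N j : ℤ)) (N j : ℤ)),
    multiFourierCoeff f n * Complex.exp (Complex.I * ∑ j, (n j : ℂ) * (x j : ℂ))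

/-- The filter of `y → x` inside the open orthant at `x` with sign pattern `s`:
`y^j > x^j` if `s j` is true and `y^j < x^j` if `s j` is false. -/
def orthantNhds {d : ℕ} (x : Fin d → ℝ) (s : Fin d → Bool) : Filter (Fin d → ℝ) :=
  𝓝[{y | ∀ j, if s j = true then x j < y j else y j < x j}] x

/-- `x` is a regular point of `f`: all the `2^d` limits `f(x^1 ± 0, …, x^d ± 0)` exist. -/
def IsRegularPoint {d : ℕ} (f : (Fin d → ℝ) → ℂ) (x : Fin d → ℝ) : Prop :=
  ∀ s : Fin d → Bool, ∃ l : ℂ, Tendsto f (orthantNhds x s) (𝓝 l)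

/-- `f^*(x)`, the mean of the `2^d` limits `f(x^1 ± 0, …, x^d ± 0)`
(meaningful at regular points). -/
def regularValue {d : ℕ} (f : (Fin d → ℝ) → ℂ) (x : Fin d → ℝ) : ℂ :=
  (1 / (2 : ℂ) ^ d) * ∑ s : Fin d → Bool, limUnder (orthantNhds x s) f

/-- `V ⊆ L¹(T^d)` is a class of convergence on `T^d`. The filter `atTop` on `Fin d → ℕ` is
`min_j N_j → ∞`, that is, convergence in the sense of Pringsheim. -/
def IsClassOfConvergence {d : ℕ} (V : Set ((Fin d → ℝ) → ℂ)) : Prop :=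
  ∀ f ∈ V,
    (IsPeriodicEach f ∧ IntegrableOn f (torusCube d) volume) ∧
    (∀ x ∈ torusCube d, IsRegularPoint f x →
      Tendsto (fun N : Fin d → ℕ => rectPartialSum f N x) atTop (𝓝 (regularValue f x))) ∧
    (∀ K : Set (Fin d → ℝ), IsCompact K → K ⊆ torusCube d →
      (∃ U : Set (Fin d → ℝ), IsOpen U ∧ K ⊆ U ∧ ContinuousOn f U) →
      TendstoUniformlyOn (fun (N : Fin d → ℕ) (x : Fin d → ℝ) => rectPartialSum f N x)
        (regularValue f) atTop K)

end

/-! Convergence. By periodicity the partial sum at x is a sum over the 2^d orthants at x of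
integrals of f against products of one-sided Dirichlet kernels, each of mass π. It is therefore
enough that such integrals tend to 0 once the orthant limit is subtracted from f
(`rectPartialSum_sub_eq`). Cut (0, π] into dyadic blocks, the p-th made of 2^p periods of
sin((N+1/2)t). In one variable, pairing the two halves of each period bounds block p by a constant
times λ_{2^{p+1}}/2^p times the share of the Λ-variation carried by that block, plus O(2^{-p}). The
shares add up to at most V, so all blocks whose ratio λ_{2^{p+1}}/2^p is at most m contribute only
O(m) together (`sum_norm_integral_blockKer_le`).

In d variables, each tuple of blocks is charged to a coordinate of least ratio, where the
one-dimensional estimate is applied; the other kernels cost only their L¹ norms, at most 4π each.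
With the other indices q fixed, the sum over that coordinate is O(ratio at max q). Only
O((s+1)^{d-2}) tuples q in ℕ^{d-1} have maximum s, so everything is dominated by Σ_s
(λ_{2^{s+1}}/2^s)(s+1)^{d-2}, which is finite by condensation of the hypothesis. The dominating
series does not depend on N or x, and each fixed block shrinks to the origin, where the function is
small; dominated convergence finishes (`tendsto_integral_prod_dirichletPos`). Stating this along an
arbitrary filter yields pointwise and uniform convergence at once.

Divergence. On scales n_{s+1} = [n_s^δ], the S-th test function is Σ_{s<S} a_s times a product of
bumps that agree with sin((n_S+1/2)t) between its zeros number n_s and n_{s+1}. After folding to [0,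
π]^d the supports are diagonal boxes, so for d ≥ 2 a line parallel to an axis meets at most one of
them and the Λ-variations stay bounded. At the origin the partial sum of order n_S is at least
π^{-d} Σ_{s<S} a_s log^d((n_{s+1}+1)/(n_s+1)), and this is unbounded (`exists_scales`). Uniform
boundedness over ℓ¹ combinations of the test functions produces a single function
(`exists_divergent`). -/

/-! ### The Dirichlet kernel -/

/-- The Dirichlet kernel `∑_{|n| ≤ N} cos (n t)`. -/
noncomputable def dirichletKer (N : ℕ) (t : ℝ) : ℝ :=
  ∑ n ∈ Finset.Icc (-(N : ℤ)) (N : ℤ), Real.cos (n * t)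

theorem sum_Icc_neg_succ {M : Type*} [AddCommMonoid M] (N : ℕ) (g : ℤ → M) :
    ∑ n ∈ Finset.Icc (-((N + 1 : ℕ) : ℤ)) ((N + 1 : ℕ) : ℤ), g n =
      g (-((N : ℤ) + 1)) + (g ((N : ℤ) + 1) + ∑ n ∈ Finset.Icc (-(N : ℤ)) (N : ℤ), g n) := by
  have h : Finset.Icc (-((N + 1 : ℕ) : ℤ)) ((N + 1 : ℕ) : ℤ) =
      insert (-((N : ℤ) + 1)) (insert ((N : ℤ) + 1) (Finset.Icc (-(N : ℤ)) (N : ℤ))) := by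
    ext x
    simp only [Finset.mem_Icc, Finset.mem_insert]
    push_cast
    omega
  rw [h, Finset.sum_insert, Finset.sum_insert]
  · simp
  · simp only [Finset.mem_insert, Finset.mem_Icc]
    omega

theorem sum_exp_eq_dirichletKer (N : ℕ) (t : ℝ) :
    ∑ n ∈ Finset.Icc (-(N : ℤ)) (N : ℤ), Complex.exp (Complex.I * ((n : ℂ) * (t : ℂ))) =
      (dirichletKer N t : ℂ) := by
  unfold dirichletKer
  induction N with
  | zero => simp
  | succ N ih =>
    rw [sum_Icc_neg_succ, sum_Icc_neg_succ, ih]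
    push_cast
    rw [mul_comm Complex.I, mul_comm Complex.I, Complex.exp_mul_I, Complex.exp_mul_I]
    have : ((-1 + -(N : ℂ)) * (t : ℂ)) = -(((N : ℂ) + 1) * t) := by ring
    simp only [neg_add_rev, this, Complex.cos_neg, Complex.sin_neg]
    ring

theorem sin_half_mul_dirichletKer (N : ℕ) (t : ℝ) :
    Real.sin (t / 2) * dirichletKer N t = Real.sin ((N + 1 / 2) * t) := by
  unfold dirichletKer
  induction N with
  | zero => simp; ring_nf
  | succ N ih =>
    rw [sum_Icc_neg_succ, mul_add, mul_add, ih]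
    push_cast
    have h1 : (-1 + -(N : ℝ)) * t = -(((N : ℝ) + 1) * t) := by ring
    simp only [neg_add_rev, h1, Real.cos_neg]
    have h2 : ((N : ℝ) + 1 + 1 / 2) * t = ((N : ℝ) + 1) * t + t / 2 := by ring
    have h3 : ((N : ℝ) + 1 / 2) * t = ((N : ℝ) + 1) * t - t / 2 := by ring
    rw [h2, h3, Real.sin_add, Real.sin_sub]
    ring

theorem abs_dirichletKer_le (N : ℕ) (t : ℝ) : |dirichletKer N t| ≤ 2 * N + 1 := by
  unfold dirichletKer
  refine (Finset.abs_sum_le_sum_abs _ _).trans ?_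
  refine (Finset.sum_le_card_nsmul _ _ 1 fun _ _ => Real.abs_cos_le_one _).trans ?_
  rw [Int.card_Icc, nsmul_eq_mul, mul_one]
  have : ((N : ℤ) + 1 - -(N : ℤ)).toNat = 2 * N + 1 := by omega
  rw [this]; push_cast; rfl

theorem continuous_dirichletKer (N : ℕ) : Continuous (dirichletKer N) := by
  unfold dirichletKer; fun_prop

theorem dirichletKer_neg (N : ℕ) (t : ℝ) : dirichletKer N (-t) = dirichletKer N t := by
  simp [dirichletKer]

theorem dirichletKer_add_two_pi (N : ℕ) (t : ℝ) :
    dirichletKer N (t + 2 * Real.pi) = dirichletKer N t := by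
  unfold dirichletKer
  refine Finset.sum_congr rfl fun n _ => ?_
  rw [mul_add, Real.cos_add_int_mul_two_pi]

theorem integral_dirichletKer (N : ℕ) : ∫ t in (0 : ℝ)..Real.pi, dirichletKer N t = Real.pi := by
  unfold dirichletKer
  rw [intervalIntegral.integral_finsetSum fun i _ => by
    apply Continuous.intervalIntegrable; fun_prop]
  rw [Finset.sum_eq_single 0]
  · simp
  · intro n _ hn
    have hn' : (n : ℝ) ≠ 0 := by exact_mod_cast hn
    rw [intervalIntegral.integral_comp_mul_left (fun x => Real.cos x) hn']
    simp
  · simp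

/-! ### Partial sums as orthant integrals -/

theorem rectPartialSum_eq_integral {d : ℕ} {f : (Fin d → ℝ) → ℂ}
    (hf : IntegrableOn f (torusCube d) volume) (N : Fin d → ℕ) (x : Fin d → ℝ) :
    rectPartialSum f N x = (1 / (2 * (Real.pi : ℂ)) ^ d) *
      ∫ y in torusCube d, f y * ∏ j, (dirichletKer (N j) (x j - y j) : ℂ) := by
  have hint : ∀ n : Fin d → ℤ, IntegrableOn
      (fun y => f y * Complex.exp (-Complex.I * ∑ j, (n j : ℂ) * (y j : ℂ))) (torusCube d) := by
    intro n
    refine Integrable.mul_bdd (c := 1) hf ?_ ?_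
    · exact Continuous.aestronglyMeasurable (by fun_prop)
    · refine ae_of_all _ fun y => ?_
      have : -Complex.I * ∑ j, (n j : ℂ) * (y j : ℂ) =
          ((-∑ j, (n j : ℝ) * y j : ℝ) : ℂ) * Complex.I := by push_cast; ring
      rw [this, Complex.norm_exp_ofReal_mul_I]
  unfold rectPartialSum multiFourierCoeff
  simp_rw [mul_assoc, ← Finset.mul_sum]
  congr 1
  simp_rw [← integral_mul_const]
  rw [← integral_finsetSum _ fun n _ => (hint n).mul_const _]
  refine integral_congr_ae (ae_of_all _ fun y => ?_)
  simp only [← sum_exp_eq_dirichletKer]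
  rw [Finset.prod_univ_sum, Finset.mul_sum]
  refine Finset.sum_congr rfl fun n _ => ?_
  rw [mul_assoc, ← Complex.exp_add, ← Complex.exp_sum]
  congr 2
  rw [Finset.mul_sum, Finset.mul_sum, ← Finset.sum_add_distrib]
  refine Finset.sum_congr rfl fun j _ => ?_
  push_cast
  ring

/-- The basis `2π e_1, …, 2π e_d` of `ℝ^d`. -/
noncomputable def periodBasis (d : ℕ) : Module.Basis (Fin d) ℝ (Fin d → ℝ) :=
  (Pi.basisFun ℝ (Fin d)).isUnitSMul (w := fun _ => 2 * Real.pi)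
    fun _ => (Real.two_pi_pos.ne').isUnit

theorem periodBasis_apply {d : ℕ} (j : Fin d) :
    periodBasis d j = Pi.single j (2 * Real.pi) := by
  rw [periodBasis, Module.Basis.isUnitSMul_apply, Pi.basisFun_apply, ← Pi.single_smul]
  simp

theorem periodBasis_repr {d : ℕ} (x : Fin d → ℝ) (j : Fin d) :
    (periodBasis d).repr x j = x j / (2 * Real.pi) := by
  rw [periodBasis, Module.Basis.repr_isUnitSMul, Pi.basisFun_repr, div_eq_inv_mul,
    Units.smul_def, smul_eq_mul]
  simp

theorem IsPeriodicEach.add_of_mem_span {d : ℕ} {f : (Fin d → ℝ) → ℂ} (hf : IsPeriodicEach f)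
    {v : Fin d → ℝ} (hv : v ∈ Submodule.span ℤ (range (periodBasis d))) (x : Fin d → ℝ) :
    f (v + x) = f x := by
  have key : ∀ (j : Fin d) (x : Fin d → ℝ), f (periodBasis d j + x) = f x := by
    intro j x
    rw [← hf x j]
    congr 1
    ext k
    rcases eq_or_ne k j with rfl | h
    · simp [periodBasis_apply, add_comm]
    · simp [periodBasis_apply, h]
  induction hv using Submodule.span_induction generalizing x with
  | mem v hv => obtain ⟨j, rfl⟩ := hv; exact key j x
  | zero => simp
  | add u v _ _ hu hv => rw [add_assoc, hu, hv]
  | smul a v _ hv =>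
    induction a using Int.induction_on generalizing x with
    | zero => simp
    | succ n ih => rw [add_smul, one_smul, add_assoc, ih, hv]
    | pred n ih =>
      rw [sub_smul, one_smul, ← hv, ← add_assoc]
      rw [show v + (-(n : ℤ) • v - v) = -(n : ℤ) • v by abel, ih]

theorem int_mul_two_pi_mem_span {d : ℕ} (k : Fin d → ℤ) :
    (fun j => (k j : ℝ) * (2 * Real.pi)) ∈ Submodule.span ℤ (range (periodBasis d)) := by
  have : (fun j => (k j : ℝ) * (2 * Real.pi)) = ∑ j, k j • periodBasis d j := by
    ext i
    simp [periodBasis_apply, Finset.sum_apply, Pi.single_apply]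
  rw [this]
  exact Submodule.sum_mem _ fun j _ => Submodule.smul_mem _ _ (Submodule.subset_span ⟨j, rfl⟩)

theorem fundamentalDomain_periodBasis (d : ℕ) :
    ZSpan.fundamentalDomain (periodBasis d) = univ.pi fun _ => Ico 0 (2 * Real.pi) := by
  ext x
  simp only [ZSpan.mem_fundamentalDomain, periodBasis_repr, mem_univ_pi, mem_Ico]
  refine forall_congr' fun j => ?_
  rw [div_lt_one Real.two_pi_pos, le_div_iff₀ Real.two_pi_pos, zero_mul]

theorem torusCube_eq_pi (d : ℕ) : torusCube d = univ.pi fun _ => Icc 0 (2 * Real.pi) := by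
  ext x; simp only [torusCube, mem_ofPred_eq, mem_univ_pi]

theorem measure_torusCube_lt_top (d : ℕ) : volume (torusCube d) < ∞ := by
  rw [torusCube_eq_pi]
  exact (isCompact_univ_pi fun _ => isCompact_Icc).measure_lt_top

open scoped Pointwise in
/-- The integral of a periodic function over the cube `[0, 2π]^d` equals its integral over the
punctured cube centred at any point. -/
theorem IsPeriodicEach.integral_torusCube {d : ℕ} {F : (Fin d → ℝ) → ℂ} (hF : IsPeriodicEach F)
    (x : Fin d → ℝ) :
    ∫ y in torusCube d, F y =
      ∫ t in univ.pi fun _ => Icc (-Real.pi) Real.pi \ {0}, F (x + t) := by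
  have hfd := ZSpan.isAddFundamentalDomain' (periodBasis d) (volume : Measure (Fin d → ℝ))
  have hinv : ∀ (g : (Submodule.span ℤ (range (periodBasis d))).toAddSubgroup) (y : Fin d → ℝ),
      F (g +ᵥ y) = F y := fun g y => hF.add_of_mem_span g.2 y
  have : Countable (Submodule.span ℤ (range (periodBasis d))).toAddSubgroup :=
    inferInstanceAs (Countable (Submodule.span ℤ (range (periodBasis d))))
  have h1 : torusCube d =ᵐ[(volume : Measure (Fin d → ℝ))] ZSpan.fundamentalDomain (periodBasis d) := by
    rw [torusCube_eq_pi, fundamentalDomain_periodBasis]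
    exact Measure.ae_eq_set_pi fun i _ => Ico_ae_eq_Icc.symm
  -- Translating the fundamental domain by x - (π, …, π) centres it at x. Closing the intervals and
  -- removing 0 from each changes the product by a null set.
  rw [setIntegral_congr_set h1,
    hfd.setIntegral_eq (hfd.vadd_of_comm (x - fun _ => Real.pi)) hinv]
  have h2 : (x - fun _ => Real.pi) +ᵥ ZSpan.fundamentalDomain (periodBasis d) =
      (fun t => x + t) '' (univ.pi fun _ => Ico (-Real.pi) Real.pi) := by
    rw [fundamentalDomain_periodBasis]
    ext y
    simp only [mem_vadd_set_iff_neg_vadd_mem, vadd_eq_add, mem_univ_pi, image_add_left,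
      mem_preimage, mem_Ico, Pi.add_apply, Pi.neg_apply, Pi.sub_apply]
    refine forall_congr' fun j => ?_
    constructor <;> rintro ⟨h, h'⟩ <;> constructor <;> linarith
  rw [h2, (measurePreserving_add_left volume x).setIntegral_image_emb
    (MeasurableEquiv.addLeft x).measurableEmbedding]
  refine setIntegral_congr_set (Measure.ae_eq_set_pi fun i _ => Ico_ae_eq_Icc.trans ?_)
  exact (sdiff_null_ae_eq_self (measure_singleton 0)).symm

/-- The Dirichlet kernel, restricted to `(0, π]`. -/
noncomputable def dirichletPos (N : ℕ) : ℝ → ℝ := (Ioc 0 Real.pi).indicator (dirichletKer N)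

/-- The point `x` reflected in the coordinates `j` with `s j = false`. -/
def reflect {d : ℕ} (s : Fin d → Bool) (t : Fin d → ℝ) : Fin d → ℝ :=
  fun j => if s j = true then t j else -t j

theorem reflect_reflect {d : ℕ} (s : Fin d → Bool) (t : Fin d → ℝ) :
    reflect s (reflect s t) = t := by
  ext j; unfold reflect; split_ifs <;> simp

theorem measurePreserving_reflect {d : ℕ} (s : Fin d → Bool) :
    MeasurePreserving (reflect s : (Fin d → ℝ) → _) := by
  refine volume_preserving_pi (f := fun j u => if s j = true then u else -u) fun j => ?_
  by_cases h : s j = true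
  · simpa [h] using! MeasurePreserving.id volume
  · simpa [h] using Measure.measurePreserving_neg volume

theorem integral_reflect {d : ℕ} (s : Fin d → Bool) (F : (Fin d → ℝ) → ℂ) :
    ∫ t, F (reflect s t) = ∫ t, F t :=
  (measurePreserving_reflect s).integral_comp
    (MeasurableEquiv.ofInvolutive (reflect s) (reflect_reflect s)
      (measurePreserving_reflect s).measurable).measurableEmbedding F

theorem integrable_dirichletPos (N : ℕ) : Integrable (dirichletPos N) :=
  ((continuous_dirichletKer N).integrableOn_Icc.mono_set Ioc_subset_Icc_self).integrable_indicator
    measurableSet_Ioc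

theorem integral_dirichletPos (N : ℕ) : ∫ t, dirichletPos N t = Real.pi := by
  rw [dirichletPos, integral_indicator measurableSet_Ioc,
    ← intervalIntegral.integral_of_le Real.pi_pos.le, integral_dirichletKer]

/-- Puncturing the interval at 0 makes this an identity at every point, so the product over the
coordinates can be expanded literally into 2^d orthant terms. -/
theorem dirichletPos_add_neg (N : ℕ) (t : ℝ) :
    dirichletPos N t + dirichletPos N (-t) =
      (Icc (-Real.pi) Real.pi \ {0}).indicator (dirichletKer N) t := by
  have := Real.pi_pos
  unfold dirichletPos
  simp only [indicator_apply, dirichletKer_neg, mem_Ioc, Set.mem_sdiff, mem_Icc, mem_singleton_iff]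
  rcases lt_trichotomy t 0 with h | rfl | h
  · rw [if_neg (by intro h'; linarith [h'.1]), zero_add]
    refine if_congr ⟨fun h' => ⟨⟨?_, ?_⟩, h.ne⟩, fun h' => ⟨?_, ?_⟩⟩ rfl rfl <;> linarith [h'.1, h'.2]
  · simp
  · rw [if_neg (c := _ ∧ -t ≤ _) (by intro h'; linarith [h'.1]), add_zero]
    refine if_congr ⟨fun h' => ⟨⟨?_, h'.2⟩, h.ne'⟩, fun h' => ⟨h, h'.1.2⟩⟩ rfl rfl
    linarith

theorem aestronglyMeasurable_comp_reflect {d : ℕ} {f : (Fin d → ℝ) → ℂ}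
    (hf : AEStronglyMeasurable f volume) (x : Fin d → ℝ) (s : Fin d → Bool) :
    AEStronglyMeasurable (fun t => f (x + reflect s t)) volume :=
  hf.comp_measurePreserving
    ((measurePreserving_add_left volume x).comp (measurePreserving_reflect s))

theorem integrable_prod_smul {d : ℕ} {g : (Fin d → ℝ) → ℂ} (hg : AEStronglyMeasurable g volume)
    {B : ℝ} (hB : ∀ t, ‖g t‖ ≤ B) {k : Fin d → ℝ → ℝ} (hk : ∀ j, Integrable (k j)) :
    Integrable (fun t => (∏ j, k j (t j)) • g t) :=
  Integrable.smul_bdd (Integrable.fintype_prod hk) B hg (ae_of_all _ hB)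

theorem integrableOn_torusCube {d : ℕ} {f : (Fin d → ℝ) → ℂ}
    (hf : AEStronglyMeasurable f volume) {B : ℝ} (hB : ∀ t, ‖f t‖ ≤ B) :
    IntegrableOn f (torusCube d) :=
  Measure.integrableOn_of_bounded (measure_torusCube_lt_top d).ne hf (ae_of_all _ hB)

/-- Multiplying out the sums of one-sided kernels gives one term per sign pattern, and the
measure-preserving reflection carries each term to the positive orthant. -/
theorem rectPartialSum_eq_sum_reflect {d : ℕ} {f : (Fin d → ℝ) → ℂ} (hper : IsPeriodicEach f)
    (hf : AEStronglyMeasurable f volume) {B : ℝ} (hB : ∀ t, ‖f t‖ ≤ B)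
    (N : Fin d → ℕ) (x : Fin d → ℝ) :
    rectPartialSum f N x = (1 / (2 * (Real.pi : ℂ)) ^ d) *
      ∑ s : Fin d → Bool, ∫ t, (∏ j, dirichletPos (N j) (t j)) • f (x + reflect s t) := by
  rw [rectPartialSum_eq_integral (integrableOn_torusCube hf hB)]
  congr 1
  have hper' : IsPeriodicEach fun y => f y * ∏ j, (dirichletKer (N j) (x j - y j) : ℂ) := by
    intro y j
    simp only [hper y j]
    congr 1
    refine Finset.prod_congr rfl fun k _ => ?_
    rcases eq_or_ne k j with rfl | h
    · rw [Function.update_self, ← dirichletKer_add_two_pi]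
      congr 2; ring
    · rw [Function.update_of_ne h]
  rw [hper'.integral_torusCube x, ← integral_indicator
    (MeasurableSet.univ_pi fun _ => measurableSet_Icc.diff (measurableSet_singleton 0))]
  have hexp : ∀ t : Fin d → ℝ, (univ.pi fun _ => Icc (-Real.pi) Real.pi \ {0}).indicator
      (fun t => f (x + t) * ∏ j, (dirichletKer (N j) (x j - (x + t) j) : ℂ)) t =
      ∑ s : Fin d → Bool, (∏ j, dirichletPos (N j) (reflect s t j)) • f (x + t) := by
    intro t
    rw [← Finset.sum_smul]
    have h1 : ∑ s : Fin d → Bool, ∏ j, dirichletPos (N j) (reflect s t j) =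
        ∏ j, (dirichletPos (N j) (t j) + dirichletPos (N j) (-t j)) := by
      have := Finset.prod_univ_sum (fun _ : Fin d => (Finset.univ : Finset Bool))
        (fun j b => dirichletPos (N j) (if b = true then t j else -t j))
      rw [Fintype.piFinset_univ] at this
      unfold reflect
      rw [← this]
      simp
    rw [h1]
    simp only [dirichletPos_add_neg]
    by_cases ht : t ∈ univ.pi fun _ : Fin d => Icc (-Real.pi) Real.pi \ {0}
    · rw [indicator_of_mem ht, Finset.prod_congr rfl fun j _ =>
        indicator_of_mem (ht j (mem_univ j)) _]
      rw [mul_comm, Complex.real_smul]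
      push_cast
      congr 1
      refine Finset.prod_congr rfl fun j _ => ?_
      rw [← dirichletKer_neg]
      simp
    · rw [indicator_of_notMem ht]
      rw [mem_univ_pi] at ht
      push Not at ht
      obtain ⟨j, hj⟩ := ht
      rw [Finset.prod_eq_zero (Finset.mem_univ j) (indicator_of_notMem hj _), zero_smul]
  simp_rw [hexp]
  have hsub : ∀ (s : Fin d → Bool) (t : Fin d → ℝ),
      (∏ j, dirichletPos (N j) (t j)) • f (x + reflect s t) =
      (fun t => (∏ j, dirichletPos (N j) (reflect s t j)) • f (x + t)) (reflect s t) := by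
    intro s t; simp only [reflect_reflect]
  rw [integral_finsetSum]
  · refine Finset.sum_congr rfl fun s _ => ?_
    simp_rw [hsub s]
    rw [integral_reflect s fun t => (∏ j, dirichletPos (N j) (reflect s t j)) • f (x + t)]
  · intro s _
    have h := integrable_prod_smul (aestronglyMeasurable_comp_reflect hf x s)
      (fun t => hB (x + reflect s t)) (fun j => integrable_dirichletPos (N j))
    have h' := (measurePreserving_reflect s).integrable_comp_of_integrable h
    simpa only [Function.comp_def, reflect_reflect] using h'

/-! ### Dyadic blocks of periods -/

/-- The function `1 / sin (t / 2)` on `(0, π]`, extended by `0`. -/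
noncomputable def cosecWeight (t : ℝ) : ℝ :=
  (Ioc 0 Real.pi).indicator (fun t => (Real.sin (t / 2))⁻¹) t

theorem sin_half_pos {t : ℝ} (h0 : 0 < t) (h1 : t ≤ Real.pi) : 0 < Real.sin (t / 2) :=
  Real.sin_pos_of_pos_of_lt_pi (by linarith) (by linarith)

theorem dirichletPos_eq (N : ℕ) (t : ℝ) :
    dirichletPos N t = Real.sin ((N + 1 / 2) * t) * cosecWeight t := by
  unfold dirichletPos cosecWeight
  by_cases ht : t ∈ Ioc 0 Real.pi
  · rw [indicator_of_mem ht, indicator_of_mem ht, ← sin_half_mul_dirichletKer]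
    have := sin_half_pos ht.1 ht.2
    field_simp
  · rw [indicator_of_notMem ht, indicator_of_notMem ht, mul_zero]

theorem cosecWeight_nonneg (t : ℝ) : 0 ≤ cosecWeight t :=
  indicator_nonneg (fun _ ht => (inv_pos.2 (sin_half_pos ht.1 ht.2)).le) t

theorem cosecWeight_anti {s t : ℝ} (hs : 0 < s) (hst : s ≤ t) : cosecWeight t ≤ cosecWeight s := by
  by_cases ht : t ≤ Real.pi
  · unfold cosecWeight
    rw [indicator_of_mem (show t ∈ Ioc 0 Real.pi from ⟨hs.trans_le hst, ht⟩),
      indicator_of_mem (show s ∈ Ioc 0 Real.pi from ⟨hs, hst.trans ht⟩)]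
    refine inv_anti₀ (sin_half_pos hs (hst.trans ht)) ?_
    exact Real.sin_le_sin_of_le_of_le_pi_div_two (by linarith [Real.pi_pos]) (by linarith)
      (by linarith)
  · refine le_trans (le_of_eq ?_) (cosecWeight_nonneg s)
    exact indicator_of_notMem (fun h => ht h.2) _

theorem cosecWeight_le {t : ℝ} (ht : 0 < t) : cosecWeight t ≤ Real.pi / t := by
  unfold cosecWeight
  by_cases h : t ≤ Real.pi
  · rw [indicator_of_mem (show t ∈ Ioc 0 Real.pi from ⟨ht, h⟩)]
    have h1 := Real.mul_le_sin (x := t / 2) (by linarith) (by linarith)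
    rw [← inv_div t]
    refine inv_anti₀ (div_pos ht Real.pi_pos) (le_trans (le_of_eq ?_) h1)
    field_simp
  · rw [indicator_of_notMem fun h' => h h'.2]
    exact (div_pos Real.pi_pos ht).le

/-- The period of `sin ((N + 1/2) t)`. -/
noncomputable def kerPeriod (N : ℕ) : ℝ := 2 * Real.pi / (N + 1 / 2)

theorem kerPeriod_pos (N : ℕ) : 0 < kerPeriod N := by
  unfold kerPeriod; have := Real.pi_pos; positivity

theorem mul_kerPeriod (N : ℕ) : ((N : ℝ) + 1 / 2) * kerPeriod N = 2 * Real.pi := by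
  unfold kerPeriod; field_simp

/-- The part of the Dirichlet kernel on the `p`-th dyadic block of periods of `(0, π]`. -/
noncomputable def blockKer (N p : ℕ) : ℝ → ℝ :=
  (Ico ((2 ^ p - 1) * kerPeriod N) ((2 ^ (p + 1) - 1) * kerPeriod N)).indicator (dirichletPos N)

theorem integrable_blockKer (N p : ℕ) : Integrable (blockKer N p) :=
  (integrable_dirichletPos N).indicator measurableSet_Ico

/-- On the first period the trivial bound 2N+1 times the length gives exactly 4π. For p ≥ 1 the
kernel is at most π/t, and the block's length is at most twice its distance from 0. -/
theorem integral_abs_blockKer_le (N p : ℕ) : ∫ t, |blockKer N p t| ≤ 4 * Real.pi := by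
  have hh := kerPeriod_pos N
  have hp : (1 : ℝ) ≤ 2 ^ p := one_le_pow₀ (by norm_num)
  have hlen : volume.real (Ico ((2 ^ p - 1) * kerPeriod N) ((2 ^ (p + 1) - 1) * kerPeriod N)) =
      2 ^ p * kerPeriod N := by
    rw [Real.volume_real_Ico_of_le (by rw [pow_succ]; nlinarith)]
    ring
  have key : ∀ A : ℝ, 0 ≤ A →
      (∀ t ∈ Ico ((2 ^ p - 1) * kerPeriod N) ((2 ^ (p + 1) - 1) * kerPeriod N),
        |dirichletPos N t| ≤ A) → ∫ t, |blockKer N p t| ≤ A * (2 ^ p * kerPeriod N) := by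
    intro A hA h
    rw [← hlen]
    have : (fun t => |blockKer N p t|) =
        (Ico ((2 ^ p - 1) * kerPeriod N) ((2 ^ (p + 1) - 1) * kerPeriod N)).indicator
          (fun t => ‖dirichletPos N t‖) := by
      ext t
      unfold blockKer
      rw [← Real.norm_eq_abs, norm_indicator_eq_indicator_norm]
    rw [this, integral_indicator measurableSet_Ico]
    have h' := norm_setIntegral_le_of_norm_le_const (μ := volume)
      (f := fun t => ‖dirichletPos N t‖) measure_Ico_lt_top
      (C := A) (fun t ht => by simpa using h t ht)
    exact (le_abs_self _).trans h'
  rcases Nat.eq_zero_or_pos p with rfl | hp0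
  · refine (key (2 * N + 1) (by positivity) fun t _ => ?_).trans (le_of_eq ?_)
    · unfold dirichletPos
      by_cases ht : t ∈ Ioc 0 Real.pi
      · rw [indicator_of_mem ht]; exact abs_dirichletKer_le N t
      · rw [indicator_of_notMem ht, abs_zero]; positivity
    · have := mul_kerPeriod N
      linear_combination 2 * this
  · have hp2 : (2 : ℝ) ≤ 2 ^ p := by
      simpa using pow_le_pow_right₀ (one_le_two : (1 : ℝ) ≤ 2) hp0
    have hpos : 0 < (2 ^ p - 1) * kerPeriod N := by nlinarith
    refine (key (Real.pi / ((2 ^ p - 1) * kerPeriod N))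
      (div_pos Real.pi_pos hpos).le fun t ht => ?_).trans ?_
    · rw [dirichletPos_eq, abs_mul, abs_of_nonneg (cosecWeight_nonneg t)]
      refine (mul_le_of_le_one_left (cosecWeight_nonneg t) (Real.abs_sin_le_one _)).trans ?_
      exact (cosecWeight_anti hpos ht.1).trans (cosecWeight_le hpos)
    · rw [div_mul_eq_mul_div, div_le_iff₀ hpos]
      have := mul_pos Real.pi_pos hh
      nlinarith

/-! ### The one-dimensional block estimate -/

/-- The `Λ`-variation of `g` on `[0, 2π]` over nonoverlapping intervals taken from left to right
is at most `V`. -/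
def OrderedVarLE (lam : ℕ → ℝ) (V : ℝ) (g : ℝ → ℂ) : Prop :=
  ∀ (S : Finset ℕ) (u v : ℕ → ℝ), (∀ k ∈ S, 0 ≤ u k ∧ u k ≤ v k ∧ v k ≤ 2 * Real.pi) →
    (∀ k ∈ S, ∀ l ∈ S, k < l → v k ≤ u l) →
    ∑ k ∈ S, ‖g (v k) - g (u k)‖ / lam (k + 1) ≤ V

/-- `λ_{2^{p+1}} / 2^p`. -/
noncomputable def dyadicRatio (lam : ℕ → ℝ) (p : ℕ) : ℝ := lam (2 ^ (p + 1)) / 2 ^ p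

/-- The sum is dominated by the geometric series starting at the least element of R, whose first
term is already at most m. -/
theorem sum_half_pow_le {R : Finset ℕ} {m : ℝ} (hm : 0 ≤ m) (h : ∀ p ∈ R, (1 / 2 : ℝ) ^ p ≤ m) :
    ∑ p ∈ R, (1 / 2 : ℝ) ^ p ≤ 2 * m := by
  rcases R.eq_empty_or_nonempty with rfl | hR
  · simpa using hm
  · set q := R.min' hR
    have hq : (1 / 2 : ℝ) ^ q ≤ m := h q (R.min'_mem hR)
    have hs : Summable fun p : ℕ => (1 / 2 : ℝ) ^ (q + p) := by
      simp_rw [pow_add]; exact summable_geometric_two.mul_left _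
    have h1 : ∑ p ∈ R, (1 / 2 : ℝ) ^ p = ∑ p ∈ R.image (fun p => p - q), (1 / 2 : ℝ) ^ (q + p) := by
      rw [Finset.sum_image]
      · refine Finset.sum_congr rfl fun p hp => ?_
        rw [Nat.add_sub_cancel' (R.min'_le p hp)]
      · intro a ha b hb hab
        have ha' := R.min'_le a ha
        have hb' := R.min'_le b hb
        simp only at hab
        omega
    rw [h1]
    refine (hs.sum_le_tsum _ fun _ _ => by positivity).trans ?_
    simp_rw [pow_add]
    rw [tsum_mul_left, tsum_geometric_two]
    linarith

/-- Such phases merge a sum of norms of integrals into a single integral, so that the variation can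
be summed over the blocks pointwise, before integrating. -/
theorem exists_mul_eq_norm (z : ℂ) : ∃ c : ℂ, ‖c‖ ≤ 1 ∧ c * z = ‖z‖ := by
  rcases eq_or_ne z 0 with rfl | hz
  · exact ⟨0, by simp⟩
  · have hz' : (‖z‖ : ℂ) ≠ 0 := by exact_mod_cast norm_ne_zero_iff.2 hz
    refine ⟨(starRingEnd ℂ) z / ‖z‖, by simp [hz], ?_⟩
    rw [div_mul_eq_mul_div, Complex.conj_mul', sq]
    field_simp

/-- The indices of the periods that make up the `p`-th dyadic block. -/
def blockIdx (p : ℕ) : Finset ℕ := Finset.Ico (2 ^ p - 1) (2 ^ (p + 1) - 1)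

theorem sin_add_half_kerPeriod (N : ℕ) (t : ℝ) :
    Real.sin ((N + 1 / 2) * (t + kerPeriod N / 2)) = -Real.sin ((N + 1 / 2) * t) := by
  rw [show ((N : ℝ) + 1 / 2) * (t + kerPeriod N / 2) =
    (N + 1 / 2) * t + ((N + 1 / 2) * kerPeriod N) / 2 by ring, mul_kerPeriod,
    mul_div_cancel_left₀ _ (two_ne_zero), Real.sin_add_pi]

theorem integrable_dirichletPos_smul (N : ℕ) {g : ℝ → ℂ} (hg : AEStronglyMeasurable g volume)
    {B : ℝ} (hB : ∀ t, ‖g t‖ ≤ B) : Integrable fun t => dirichletPos N t • g t :=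
  (integrable_dirichletPos N).smul_bdd B hg (ae_of_all _ hB)

/-- Folding the block onto half a period puts points half a period apart, where the sine takes
opposite values, under the same integral sign. -/
theorem integral_blockKer_smul (N p : ℕ) {g : ℝ → ℂ} (hg : AEStronglyMeasurable g volume)
    {B : ℝ} (hB : ∀ t, ‖g t‖ ≤ B) :
    ∫ t, blockKer N p t • g t = ∫ t in (0 : ℝ)..kerPeriod N / 2,
      ∑ k ∈ blockIdx p,
        (dirichletPos N (t + k * kerPeriod N) • g (t + k * kerPeriod N) +
          dirichletPos N (t + k * kerPeriod N + kerPeriod N / 2) •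
            g (t + k * kerPeriod N + kerPeriod N / 2)) := by
  have hh := kerPeriod_pos N
  have hp : (1 : ℝ) ≤ 2 ^ p := one_le_pow₀ (by norm_num)
  have hint := integrable_dirichletPos_smul N hg hB
  set F : ℝ → ℂ := fun t => dirichletPos N t • g t with hF
  have h1 : (fun t => blockKer N p t • g t) =
      (Ico ((2 ^ p - 1) * kerPeriod N) ((2 ^ (p + 1) - 1) * kerPeriod N)).indicator F := by
    ext t; unfold blockKer; rw [← indicator_smul_apply_left]
  have hpn : 2 ^ p - 1 ≤ 2 ^ (p + 1) - 1 :=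
    Nat.sub_le_sub_right (Nat.pow_le_pow_right (by norm_num) (Nat.le_succ p)) 1
  have hcast : ∀ q : ℕ, ((2 ^ q - 1 : ℕ) : ℝ) = 2 ^ q - 1 := by
    intro q; rw [Nat.cast_sub Nat.one_le_two_pow]; simp
  rw [h1, integral_indicator measurableSet_Ico, integral_Ico_eq_integral_Ioc,
    ← intervalIntegral.integral_of_le (by rw [pow_succ]; nlinarith), ← hcast, ← hcast,
    ← intervalIntegral.sum_integral_adjacent_intervals_Ico
      (a := fun k : ℕ => (k : ℝ) * kerPeriod N) hpn
      (fun k _ => hint.intervalIntegrable),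
    ← blockIdx, intervalIntegral.integral_finsetSum]
  · refine Finset.sum_congr rfl fun k _ => ?_
    have e1 := intervalIntegral.integral_add_adjacent_intervals (μ := volume) (f := F)
      (a := k * kerPeriod N) (b := k * kerPeriod N + kerPeriod N / 2)
      (c := (k + 1 : ℕ) * kerPeriod N) hint.intervalIntegrable hint.intervalIntegrable
    rw [← e1, intervalIntegral.integral_add]
    · congr 1
      · rw [intervalIntegral.integral_comp_add_right (fun t => F t)]
        rw [zero_add, add_comm]
      · simp_rw [add_assoc]
        rw [intervalIntegral.integral_comp_add_right (fun t => F t)]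
        congr 1
        · ring
        · push_cast; ring
    · exact (hint.comp_add_right _).intervalIntegrable
    · simp_rw [add_assoc]
      exact (hint.comp_add_right _).intervalIntegrable
  · intro k _
    refine ((hint.comp_add_right _).add ?_).intervalIntegrable
    simp_rw [add_assoc]
    exact hint.comp_add_right _

/-- With w the cosecant weight and y' = y + h/2 for the period h, the pair is sin((N+1/2)y) times
w(y)(g(y) - g(y')) + (w(y) - w(y'))g(y'), and w decreases. -/
theorem norm_dirichletPos_pair_le (N k : ℕ) {g : ℝ → ℂ} {B : ℝ} (hB : ∀ t, ‖g t‖ ≤ B) {t : ℝ}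
    (ht : 0 < t) :
    ‖dirichletPos N (t + k * kerPeriod N) • g (t + k * kerPeriod N) +
      dirichletPos N (t + k * kerPeriod N + kerPeriod N / 2) •
        g (t + k * kerPeriod N + kerPeriod N / 2)‖ ≤
    cosecWeight (t + k * kerPeriod N) *
      ‖g (t + k * kerPeriod N + kerPeriod N / 2) - g (t + k * kerPeriod N)‖ +
    B * (cosecWeight (t + k * kerPeriod N) -
      cosecWeight (t + k * kerPeriod N + kerPeriod N / 2)) := by
  have hh := kerPeriod_pos N
  set y := t + k * kerPeriod N
  have hy : 0 < y := by positivity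
  have hw := cosecWeight_anti hy (by linarith : y ≤ y + kerPeriod N / 2)
  have hw0 := cosecWeight_nonneg y
  have e : dirichletPos N y • g y + dirichletPos N (y + kerPeriod N / 2) • g (y + kerPeriod N / 2) =
      Real.sin ((N + 1 / 2) * y) • (cosecWeight y • (g y - g (y + kerPeriod N / 2)) +
        (cosecWeight y - cosecWeight (y + kerPeriod N / 2)) • g (y + kerPeriod N / 2)) := by
    rw [dirichletPos_eq, dirichletPos_eq, sin_add_half_kerPeriod]
    module
  rw [e, norm_smul]
  refine (mul_le_of_le_one_left (norm_nonneg _) (Real.abs_sin_le_one _)).trans ?_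
  refine (norm_add_le _ _).trans ?_
  rw [norm_smul, norm_smul, Real.norm_of_nonneg hw0, Real.norm_of_nonneg (sub_nonneg.2 hw),
    norm_sub_rev, mul_comm B]
  gcongr
  exact hB _

theorem sum_Ico_sub_succ (W : ℕ → ℝ) {a b : ℕ} (hab : a ≤ b) :
    ∑ k ∈ Finset.Ico a b, (W k - W (k + 1)) = W a - W b := by
  induction b, hab using Nat.le_induction with
  | base => simp
  | succ n hn ih => rw [Finset.sum_Ico_succ_top hn, ih]; ring

/-- For p ≥ 1 the block starts at 2^p - 1 ≥ 2^{p-1} periods from 0, so the weight is at most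
(2π/h)2^{-p} with h the period. Inside the block λ_{k+1} ≤ λ_{2^{p+1}}, which turns oscillations
into Λ-variation. Pairs starting beyond π have weight 0 and are left out of the variation, to keep
its intervals inside [0, 2π]. -/
theorem sum_norm_dirichletPos_pair_le {lam : ℕ → ℝ} (h1 : 1 < lam 1)
    (hmono : MonotoneOn lam (Ici 1)) (N : ℕ) {p : ℕ} (hp : 1 ≤ p) {g : ℝ → ℂ} {B : ℝ}
    (hB : ∀ t, ‖g t‖ ≤ B) {t : ℝ} (ht : 0 < t) :
    ∑ k ∈ blockIdx p,
      ‖dirichletPos N (t + k * kerPeriod N) • g (t + k * kerPeriod N) +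
        dirichletPos N (t + k * kerPeriod N + kerPeriod N / 2) •
          g (t + k * kerPeriod N + kerPeriod N / 2)‖ ≤
    2 * Real.pi / kerPeriod N * (dyadicRatio lam p *
      (∑ k ∈ (blockIdx p).filter
          (fun k : ℕ => t + k * kerPeriod N ≤ Real.pi),
        ‖g (t + k * kerPeriod N + kerPeriod N / 2) - g (t + k * kerPeriod N)‖ / lam (k + 1)) +
      (1 / 2) ^ p * B) := by
  have hh := kerPeriod_pos N
  have hpi := Real.pi_pos
  have hB0 : 0 ≤ B := (norm_nonneg _).trans (hB 0)
  have hpn : 2 ^ p - 1 ≤ 2 ^ (p + 1) - 1 :=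
    Nat.sub_le_sub_right (Nat.pow_le_pow_right (by norm_num) (Nat.le_succ p)) 1
  have hw : ∀ k : ℕ, 2 ^ p - 1 ≤ k →
      cosecWeight (t + k * kerPeriod N) ≤ 2 * Real.pi / kerPeriod N * (1 / 2) ^ p := by
    intro k hk
    obtain ⟨q, rfl⟩ : ∃ q, p = q + 1 := ⟨p - 1, by omega⟩
    have hq : 2 ^ q ≤ k := by
      have : 1 ≤ 2 ^ q := Nat.one_le_two_pow
      rw [pow_succ] at hk
      omega
    have hq' : (2 : ℝ) ^ q ≤ k := by exact_mod_cast hq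
    refine (cosecWeight_le (by positivity)).trans ?_
    have : Real.pi / (t + k * kerPeriod N) ≤ Real.pi / (2 ^ q * kerPeriod N) := by
      gcongr
      nlinarith
    refine this.trans (le_of_eq ?_)
    rw [pow_succ, one_div, inv_pow]
    field_simp
  refine (Finset.sum_le_sum fun k _ => norm_dirichletPos_pair_le N k hB ht).trans ?_
  rw [Finset.sum_add_distrib, mul_add]
  refine add_le_add ?_ ?_
  · rw [Finset.sum_filter, Finset.mul_sum, Finset.mul_sum]
    refine Finset.sum_le_sum fun k hk => ?_
    rw [blockIdx, Finset.mem_Ico] at hk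
    split_ifs with hkt
    · have hk1 : 1 ≤ k + 1 := by omega
      have hk2 : k + 1 ≤ 2 ^ (p + 1) := by omega
      have hl1 : 0 < lam (k + 1) :=
        lt_of_lt_of_le (by linarith) (hmono (mem_Ici.2 le_rfl) (mem_Ici.2 hk1) hk1)
      have hl2 : lam (k + 1) ≤ lam (2 ^ (p + 1)) :=
        hmono (mem_Ici.2 hk1) (mem_Ici.2 (hk1.trans hk2)) hk2
      have e : dyadicRatio lam p = (1 / 2) ^ p * lam (2 ^ (p + 1)) := by
        unfold dyadicRatio; rw [one_div, inv_pow]; field_simp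
      rw [e]
      set D := ‖g (t + k * kerPeriod N + kerPeriod N / 2) - g (t + k * kerPeriod N)‖
      have hD : D ≤ lam (2 ^ (p + 1)) * (D / lam (k + 1)) := by
        rw [mul_div_assoc', le_div_iff₀ hl1, mul_comm]
        exact mul_le_mul_of_nonneg_right hl2 (norm_nonneg _)
      calc cosecWeight (t + k * kerPeriod N) * D
          ≤ 2 * Real.pi / kerPeriod N * (1 / 2) ^ p * (lam (2 ^ (p + 1)) * (D / lam (k + 1))) := by
            gcongr
            exact hw k hk.1
        _ = _ := by ring
    · have : cosecWeight (t + k * kerPeriod N) = 0 :=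
        indicator_of_notMem (fun h => hkt h.2) _
      rw [this]; simp
  · rw [← Finset.mul_sum]
    set W : ℕ → ℝ := fun k => cosecWeight (t + k * kerPeriod N) with hW
    -- The weight half a period later is at least the weight at the next period, so the drops are
    -- dominated by a telescoping sum and only the first weight survives.
    have : ∑ k ∈ blockIdx p, (cosecWeight (t + k * kerPeriod N) -
        cosecWeight (t + k * kerPeriod N + kerPeriod N / 2)) ≤
        ∑ k ∈ blockIdx p, (W k - W (k + 1)) := by
      refine Finset.sum_le_sum fun k _ => ?_
      have : W (k + 1) ≤ cosecWeight (t + k * kerPeriod N + kerPeriod N / 2) := by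
        refine cosecWeight_anti (by positivity) ?_
        push_cast; linarith
      simp only [hW] at this ⊢
      linarith
    rw [show ∑ k ∈ blockIdx p, (W k - W (k + 1)) = _ from sum_Ico_sub_succ W hpn] at this
    have h2 : W (2 ^ (p + 1) - 1) ≥ 0 := cosecWeight_nonneg _
    have h3 := hw (2 ^ p - 1) le_rfl
    have h4 : ∑ k ∈ blockIdx p, (cosecWeight (t + k * kerPeriod N) -
        cosecWeight (t + k * kerPeriod N + kerPeriod N / 2)) ≤
        2 * Real.pi / kerPeriod N * (1 / 2) ^ p := by
      linarith
    calc _ ≤ B * (2 * Real.pi / kerPeriod N * (1 / 2) ^ p) := by gcongr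
      _ = _ := by ring

/-- The one-dimensional estimate: the blocks on which `λ_{2^{p+1}} / 2^p ≤ m` contribute `O(m)`. -/
theorem sum_norm_integral_blockKer_le {lam : ℕ → ℝ} (h1 : 1 < lam 1)
    (hmono : MonotoneOn lam (Ici 1)) {N : ℕ} (hN : 1 ≤ N) {g : ℝ → ℂ}
    (hg : AEStronglyMeasurable g volume) {B V m : ℝ} (hB : ∀ t, ‖g t‖ ≤ B)
    (hV : OrderedVarLE lam V g) {R : Finset ℕ} (hm : 0 ≤ m)
    (hR : ∀ p ∈ R, dyadicRatio lam p ≤ m) :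
    ∑ p ∈ R, ‖∫ t, blockKer N p t • g t‖ ≤ 6 * Real.pi * m * (V + B) := by
  have hh := kerPeriod_pos N
  have hpi := Real.pi_pos
  have hB0 : 0 ≤ B := (norm_nonneg _).trans (hB 0)
  have hlam : ∀ k : ℕ, 1 ≤ k → 1 ≤ lam k := fun k hk =>
    h1.le.trans (hmono (mem_Ici.2 le_rfl) (mem_Ici.2 hk) hk)
  have hV0 : 0 ≤ V := by simpa using hV ∅ 0 0 (by simp) (by simp)
  have hhalf : ∀ p, (1 / 2 : ℝ) ^ p ≤ dyadicRatio lam p := by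
    intro p
    unfold dyadicRatio
    rw [one_div, inv_pow, inv_eq_one_div]
    gcongr
    exact hlam _ Nat.one_le_two_pow
  have hzero : 0 ∈ R → ‖∫ t, blockKer N 0 t • g t‖ ≤ 4 * Real.pi * m * B := by
    intro h0
    -- The ratio at p = 0 is λ_2 ≥ 1, so block 0, where no pairing gain is available, occurs only
    -- when m ≥ 1 and the L¹ bound suffices.
    have hm1 : 1 ≤ m := by simpa using (hhalf 0).trans (hR 0 h0)
    have : ‖∫ t, blockKer N 0 t • g t‖ ≤ ∫ t, |blockKer N 0 t| * B := by
      refine norm_integral_le_of_norm_le ((integrable_blockKer N 0).abs.mul_const B)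
        (ae_of_all _ fun t => ?_)
      rw [norm_smul, Real.norm_eq_abs]
      exact mul_le_mul_of_nonneg_left (hB t) (abs_nonneg _)
    rw [integral_mul_const] at this
    have h4 := integral_abs_blockKer_le N 0
    calc _ ≤ _ := this
      _ ≤ 4 * Real.pi * B := by gcongr
      _ ≤ 4 * Real.pi * m * B := by
        have := mul_le_mul_of_nonneg_left hm1 (by positivity : 0 ≤ 4 * Real.pi * B)
        linarith
  set R' := R.erase 0 with hR'
  have hR'1 : ∀ p ∈ R', 1 ≤ p := fun p hp => by
    have := Finset.ne_of_mem_erase hp; omega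
  have hR'm : ∀ p ∈ R', dyadicRatio lam p ≤ m := fun p hp => hR p (Finset.mem_of_mem_erase hp)
  have hmain : ∑ p ∈ R', ‖∫ t, blockKer N p t • g t‖ ≤ Real.pi * m * (V + 2 * B) := by
    choose c hc1 hc2 using fun p => exists_mul_eq_norm (∫ t, blockKer N p t • g t)
    set P : ℕ → ℝ → ℂ := fun k t =>
      dirichletPos N (t + k * kerPeriod N) • g (t + k * kerPeriod N) +
          dirichletPos N (t + k * kerPeriod N + kerPeriod N / 2) •
            g (t + k * kerPeriod N + kerPeriod N / 2) with hP
    have hint := integrable_dirichletPos_smul N hg hB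
    have hPint : ∀ k, Integrable (P k) := by
      intro k
      refine Integrable.add (hint.comp_add_right _) ?_
      simp_rw [add_assoc]
      exact hint.comp_add_right _
    have e1 : ((∑ p ∈ R', ‖∫ t, blockKer N p t • g t‖ : ℝ) : ℂ) =
        ∫ t in (0 : ℝ)..kerPeriod N / 2, ∑ p ∈ R',
          c p * ∑ k ∈ blockIdx p, P k t := by
      rw [intervalIntegral.integral_finsetSum]
      · push_cast
        refine Finset.sum_congr rfl fun p _ => ?_
        rw [← hc2, integral_blockKer_smul N p hg hB, intervalIntegral.integral_const_mul, hP]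
      · intro p _
        exact ((integrable_finsetSum (blockIdx p) fun k _ => hPint k).const_mul (c p)).intervalIntegrable
    have e2 : ∑ p ∈ R', ‖∫ t, blockKer N p t • g t‖ =
        ‖((∑ p ∈ R', ‖∫ t, blockKer N p t • g t‖ : ℝ) : ℂ)‖ := by
      rw [Complex.norm_real, Real.norm_of_nonneg]
      exact Finset.sum_nonneg fun _ _ => norm_nonneg _
    rw [e2, e1]
    have hbd : ∀ t ∈ uIoc 0 (kerPeriod N / 2), ‖∑ p ∈ R',
          c p * ∑ k ∈ blockIdx p, P k t‖ ≤
          2 * Real.pi / kerPeriod N * (m * (V + 2 * B)) := by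
      intro t ht
      rw [uIoc_of_le (by positivity)] at ht
      set S : ℕ → Finset ℕ := fun p => (blockIdx p).filter
          (fun k : ℕ => t + k * kerPeriod N ≤ Real.pi) with hS
      set v : ℕ → ℝ := fun p => ∑ k ∈ S p,
        ‖g (t + k * kerPeriod N + kerPeriod N / 2) - g (t + k * kerPeriod N)‖ / lam (k + 1) with hv
      have hv0 : ∀ p, 0 ≤ v p := fun p => Finset.sum_nonneg fun k _ =>
        div_nonneg (norm_nonneg _) (zero_le_one.trans (hlam _ (by omega)))
      -- Different blocks use disjoint sets of indices, and for fixed t the half-period intervals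
      -- run from left to right: together they are one admissible collection.
      have hvV : ∑ p ∈ R', v p ≤ V := by
        rw [hv, ← Finset.sum_biUnion]
        · refine hV _ (fun k => t + k * kerPeriod N)
            (fun k => t + k * kerPeriod N + kerPeriod N / 2) ?_ ?_
          · intro k hk
            rw [Finset.mem_biUnion] at hk
            obtain ⟨p, -, hk⟩ := hk
            have hk' := (Finset.mem_filter.1 hk).2
            refine ⟨by have := ht.1; positivity, by linarith, ?_⟩
            -- With N ≥ 1 half a period is at most π, so an interval that starts before π ends
            -- before 2π.
            have hN' : (1 : ℝ) ≤ N := by exact_mod_cast hN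
            have : kerPeriod N / 2 ≤ Real.pi := by
              have := mul_kerPeriod N
              nlinarith
            linarith
          · intro k _ l _ hkl
            have : (k : ℝ) + 1 ≤ l := by exact_mod_cast hkl
            nlinarith
        · intro p _ q _ hpq
          rw [Function.onFun, Finset.disjoint_left]
          intro k hk hk'
          have a1 := Finset.mem_Ico.1 (Finset.mem_filter.1 hk).1
          have a2 := Finset.mem_Ico.1 (Finset.mem_filter.1 hk').1
          rcases lt_or_gt_of_ne hpq with h | h
          · have : 2 ^ (p + 1) ≤ 2 ^ q := Nat.pow_le_pow_right (by norm_num) h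
            omega
          · have : 2 ^ (q + 1) ≤ 2 ^ p := Nat.pow_le_pow_right (by norm_num) h
            omega
      have hterm : ∀ p ∈ R', ‖c p * ∑ k ∈ blockIdx p, P k t‖ ≤
          2 * Real.pi / kerPeriod N * (m * v p + (1 / 2) ^ p * B) := by
        intro p hp
        rw [norm_mul]
        refine (mul_le_of_le_one_left (norm_nonneg _) (hc1 p)).trans ?_
        refine (norm_sum_le _ _).trans ?_
        refine (sum_norm_dirichletPos_pair_le h1 hmono N (hR'1 p hp) hB ht.1).trans ?_
        gcongr
        · exact hv0 p
        · exact hR'm p hp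
      refine (norm_sum_le _ _).trans ((Finset.sum_le_sum hterm).trans ?_)
      rw [← Finset.mul_sum, Finset.sum_add_distrib, ← Finset.mul_sum, ← Finset.sum_mul]
      gcongr
      have h2 := sum_half_pow_le (R := R') hm fun p hp => (hhalf p).trans (hR'm p hp)
      have h3 := mul_le_mul_of_nonneg_left hvV hm
      have h4 := mul_le_mul_of_nonneg_right h2 hB0
      linarith
    refine (intervalIntegral.norm_integral_le_of_norm_le_const hbd).trans (le_of_eq ?_)
    rw [sub_zero, abs_of_pos (by positivity)]
    field_simp
  have hmV : 0 ≤ Real.pi * m * V := by positivity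
  by_cases h0 : 0 ∈ R
  · rw [← Finset.add_sum_erase R _ h0]
    have := hzero h0
    nlinarith
  · rw [hR', Finset.erase_eq_of_notMem h0] at hmain
    have : 0 ≤ Real.pi * m * B := by positivity
    nlinarith

/-! ### Block integrals in several variables -/

theorem integral_eq_integral_insertNth {n : ℕ} (i : Fin (n + 1)) {F : (Fin (n + 1) → ℝ) → ℂ}
    (hF : Integrable F) :
    ∫ t, F t = ∫ y : Fin n → ℝ, ∫ u : ℝ, F (i.insertNth u y) := by
  have h := (volume_preserving_piFinSuccAbove (fun _ : Fin (n + 1) => ℝ) i).symm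
  rw [← h.integral_comp' F]
  have hint : Integrable (fun z => F ((MeasurableEquiv.piFinSuccAbove (fun _ => ℝ) i).symm z))
      ((volume : Measure ℝ).prod (volume : Measure (Fin n → ℝ))) :=
    h.integrable_comp_of_integrable hF
  exact integral_prod_symm _ hint

theorem integrable_integral_insertNth {n : ℕ} (i : Fin (n + 1)) {F : (Fin (n + 1) → ℝ) → ℂ}
    (hF : Integrable F) : Integrable fun y : Fin n → ℝ => ∫ u : ℝ, F (i.insertNth u y) := by
  have h := (volume_preserving_piFinSuccAbove (fun _ : Fin (n + 1) => ℝ) i).symm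
  have hint : Integrable (fun z => F ((MeasurableEquiv.piFinSuccAbove (fun _ => ℝ) i).symm z))
      ((volume : Measure ℝ).prod (volume : Measure (Fin n → ℝ))) :=
    h.integrable_comp_of_integrable hF
  exact hint.integral_prod_right

theorem ae_aestronglyMeasurable_insertNth {n : ℕ} (i : Fin (n + 1)) {F : (Fin (n + 1) → ℝ) → ℂ}
    (hF : AEStronglyMeasurable F volume) :
    ∀ᵐ y : Fin n → ℝ, AEStronglyMeasurable (fun u : ℝ => F (i.insertNth u y)) volume := by
  have h := (volume_preserving_piFinSuccAbove (fun _ : Fin (n + 1) => ℝ) i).symm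
  have hm : AEStronglyMeasurable
      (fun z => F ((MeasurableEquiv.piFinSuccAbove (fun _ => ℝ) i).symm z))
      ((volume : Measure ℝ).prod (volume : Measure (Fin n → ℝ))) :=
    hF.comp_measurePreserving h
  exact hm.prod_swap.prodMk_left

/-- The integral of `G` against a product of dyadic blocks of Dirichlet kernels. -/
noncomputable def blockIntegral {d : ℕ} (G : (Fin d → ℝ) → ℂ) (N P : Fin d → ℕ) : ℂ :=
  ∫ t, (∏ j, blockKer (N j) (P j) (t j)) • G t

theorem integral_prod_abs_blockKer_le {d : ℕ} (N P : Fin d → ℕ) :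
    ∫ t : Fin d → ℝ, ∏ j, |blockKer (N j) (P j) (t j)| ≤ (4 * Real.pi) ^ d := by
  rw [integral_fintype_prod_volume_eq_prod (fun j u => |blockKer (N j) (P j) u|)]
  refine (Finset.prod_le_prod (fun j _ => integral_nonneg fun _ => abs_nonneg _)
    fun j _ => integral_abs_blockKer_le (N j) (P j)).trans (le_of_eq ?_)
  simp

theorem integrable_prod_abs_blockKer {d : ℕ} (N P : Fin d → ℕ) :
    Integrable fun t : Fin d → ℝ => ∏ j, |blockKer (N j) (P j) (t j)| :=
  Integrable.fintype_prod fun j => (integrable_blockKer (N j) (P j)).abs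

/-- Fubini separates the i-th variable, where the one-dimensional estimate holds on almost every
line; each remaining kernel costs its L¹ norm, at most 4π. The phases again bring the sum inside the
integral. -/
theorem sum_norm_blockIntegral_insertNth_le {n : ℕ} {lam : ℕ → ℝ} (h1 : 1 < lam 1)
    (hmono : MonotoneOn lam (Ici 1)) {N : Fin (n + 1) → ℕ} (hN : ∀ j, 1 ≤ N j)
    {G : (Fin (n + 1) → ℝ) → ℂ} (hG : AEStronglyMeasurable G volume) {B V m : ℝ}
    (hB : ∀ t, ‖G t‖ ≤ B) (i : Fin (n + 1))
    (hV : ∀ y : Fin n → ℝ, OrderedVarLE lam V fun u => G (i.insertNth u y))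
    {R : Finset ℕ} (hm : 0 ≤ m) (hR : ∀ p ∈ R, dyadicRatio lam p ≤ m) (q : Fin n → ℕ) :
    ∑ p ∈ R, ‖blockIntegral G N (i.insertNth p q)‖ ≤
      (4 * Real.pi) ^ n * (6 * Real.pi * m * (V + B)) := by
  have hB0 : 0 ≤ B := (norm_nonneg _).trans (hB 0)
  have hV0 : 0 ≤ V := by simpa using hV 0 ∅ 0 0 (by simp) (by simp)
  choose c hc1 hc2 using fun p => exists_mul_eq_norm (blockIntegral G N (i.insertNth p q))
  have hint : ∀ p, Integrable fun t : Fin (n + 1) → ℝ =>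
      (∏ j, blockKer (N j) ((i.insertNth p q : Fin (n + 1) → ℕ) j) (t j)) • G t := fun p =>
    integrable_prod_smul hG hB fun j => integrable_blockKer _ _
  set Q : (Fin n → ℝ) → ℝ := fun y => ∏ j, blockKer (N (i.succAbove j)) (q j) (y j) with hQ
  set T : ℕ → (Fin n → ℝ) → ℂ := fun p y => ∫ u, blockKer (N i) p u • G (i.insertNth u y) with hT
  have hinner : ∀ p y, ∫ u : ℝ, (∏ j, blockKer (N j) ((i.insertNth p q : Fin (n + 1) → ℕ) j)
      ((i.insertNth u y : Fin (n + 1) → ℝ) j)) • G (i.insertNth u y) = Q y • T p y := by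
    intro p y
    rw [hT, ← integral_smul]
    refine integral_congr_ae (ae_of_all _ fun u => ?_)
    simp only [i.prod_univ_succAbove, Fin.insertNth_apply_same, Fin.insertNth_apply_succAbove]
    rw [smul_smul, mul_comm]
  have hQT : ∀ p, Integrable fun y => Q y • T p y := by
    intro p
    have := integrable_integral_insertNth i (hint p)
    simpa only [hinner] using this
  have hbi : ∀ p, blockIntegral G N (i.insertNth p q) = ∫ y, Q y • T p y := by
    intro p
    rw [blockIntegral, integral_eq_integral_insertNth i (hint p)]
    simp only [hinner]
  have e1 : ∑ p ∈ R, ‖blockIntegral G N (i.insertNth p q)‖ =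
      ‖∫ y, ∑ p ∈ R, c p * (Q y • T p y)‖ := by
    rw [integral_finsetSum _ fun p _ => (hQT p).const_mul (c p)]
    have : ∑ p ∈ R, ∫ y, c p * (Q y • T p y) =
        ((∑ p ∈ R, ‖blockIntegral G N (i.insertNth p q)‖ : ℝ) : ℂ) := by
      push_cast
      refine Finset.sum_congr rfl fun p _ => ?_
      rw [← hc2, integral_const_mul, hbi]
    rw [this, Complex.norm_real, Real.norm_of_nonneg]
    exact Finset.sum_nonneg fun _ _ => norm_nonneg _
  rw [e1]
  have hdom : ‖∫ y, ∑ p ∈ R, c p * (Q y • T p y)‖ ≤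
      ∫ y : Fin n → ℝ, (∏ j, |blockKer (N (i.succAbove j)) (q j) (y j)|) *
        (6 * Real.pi * m * (V + B)) := by
    refine norm_integral_le_of_norm_le
      ((integrable_prod_abs_blockKer (fun j => N (i.succAbove j)) q).mul_const _) ?_
    filter_upwards [ae_aestronglyMeasurable_insertNth i hG] with y hy
    have h := sum_norm_integral_blockKer_le h1 hmono (hN i) hy (fun u => hB _) (hV y) hm hR
    rw [← Finset.abs_prod]
    calc ‖∑ p ∈ R, c p * (Q y • T p y)‖ ≤ ∑ p ∈ R, |Q y| * ‖T p y‖ := by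
          refine (norm_sum_le _ _).trans (Finset.sum_le_sum fun p _ => ?_)
          rw [norm_mul, norm_smul, Real.norm_eq_abs]
          exact mul_le_of_le_one_left (by positivity) (hc1 p)
      _ ≤ |Q y| * (6 * Real.pi * m * (V + B)) := by
          rw [← Finset.mul_sum]
          exact mul_le_mul_of_nonneg_left h (abs_nonneg _)
  refine hdom.trans ?_
  rw [integral_mul_const]
  have := integral_prod_abs_blockKer_le (fun j => N (i.succAbove j)) q
  have hpi := Real.pi_pos
  gcongr

theorem sum_indicator_Ico {a : ℕ → ℝ} (ha : Monotone a) (F : ℝ → ℝ) (K : ℕ) (t : ℝ) :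
    ∑ p ∈ Finset.range K, (Ico (a p) (a (p + 1))).indicator F t =
      (Ico (a 0) (a K)).indicator F t := by
  induction K with
  | zero => simp
  | succ K ih =>
    rw [Finset.sum_range_succ, ih, ← Ico_union_Ico_eq_Ico (ha (Nat.zero_le K)) (ha (Nat.le_succ K)),
      indicator_union_of_disjoint]
    exact Set.disjoint_left.2 fun x hx hx' => absurd hx.2 (not_lt.2 hx'.1)

/-- Blocks 0, …, N cover (0, π], because 2^{N+1} - 1 ≥ N + 1 periods have total length more than π.
-/
theorem dirichletPos_eq_sum_blockKer (N : ℕ) (t : ℝ) :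
    dirichletPos N t = ∑ p ∈ Finset.range (N + 1), blockKer N p t := by
  have hh := kerPeriod_pos N
  unfold blockKer
  have ha : Monotone fun p : ℕ => ((2 : ℝ) ^ p - 1) * kerPeriod N := by
    intro p q hpq
    have : (2 : ℝ) ^ p ≤ 2 ^ q := pow_le_pow_right₀ (by norm_num) hpq
    simp only
    gcongr
  rw [sum_indicator_Ico ha]
  by_cases ht : t ∈ Ioc 0 Real.pi
  · rw [indicator_of_mem]
    refine ⟨by simpa using ht.1.le, ht.2.trans_lt ?_⟩
    have h2 : ((N : ℝ) + 2) ≤ 2 ^ (N + 1) := by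
      have : N + 1 < 2 ^ (N + 1) := Nat.lt_two_pow_self
      exact_mod_cast this
    have := mul_kerPeriod N
    nlinarith [Real.pi_pos]
  · have h0 : dirichletPos N t = 0 := indicator_of_notMem ht _
    rw [h0, indicator_apply_eq_zero.2 fun _ => h0]

theorem integral_prod_dirichletPos_eq_sum {d : ℕ} {G : (Fin d → ℝ) → ℂ}
    (hG : AEStronglyMeasurable G volume) {B : ℝ} (hB : ∀ t, ‖G t‖ ≤ B) (N : Fin d → ℕ) :
    ∫ t, (∏ j, dirichletPos (N j) (t j)) • G t =
      ∑ P ∈ Fintype.piFinset fun j => Finset.range (N j + 1), blockIntegral G N P := by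
  unfold blockIntegral
  rw [← integral_finsetSum]
  · refine integral_congr_ae (ae_of_all _ fun t => ?_)
    simp only [dirichletPos_eq_sum_blockKer]
    rw [Finset.prod_univ_sum, Finset.sum_smul]
  · exact fun P _ => integrable_prod_smul hG hB fun j => integrable_blockKer _ _

theorem norm_blockIntegral_le {d : ℕ} {G : (Fin d → ℝ) → ℂ} {ε δ : ℝ} (hε : 0 ≤ ε)
    (hG : ∀ t : Fin d → ℝ, (∀ j, 0 < t j ∧ t j < δ) → ‖G t‖ ≤ ε) {N P : Fin d → ℕ}
    (hN : ∀ j, (2 ^ (P j + 1) - 1) * kerPeriod (N j) ≤ δ) :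
    ‖blockIntegral G N P‖ ≤ (4 * Real.pi) ^ d * ε := by
  have h : ‖blockIntegral G N P‖ ≤
      ∫ t : Fin d → ℝ, (∏ j, |blockKer (N j) (P j) (t j)|) * ε := by
    refine norm_integral_le_of_norm_le ((integrable_prod_abs_blockKer N P).mul_const _)
      (ae_of_all _ fun t => ?_)
    rw [norm_smul, Real.norm_eq_abs, Finset.abs_prod]
    by_cases ht : ∀ j, blockKer (N j) (P j) (t j) ≠ 0
    · refine mul_le_mul_of_nonneg_left (hG t fun j => ?_)
        (Finset.prod_nonneg fun _ _ => abs_nonneg _)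
      have h1 := mem_of_indicator_ne_zero (ht j)
      have h2 : dirichletPos (N j) (t j) ≠ 0 := by
        have := ht j
        unfold blockKer at this
        rwa [indicator_of_mem h1] at this
      exact ⟨(mem_of_indicator_ne_zero h2).1, h1.2.trans_le (hN j)⟩
    · push Not at ht
      obtain ⟨j, hj⟩ := ht
      rw [Finset.prod_eq_zero (Finset.mem_univ j) (by rw [hj, abs_zero])]
      simp
  refine h.trans ?_
  rw [integral_mul_const]
  exact mul_le_mul_of_nonneg_right (integral_prod_abs_blockKer_le N P) hε

theorem tendsto_kerPeriod {ι : Type*} {l : Filter ι} {N : ι → ℕ} (hN : Tendsto N l atTop) :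
    Tendsto (fun a => kerPeriod (N a)) l (𝓝 0) := by
  unfold kerPeriod
  refine Tendsto.div_atTop tendsto_const_nhds ?_
  exact tendsto_atTop_add_const_right _ _ (tendsto_natCast_atTop_atTop.comp hN)

/-- For a fixed tuple the box of the block shrinks to the origin while the L¹ norm of the kernel
stays bounded. -/
theorem tendsto_blockIntegral {ι : Type*} {l : Filter ι} {d : ℕ} {G : ι → (Fin d → ℝ) → ℂ}
    {N : ι → Fin d → ℕ} (hN : ∀ j, Tendsto (fun a => N a j) l atTop)
    (hG : ∀ ε > 0, ∃ δ > 0, ∀ᶠ a in l, ∀ t : Fin d → ℝ, (∀ j, 0 < t j ∧ t j < δ) → ‖G a t‖ ≤ ε)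
    (P : Fin d → ℕ) : Tendsto (fun a => blockIntegral (G a) (N a) P) l (𝓝 0) := by
  rw [Metric.tendsto_nhds]
  intro ε hε
  have hpi := Real.pi_pos
  have hK : 0 < (4 * Real.pi) ^ d + 1 := by positivity
  obtain ⟨δ, hδ, h⟩ := hG (ε / ((4 * Real.pi) ^ d + 1)) (by positivity)
  have hsmall : ∀ᶠ a in l, ∀ j, (2 ^ (P j + 1) - 1) * kerPeriod (N a j) ≤ δ := by
    rw [eventually_all]
    intro j
    have := (tendsto_kerPeriod (hN j)).const_mul ((2 : ℝ) ^ (P j + 1) - 1)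
    rw [mul_zero] at this
    exact (this.eventually (gt_mem_nhds hδ)).mono fun _ h => le_of_lt h
  filter_upwards [h, hsmall] with a ha hs
  rw [dist_zero_right]
  refine (norm_blockIntegral_le (by positivity) ha hs).trans_lt ?_
  rw [mul_div_assoc', div_lt_iff₀ hK]
  nlinarith

/-! ### Summation over tuples of blocks -/

/-- The contribution of the block tuples whose smallest dyadic ratio is at coordinate `i`,
with the other coordinates of the tuple given by `q`. -/
noncomputable def blockTail {n : ℕ} (lam : ℕ → ℝ) (G : (Fin (n + 1) → ℝ) → ℂ)
    (N : Fin (n + 1) → ℕ) (i : Fin (n + 1)) (q : Fin n → ℕ) : ℝ :=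
  ∑ p ∈ (Finset.range (N i + 1)).filter
      (fun p => dyadicRatio lam p ≤ dyadicRatio lam (Finset.univ.sup q)),
    ‖blockIntegral G N (i.insertNth p q)‖

theorem blockTail_nonneg {n : ℕ} (lam : ℕ → ℝ) (G : (Fin (n + 1) → ℝ) → ℂ)
    (N : Fin (n + 1) → ℕ) (i : Fin (n + 1)) (q : Fin n → ℕ) : 0 ≤ blockTail lam G N i q :=
  Finset.sum_nonneg fun _ _ => norm_nonneg _

theorem norm_integral_prod_dirichletPos_le {n : ℕ} (hn : 1 ≤ n) {lam : ℕ → ℝ}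
    {G : (Fin (n + 1) → ℝ) → ℂ} (hG : AEStronglyMeasurable G volume) {B : ℝ}
    (hB : ∀ t, ‖G t‖ ≤ B) {N : Fin (n + 1) → ℕ} (hs : ∀ i, Summable (blockTail lam G N i)) :
    ‖∫ t, (∏ j, dirichletPos (N j) (t j)) • G t‖ ≤ ∑ i, ∑' q, blockTail lam G N i q := by
  have : Nonempty (Fin n) := ⟨⟨0, hn⟩⟩
  rw [integral_prod_dirichletPos_eq_sum hG hB]
  refine (norm_sum_le _ _).trans ?_
  set box := Fintype.piFinset fun j => Finset.range (N j + 1) with hbox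
  -- Take i of least ratio; the supremum of the other indices is one of them, which uses n ≥ 1.
  -- Ratios are compared instead of indices because the ratio need not be monotone.
  have h1 : ∀ P : Fin (n + 1) → ℕ, ∃ i : Fin (n + 1),
      dyadicRatio lam (P i) ≤ dyadicRatio lam (Finset.univ.sup (i.removeNth P)) := by
    intro P
    obtain ⟨i, -, hi⟩ := Finset.exists_min_image Finset.univ (fun j => dyadicRatio lam (P j))
      Finset.univ_nonempty
    obtain ⟨j, -, hj⟩ := Finset.exists_mem_eq_sup Finset.univ Finset.univ_nonempty
      (i.removeNth P)
    exact ⟨i, by rw [hj]; exact hi _ (Finset.mem_univ _)⟩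
  have h2 : ∑ P ∈ box, ‖blockIntegral G N P‖ ≤ ∑ i, ∑ P ∈ box.filter (fun P =>
      dyadicRatio lam (P i) ≤ dyadicRatio lam (Finset.univ.sup (i.removeNth P))),
        ‖blockIntegral G N P‖ := by
    simp_rw [Finset.sum_filter]
    rw [Finset.sum_comm]
    refine Finset.sum_le_sum fun P _ => ?_
    obtain ⟨i, hi⟩ := h1 P
    refine le_trans (le_of_eq ?_) (Finset.single_le_sum (f := fun i : Fin (n + 1) =>
      if dyadicRatio lam (P i) ≤ dyadicRatio lam (Finset.univ.sup (i.removeNth P)) then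
        ‖blockIntegral G N P‖ else 0) (fun j _ => by split_ifs <;> positivity) (Finset.mem_univ i))
    simp only [hi, if_true]
  refine h2.trans (Finset.sum_le_sum fun i _ => ?_)
  set box' := Fintype.piFinset fun j => Finset.range (N (i.succAbove j) + 1) with hbox'
  refine le_trans (le_of_eq ?_) ((hs i).sum_le_tsum box' fun q _ => blockTail_nonneg lam G N i q)
  unfold blockTail
  rw [Finset.sum_sigma']
  refine Finset.sum_nbij' (fun P => ⟨i.removeNth P, P i⟩) (fun z => i.insertNth z.2 z.1) ?_ ?_ ?_
    ?_ ?_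
  · intro P hP
    simp only [hbox, Finset.mem_filter, Fintype.mem_piFinset] at hP
    simp only [hbox', Finset.mem_sigma, Finset.mem_filter, Fintype.mem_piFinset]
    exact ⟨fun j => hP.1 _, hP.1 i, hP.2⟩
  · rintro ⟨q, p⟩ hz
    simp only [hbox', Finset.mem_sigma, Finset.mem_filter, Fintype.mem_piFinset] at hz
    simp only [hbox, Finset.mem_filter, Fintype.mem_piFinset, Fin.insertNth_apply_same,
      Fin.removeNth_insertNth]
    refine ⟨(Fin.forall_iff_succAbove i).2 ⟨?_, fun j => ?_⟩, hz.2.2⟩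
    · simpa using hz.2.1
    · simpa using hz.1 j
  · intro P _
    simp
  · rintro ⟨q, p⟩ _
    simp
  · intro P _
    simp

/-- Integrals against products of one-sided Dirichlet kernels tend to zero for functions that are
uniformly bounded, of uniformly bounded partial `Λ`-variation, and small near the origin. -/
theorem tendsto_integral_prod_dirichletPos {ι : Type*} {l : Filter ι} {n : ℕ} (hn : 1 ≤ n)
    {lam : ℕ → ℝ} (h1 : 1 < lam 1) (hmono : MonotoneOn lam (Ici 1))
    (hsum : Summable fun q : Fin n → ℕ => dyadicRatio lam (Finset.univ.sup q))
    (hlim : Tendsto (dyadicRatio lam) atTop (𝓝 0))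
    {G : ι → (Fin (n + 1) → ℝ) → ℂ} (hGm : ∀ a, AEStronglyMeasurable (G a) volume)
    {B V : ℝ} (hB : ∀ a t, ‖G a t‖ ≤ B)
    (hV : ∀ a (i : Fin (n + 1)) (y : Fin n → ℝ),
      OrderedVarLE lam V fun u => G a (i.insertNth u y))
    {N : ι → Fin (n + 1) → ℕ} (hN : ∀ j, Tendsto (fun a => N a j) l atTop)
    (hG : ∀ ε > 0, ∃ δ > 0, ∀ᶠ a in l,
      ∀ t : Fin (n + 1) → ℝ, (∀ j, 0 < t j ∧ t j < δ) → ‖G a t‖ ≤ ε) :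
    Tendsto (fun a => ∫ t, (∏ j, dirichletPos (N a j) (t j)) • G a t) l (𝓝 0) := by
  have hpi := Real.pi_pos
  rcases isEmpty_or_nonempty ι with hι | ⟨⟨a₀⟩⟩
  · rw [filter_eq_bot_of_isEmpty l]; exact tendsto_bot
  have hB0 : 0 ≤ B := (norm_nonneg _).trans (hB a₀ 0)
  have hV0 : 0 ≤ V := by simpa using hV a₀ 0 0 ∅ 0 0 (by simp) (by simp)
  have hc0 : ∀ p, 0 ≤ dyadicRatio lam p := by
    intro p
    have : lam 1 ≤ lam (2 ^ (p + 1)) :=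
      hmono (mem_Ici.2 le_rfl) (mem_Ici.2 Nat.one_le_two_pow) Nat.one_le_two_pow
    unfold dyadicRatio
    have : 0 ≤ lam (2 ^ (p + 1)) := by linarith
    positivity
  have hN1 : ∀ᶠ a in l, ∀ j, 1 ≤ N a j := by
    rw [eventually_all]; exact fun j => (hN j).eventually_ge_atTop 1
  set K : ℝ := (4 * Real.pi) ^ n * (6 * Real.pi * (V + B)) with hK
  have hK0 : 0 ≤ K := by positivity
  have hdom : ∀ᶠ a in l, ∀ i q, blockTail lam (G a) (N a) i q ≤
      K * dyadicRatio lam (Finset.univ.sup q) := by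
    filter_upwards [hN1] with a ha i q
    refine (sum_norm_blockIntegral_insertNth_le h1 hmono ha (hGm a) (hB a) i (hV a i) (hc0 _)
      (fun p hp => (Finset.mem_filter.1 hp).2) q).trans (le_of_eq ?_)
    rw [hK]; ring
  -- The range of p grows with N, so it is cut at p₀: finitely many blocks vanish one by one, and
  -- the rest have small ratios and are controlled uniformly by the one-coordinate estimate.
  have hzero : ∀ i q, Tendsto (fun a => blockTail lam (G a) (N a) i q) l (𝓝 0) := by
    intro i q
    rw [Metric.tendsto_nhds]
    intro ε hε
    obtain ⟨p₀, hp₀⟩ : ∃ p₀, ∀ p ≥ p₀, dyadicRatio lam p ≤ ε / (2 * (K + 1)) :=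
      eventually_atTop.1 ((hlim.eventually (gt_mem_nhds (by positivity))).mono
        fun _ h => le_of_lt h)
    have hfin : Tendsto (fun a => ∑ p ∈ Finset.range p₀,
        ‖blockIntegral (G a) (N a) (i.insertNth p q)‖) l (𝓝 0) := by
      have := tendsto_finsetSum (Finset.range p₀) fun p _ =>
        (tendsto_blockIntegral hN hG (i.insertNth p q)).norm
      simpa using this
    filter_upwards [hN1, hfin.eventually (gt_mem_nhds (half_pos hε))] with a ha hfa
    rw [dist_zero_right, Real.norm_of_nonneg (blockTail_nonneg _ _ _ _ _)]
    have h2 := sum_norm_blockIntegral_insertNth_le h1 hmono ha (hGm a) (hB a) i (hV a i)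
      (R := (Finset.range (N a i + 1)).filter fun p => p₀ ≤ p)
      (m := ε / (2 * (K + 1))) (by positivity)
      (fun p hp => hp₀ p (Finset.mem_filter.1 hp).2) q
    have h3 : (4 * Real.pi) ^ n * (6 * Real.pi * (ε / (2 * (K + 1))) * (V + B)) ≤ ε / 2 := by
      rw [show (4 * Real.pi) ^ n * (6 * Real.pi * (ε / (2 * (K + 1))) * (V + B)) =
        K * (ε / (2 * (K + 1))) by rw [hK]; ring, mul_div_assoc', div_le_div_iff₀ (by positivity)
        (by norm_num)]
      nlinarith
    have h4 : blockTail lam (G a) (N a) i q ≤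
        ∑ p ∈ Finset.range p₀, ‖blockIntegral (G a) (N a) (i.insertNth p q)‖ +
        ∑ p ∈ (Finset.range (N a i + 1)).filter fun p => p₀ ≤ p,
          ‖blockIntegral (G a) (N a) (i.insertNth p q)‖ := by
      unfold blockTail
      rw [← Finset.sum_union]
      · refine Finset.sum_le_sum_of_subset_of_nonneg (fun p hp => ?_) fun _ _ _ => norm_nonneg _
        have := (Finset.mem_filter.1 hp).1
        rw [Finset.mem_union, Finset.mem_filter, Finset.mem_range]
        rcases lt_or_ge p p₀ with h | h
        · exact Or.inl h
        · exact Or.inr ⟨this, h⟩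
      · rw [Finset.disjoint_left]
        intro p hp hp'
        exact absurd (Finset.mem_range.1 hp) (not_lt.2 (Finset.mem_filter.1 hp').2)
    linarith
  have htsum : ∀ i, Tendsto (fun a => ∑' q, blockTail lam (G a) (N a) i q) l (𝓝 0) := by
    intro i
    have := tendsto_tsum_of_dominated_convergence (𝓕 := l)
      (f := fun a q => blockTail lam (G a) (N a) i q) (g := fun _ => 0)
      (hsum.mul_left K) (hzero i) (hdom.mono fun a ha q => by
        rw [Real.norm_of_nonneg (blockTail_nonneg _ _ _ _ _)]; exact ha i q)
    simpa using this
  have htot : Tendsto (fun a => ∑ i, ∑' q, blockTail lam (G a) (N a) i q) l (𝓝 0) := by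
    have := tendsto_finsetSum Finset.univ fun i _ => htsum i
    simpa using this
  refine squeeze_zero_norm' ?_ htot
  filter_upwards [hdom] with a ha
  exact norm_integral_prod_dirichletPos_le hn (hGm a) (hB a) fun i =>
    Summable.of_nonneg_of_le (fun q => blockTail_nonneg _ _ _ _ _) (ha i) (hsum.mul_left K)

/-! ### Condensation of the summability hypothesis -/

theorem dyadicRatio_nonneg {lam : ℕ → ℝ} (h1 : 1 < lam 1) (hmono : MonotoneOn lam (Ici 1))
    (p : ℕ) : 0 ≤ dyadicRatio lam p := by
  have : lam 1 ≤ lam (2 ^ (p + 1)) :=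
    hmono (mem_Ici.2 le_rfl) (mem_Ici.2 Nat.one_le_two_pow) Nat.one_le_two_pow
  unfold dyadicRatio
  have : 0 ≤ lam (2 ^ (p + 1)) := by linarith
  positivity

theorem summable_dyadicRatio_mul_pow {lam : ℕ → ℝ} (h1 : 1 < lam 1)
    (hmono : MonotoneOn lam (Ici 1)) {e : ℕ}
    (hs : Summable fun n : ℕ => lam n * Real.log n ^ e / (n : ℝ) ^ 2) :
    Summable fun p : ℕ => dyadicRatio lam p * ((p : ℝ) + 1) ^ e := by
  set a : ℕ → ℝ := fun n => lam n * Real.log n ^ e / (n : ℝ) ^ 2 with ha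
  have hlam : ∀ k : ℕ, 1 ≤ k → 0 ≤ lam k := fun k hk =>
    (by linarith [hmono (mem_Ici.2 le_rfl) (mem_Ici.2 hk) hk])
  have hlog2 : 0 < Real.log 2 := Real.log_pos (by norm_num)
  -- The 8 comes from 2^{p+1} terms, each with denominator at most (2^{p+2})².
  have hterm : ∀ p : ℕ, dyadicRatio lam p * ((p : ℝ) + 1) ^ e * (Real.log 2 ^ e / 8) ≤
      ∑ k ∈ Finset.Ico (2 ^ (p + 1)) (2 ^ (p + 2)), a k := by
    intro p
    have hcard : (Finset.Ico (2 ^ (p + 1)) (2 ^ (p + 2))).card = 2 ^ (p + 1) := by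
      rw [Nat.card_Ico, pow_succ 2 (p + 1)]; omega
    have : ∀ k ∈ Finset.Ico (2 ^ (p + 1)) (2 ^ (p + 2)),
        lam (2 ^ (p + 1)) * (((p : ℝ) + 1) * Real.log 2) ^ e / (2 ^ (p + 2)) ^ 2 ≤ a k := by
      intro k hk
      rw [Finset.mem_Ico] at hk
      have hk1 : 1 ≤ k := Nat.one_le_two_pow.trans hk.1
      have hkr : ((2 : ℝ) ^ (p + 1)) ≤ k := by exact_mod_cast hk.1
      have hkr' : (k : ℝ) ≤ 2 ^ (p + 2) := by exact_mod_cast hk.2.le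
      have hl : ((p : ℝ) + 1) * Real.log 2 ≤ Real.log k := by
        have := Real.log_le_log (by positivity) hkr
        rw [Real.log_pow] at this
        push_cast at this
        exact this
      have hk0 : (0 : ℝ) < k := by exact_mod_cast hk1
      have := hlam k hk1
      have hm : lam (2 ^ (p + 1)) ≤ lam k :=
        hmono (mem_Ici.2 Nat.one_le_two_pow) (mem_Ici.2 hk1) hk.1
      simp only [ha]
      gcongr
    have h := Finset.card_nsmul_le_sum _ _ _ this
    rw [hcard, nsmul_eq_mul] at h
    refine le_trans (le_of_eq ?_) h
    unfold dyadicRatio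
    rw [mul_pow]
    push_cast
    have h2 : (2 : ℝ) ^ (p + 1) = 2 * 2 ^ p := by ring
    have h3 : (2 : ℝ) ^ (p + 2) = 4 * 2 ^ p := by ring
    rw [h2, h3]
    field_simp
    ring
  have hs' : Summable fun p : ℕ => dyadicRatio lam p * ((p : ℝ) + 1) ^ e * (Real.log 2 ^ e / 8) := by
    refine summable_of_sum_range_le (c := ∑' n, |a n|) (fun p => ?_) fun P => ?_
    · have := dyadicRatio_nonneg h1 hmono p
      positivity
    · refine (Finset.sum_le_sum fun p _ => hterm p).trans ?_
      have : ∀ P : ℕ, ∑ p ∈ Finset.range P, ∑ k ∈ Finset.Ico (2 ^ (p + 1)) (2 ^ (p + 2)), a k =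
          ∑ k ∈ Finset.Ico 2 (2 ^ (P + 1)), a k := by
        intro P
        induction P with
        | zero => simp
        | succ P ih =>
          rw [Finset.sum_range_succ, ih, Finset.sum_Ico_consecutive]
          · exact le_self_pow₀ (by norm_num) (by omega)
          · exact Nat.pow_le_pow_right (by norm_num) (by omega)
      rw [this]
      exact (Finset.sum_le_sum fun k _ => le_abs_self _).trans
        (hs.abs.sum_le_tsum _ fun _ _ => abs_nonneg _)
  have hc : Real.log 2 ^ e / 8 ≠ 0 := by positivity
  exact (summable_mul_right_iff hc).1 hs'

theorem succ_pow_le (s m : ℕ) : (s + 1) ^ (m + 1) ≤ s ^ (m + 1) + (m + 1) * (s + 1) ^ m := by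
  induction m with
  | zero => simp
  | succ m ih =>
    have h : s ^ (m + 1) ≤ (s + 1) ^ (m + 1) := Nat.pow_le_pow_left (Nat.le_succ s) _
    calc (s + 1) ^ (m + 1 + 1) = (s + 1) ^ (m + 1) * (s + 1) := pow_succ _ _
      _ ≤ (s ^ (m + 1) + (m + 1) * (s + 1) ^ m) * (s + 1) := Nat.mul_le_mul_right _ ih
      _ = s ^ (m + 1 + 1) + s ^ (m + 1) + (m + 1) * (s + 1) ^ (m + 1) := by ring
      _ ≤ s ^ (m + 1 + 1) + (m + 1 + 1) * (s + 1) ^ (m + 1) := by linarith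

/-- The tuples with maximum s number (s+1)^{m+1} - s^{m+1} ≤ (m+1)(s+1)^m. -/
theorem summable_comp_sup {m : ℕ} {c : ℕ → ℝ} (hc : ∀ p, 0 ≤ c p)
    (hs : Summable fun p : ℕ => c p * ((p : ℝ) + 1) ^ m) :
    Summable fun q : Fin (m + 1) → ℕ => c (Finset.univ.sup q) := by
  refine summable_of_sum_le (c := ((m : ℝ) + 1) * ∑' p : ℕ, c p * ((p : ℝ) + 1) ^ m)
    (fun q => hc _) fun F => ?_
  rw [← Finset.sum_fiberwise_of_maps_to (s := F) (t := F.image fun q => Finset.univ.sup q)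
    (g := fun q => Finset.univ.sup q) (fun q hq => Finset.mem_image_of_mem _ hq)]
  rw [← tsum_mul_left]
  refine le_trans (Finset.sum_le_sum fun s _ => ?_) ((hs.mul_left ((m : ℝ) + 1)).sum_le_tsum _
    fun p _ => mul_nonneg (by positivity) (mul_nonneg (hc p) (by positivity)))
  have h1 : ∑ q ∈ F.filter (fun q => Finset.univ.sup q = s), c (Finset.univ.sup q) =
      (F.filter (fun q => Finset.univ.sup q = s)).card * c s := by
    rw [← nsmul_eq_mul, ← Finset.sum_const]
    exact Finset.sum_congr rfl fun q hq => by rw [(Finset.mem_filter.1 hq).2]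
  have h2 : (F.filter (fun q => Finset.univ.sup q = s)).card ≤ (m + 1) * (s + 1) ^ m := by
    have hsub : F.filter (fun q => Finset.univ.sup q = s) ⊆
        (Fintype.piFinset fun _ : Fin (m + 1) => Finset.range (s + 1)) \
          (Fintype.piFinset fun _ : Fin (m + 1) => Finset.range s) := by
      intro q hq
      have hq' := (Finset.mem_filter.1 hq).2
      rw [Finset.mem_sdiff, Fintype.mem_piFinset, Fintype.mem_piFinset]
      refine ⟨fun j => ?_, fun h => ?_⟩
      · rw [Finset.mem_range, Nat.lt_succ_iff, ← hq']
        exact Finset.le_sup (Finset.mem_univ j)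
      · obtain ⟨j, -, hj⟩ := Finset.exists_mem_eq_sup Finset.univ Finset.univ_nonempty q
        have := Finset.mem_range.1 (h j)
        omega
    refine (Finset.card_le_card hsub).trans ?_
    rw [Finset.card_sdiff_of_subset
      (Fintype.piFinset_subset _ _ fun _ => Finset.range_mono (Nat.le_succ s))]
    simp only [Fintype.card_piFinset, Finset.card_range, Finset.prod_const, Finset.card_univ,
      Fintype.card_fin, Nat.succ_eq_add_one]
    have := succ_pow_le s m
    omega
  rw [h1]
  have h3 : ((F.filter (fun q => Finset.univ.sup q = s)).card : ℝ) ≤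
      ((m : ℝ) + 1) * ((s : ℝ) + 1) ^ m := by exact_mod_cast h2
  calc _ ≤ ((m : ℝ) + 1) * ((s : ℝ) + 1) ^ m * c s := mul_le_mul_of_nonneg_right h3 (hc s)
    _ = _ := by ring

theorem tendsto_of_summable_mul_pow {m : ℕ} {c : ℕ → ℝ} (hc : ∀ p, 0 ≤ c p)
    (hs : Summable fun p : ℕ => c p * ((p : ℝ) + 1) ^ m) : Tendsto c atTop (𝓝 0) := by
  refine squeeze_zero hc (fun p => ?_) hs.tendsto_atTop_zero
  exact le_mul_of_one_le_right (hc p) (one_le_pow₀ (by linarith [(Nat.cast_nonneg p : (0 : ℝ) ≤ p)]))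

/-! ### Λ-variation, periodicity and boundedness -/

/-- The `Λ`-variation of `φ` over `[0, 2π]` is at most `V`. -/
def IntervalVarLE (lam : ℕ → ℝ) (V : ℝ) (φ : ℝ → ℂ) : Prop :=
  ∀ (m : ℕ) (a b : Fin m → ℝ), IsIntervalCollection a b →
    ∑ k : Fin m, ‖φ (b k) - φ (a k)‖ / lam ((k : ℕ) + 1) ≤ V

/-- The intervals `[u k, v k]`, `k ∈ S`, possibly degenerate, do not overlap. -/
def Nonoverlapping (S : Finset ℕ) (u v : ℕ → ℝ) : Prop :=
  ∀ k ∈ S, ∀ l ∈ S, k ≠ l → v k ≤ u l ∨ v l ≤ u k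

theorem Fin.val_le_of_strictMono {m : ℕ} {e : Fin m → ℕ} (he : StrictMono e) (k : Fin m) :
    (k : ℕ) ≤ e k := by
  obtain ⟨k, hk⟩ := k
  induction k with
  | zero => exact Nat.zero_le _
  | succ k ih =>
    have h := ih (by omega)
    have h' : e ⟨k, by omega⟩ < e ⟨k + 1, hk⟩ := he (by simp)
    simp only at h ⊢
    omega

section Variation

variable {lam : ℕ → ℝ} {V : ℝ} {φ : ℝ → ℂ}

/-- Dropping degenerate intervals and renumbering the others consecutively lowers their indices, so
the weights 1/λ can only grow. -/
theorem IntervalVarLE.sum_le (hφ : IntervalVarLE lam V φ) (h1 : 1 < lam 1)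
    (hmono : MonotoneOn lam (Ici 1)) {S : Finset ℕ} {u v : ℕ → ℝ}
    (huv : ∀ k ∈ S, 0 ≤ u k ∧ u k ≤ v k ∧ v k ≤ 2 * Real.pi) (hd : Nonoverlapping S u v) :
    ∑ k ∈ S, ‖φ (v k) - φ (u k)‖ / lam (k + 1) ≤ V := by
  have hpos : ∀ k : ℕ, 0 < lam (k + 1) := fun k => by
    linarith [hmono (mem_Ici.2 le_rfl) (mem_Ici.2 (Nat.le_add_left 1 k)) (Nat.le_add_left 1 k)]
  set S' := S.filter fun k => u k < v k with hS'
  set e := S'.orderEmbOfFin rfl with he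
  have heS : ∀ k, e k ∈ S ∧ u (e k) < v (e k) := fun k =>
    Finset.mem_filter.1 (Finset.orderEmbOfFin_mem S' rfl k)
  have hcoll : IsIntervalCollection (fun k => u (e k)) (fun k => v (e k)) := by
    refine ⟨fun k => (heS k).2, fun k => ⟨(huv _ (heS k).1).1, (huv _ (heS k).1).2.2⟩,
      fun k l hkl => ?_⟩
    rw [Set.disjoint_left]
    intro x hx hx'
    rcases hd _ (heS k).1 _ (heS l).1 (fun h => hkl (e.injective h)) with h | h
    · linarith [hx.2, hx'.1]
    · linarith [hx.1, hx'.2]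
  refine le_trans ?_ (hφ _ _ _ hcoll)
  have h2 : ∑ k ∈ S, ‖φ (v k) - φ (u k)‖ / lam (k + 1) =
      ∑ k ∈ S', ‖φ (v k) - φ (u k)‖ / lam (k + 1) := by
    rw [hS', Finset.sum_filter_of_ne]
    intro k hk hne
    refine lt_of_le_of_ne (huv k hk).2.1 fun h => hne ?_
    rw [h, sub_self, norm_zero, zero_div]
  have h3 : ∑ k ∈ S', ‖φ (v k) - φ (u k)‖ / lam (k + 1) =
      ∑ k, ‖φ (v (e k)) - φ (u (e k))‖ / lam (e k + 1) := by
    conv_lhs => rw [← Finset.map_orderEmbOfFin_univ S' rfl, Finset.sum_map]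
    rfl
  rw [h2, h3]
  refine Finset.sum_le_sum fun k _ => ?_
  have hk : (k : ℕ) ≤ e k := Fin.val_le_of_strictMono e.strictMono k
  have := hmono (mem_Ici.2 (Nat.le_add_left 1 (k : ℕ))) (mem_Ici.2 (Nat.le_add_left 1 (e k)))
    (Nat.add_le_add_right hk 1)
  exact div_le_div_of_nonneg_left (norm_nonneg _) (hpos _) this

theorem Nonoverlapping.comp {S : Finset ℕ} {u v : ℕ → ℝ} (h : Nonoverlapping S u v) {g : ℝ → ℝ}
    (hg : Monotone g) : Nonoverlapping S (fun k => g (u k)) (fun k => g (v k)) :=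
  fun k hk l hl hkl => (h k hk l hl hkl).imp (fun h => hg h) fun h => hg h

/-- A window of length 2π, moved to start in [0, 2π), meets at most two period cells. Cutting its
intervals at 2π yields two collections with the original indices, hence the factor 2. -/
theorem IntervalVarLE.sum_le_of_periodic (hφ : IntervalVarLE lam V φ) (h1 : 1 < lam 1)
    (hmono : MonotoneOn lam (Ici 1)) (hper : Function.Periodic φ (2 * Real.pi)) (y : ℝ)
    {S : Finset ℕ} {u v : ℕ → ℝ}
    (huv : ∀ k ∈ S, y ≤ u k ∧ u k ≤ v k ∧ v k ≤ y + 2 * Real.pi) (hd : Nonoverlapping S u v) :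
    ∑ k ∈ S, ‖φ (v k) - φ (u k)‖ / lam (k + 1) ≤ 2 * V := by
  have hpi := Real.pi_pos
  have hpos : ∀ k : ℕ, 0 < lam (k + 1) := fun k => by
    linarith [hmono (mem_Ici.2 le_rfl) (mem_Ici.2 (Nat.le_add_left 1 k)) (Nat.le_add_left 1 k)]
  obtain ⟨z, hz⟩ : ∃ z : ℤ, y - z * (2 * Real.pi) ∈ Ico 0 (2 * Real.pi) := by
    have := toIcoMod_mem_Ico Real.two_pi_pos 0 y
    rw [← self_sub_toIcoDiv_zsmul, zero_add, zsmul_eq_mul] at this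
    exact ⟨_, this⟩
  set c : ℝ := z * (2 * Real.pi) with hc
  have hsh : ∀ t, φ t = φ (t - c) := fun t => by rw [hc]; exact (hper.sub_int_mul_eq z).symm
  -- The two monotone maps send an interval to its parts before and after 2π, the second moved back
  -- to [0, 2π]; a missing part becomes degenerate.
  set lo : ℝ → ℝ := fun t => min (t - c) (2 * Real.pi) with hlo
  set hi : ℝ → ℝ := fun t => max (t - c) (2 * Real.pi) - 2 * Real.pi with hhi
  have hlom : Monotone lo := fun s t hst => min_le_min_right _ (by linarith)
  have hhim : Monotone hi := fun s t hst => sub_le_sub_right (max_le_max_right _ (by linarith)) _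
  have hsplit : ∀ s t, s ≤ t → ‖φ t - φ s‖ ≤ ‖φ (lo t) - φ (lo s)‖ + ‖φ (hi t) - φ (hi s)‖ := by
    intro s t hst
    have key : φ t - φ s = (φ (lo t) - φ (lo s)) + (φ (hi t) - φ (hi s)) := by
      have h : ∀ r, φ r = φ (lo r) + φ (hi r) - φ 0 := by
        intro r
        rw [hsh r]
        have h2 : φ (2 * Real.pi) = φ 0 := by simpa using hper 0
        rcases le_total (r - c) (2 * Real.pi) with h | h
        · simp only [hlo, hhi, min_eq_left h, max_eq_right h, sub_self]; ring
        · simp only [hlo, hhi, min_eq_right h, max_eq_left h, hper.sub_eq, h2]; ring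
      rw [h t, h s]; ring
    rw [key]
    exact norm_add_le _ _
  have hA := hφ.sum_le h1 hmono (u := fun k => lo (u k)) (v := fun k => lo (v k))
    (fun k hk => ⟨le_min (by linarith [(huv k hk).1, hz.1]) (by linarith), hlom (huv k hk).2.1,
      min_le_right _ _⟩) (hd.comp hlom)
  have hB := hφ.sum_le h1 hmono (u := fun k => hi (u k)) (v := fun k => hi (v k))
    (fun k hk => ⟨sub_nonneg.2 (le_max_right _ _), hhim (huv k hk).2.1, by
      rw [sub_le_iff_le_add]
      exact max_le (by linarith [(huv k hk).2.2, hz.2]) (by linarith)⟩) (hd.comp hhim)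
  refine le_trans (Finset.sum_le_sum fun k hk =>
    div_le_div_of_nonneg_right (hsplit _ _ (huv k hk).2.1) (hpos k).le) ?_
  simp_rw [add_div]
  rw [Finset.sum_add_distrib]
  linarith

theorem IntervalVarLE.orderedVarLE (hφ : IntervalVarLE lam V φ) (h1 : 1 < lam 1)
    (hmono : MonotoneOn lam (Ici 1)) (hper : Function.Periodic φ (2 * Real.pi)) (y : ℝ) :
    OrderedVarLE lam (2 * V) (fun t => φ (y + t)) ∧
      OrderedVarLE lam (2 * V) (fun t => φ (y - t)) := by
  constructor
  · intro S u v huv hd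
    refine hφ.sum_le_of_periodic h1 hmono hper y (u := fun k => y + u k) (v := fun k => y + v k)
      (fun k hk => ?_) fun k hk l hl hkl => ?_
    · obtain ⟨a, b, c⟩ := huv k hk
      exact ⟨by linarith, by linarith, by linarith⟩
    · rcases lt_or_gt_of_ne hkl with h | h
      · exact Or.inl (by linarith [hd k hk l hl h])
      · exact Or.inr (by linarith [hd l hl k hk h])
  · intro S u v huv hd
    simp_rw [norm_sub_rev (φ (y - v _))]
    refine hφ.sum_le_of_periodic h1 hmono hper (y - 2 * Real.pi) (u := fun k => y - v k)
      (v := fun k => y - u k) (fun k hk => ?_) fun k hk l hl hkl => ?_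
    · obtain ⟨a, b, c⟩ := huv k hk
      exact ⟨by linarith, by linarith, by linarith⟩
    · rcases lt_or_gt_of_ne hkl with h | h
      · exact Or.inr (by linarith [hd k hk l hl h])
      · exact Or.inl (by linarith [hd l hl k hk h])

end Variation

theorem IsPeriodicEach.eq_of_sub {d : ℕ} {f : (Fin d → ℝ) → ℂ} (hf : IsPeriodicEach f)
    {x y : Fin d → ℝ} {k : Fin d → ℤ} (h : ∀ j, x j = k j * (2 * Real.pi) + y j) : f x = f y := by
  rw [← hf.add_of_mem_span (int_mul_two_pi_mem_span k) y]
  congr 1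
  ext j
  exact h j

theorem exists_int_mul_two_pi_add (t : ℝ) :
    ∃ (z : ℤ) (s : ℝ), s ∈ Icc 0 (2 * Real.pi) ∧ t = z * (2 * Real.pi) + s := by
  have h := toIcoMod_mem_Ico Real.two_pi_pos 0 t
  refine ⟨toIcoDiv Real.two_pi_pos 0 t, toIcoMod Real.two_pi_pos 0 t, ⟨h.1, ?_⟩, ?_⟩
  · linarith [h.2]
  · rw [← self_sub_toIcoDiv_zsmul, zsmul_eq_mul]; ring

theorem IsPeriodicEach.periodic_update {d : ℕ} {f : (Fin d → ℝ) → ℂ} (hf : IsPeriodicEach f)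
    (z : Fin d → ℝ) (i : Fin d) :
    Function.Periodic (fun r => f (Function.update z i r)) (2 * Real.pi) := by
  intro r
  have := hf (Function.update z i r) i
  simpa using this

theorem intervalVarLE_of_mem_PBV {d : ℕ} {lam : ℕ → ℝ} (h1 : 1 < lam 1)
    (hmono : MonotoneOn lam (Ici 1)) {f : (Fin d → ℝ) → ℂ} (hf : f ∈ PBV d lam) (i : Fin d)
    (z : Fin d → ℝ) : IntervalVarLE lam (totalPartialVariation lam f).toReal
      (fun r => f (Function.update z i r)) := by
  intro m a b hab
  have hpos : ∀ k : ℕ, 0 < lam (k + 1) := fun k => by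
    linarith [hmono (mem_Ici.2 le_rfl) (mem_Ici.2 (Nat.le_add_left 1 k)) (Nat.le_add_left 1 k)]
  choose k s hs hk using fun j => exists_int_mul_two_pi_add (z j)
  set z' : Fin d → ℝ := Function.update s i 0 with hz'
  have hz'c : z' ∈ torusCube d := by
    intro j
    rcases eq_or_ne j i with rfl | h
    · simp [hz', Real.pi_pos.le]
    · rw [hz', Function.update_of_ne h]; exact hs j
  have heq : ∀ r, f (Function.update z i r) = f (Function.update z' i r) := by
    intro r
    refine hf.2.1.eq_of_sub (k := Function.update k i 0) fun j => ?_
    rcases eq_or_ne j i with rfl | h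
    · simp
    · simp [h, hz', hk j]
  simp_rw [heq]
  have hle : ∑ k : Fin m, ENNReal.ofReal
      (‖f (Function.update z' i (b k)) - f (Function.update z' i (a k))‖ / lam ((k : ℕ) + 1)) ≤
      totalPartialVariation lam f := by
    refine le_trans ?_ (Finset.single_le_sum (f := fun i => partialVariation lam i f)
      (fun _ _ => zero_le) (Finset.mem_univ i))
    unfold partialVariation
    exact le_iSup_of_le z' <| le_iSup_of_le hz'c <| le_iSup_of_le m <| le_iSup_of_le a <|
      le_iSup_of_le b <| le_iSup_of_le hab le_rfl
  rw [← ENNReal.ofReal_sum_of_nonneg fun (k : Fin m) _ =>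
    div_nonneg (norm_nonneg _) (hpos k).le] at hle
  exact (ENNReal.ofReal_le_iff_le_toReal hf.2.2.ne).1 hle

/-- Changing one coordinate is a collection with a single interval, so it moves f by at most 2Vλ_1;
d such changes lead from 0 to x. -/
theorem exists_bound_of_mem_PBV {d : ℕ} {lam : ℕ → ℝ} (h1 : 1 < lam 1)
    (hmono : MonotoneOn lam (Ici 1)) {f : (Fin d → ℝ) → ℂ} (hf : f ∈ PBV d lam) :
    ∃ B, ∀ x, ‖f x‖ ≤ B := by
  set V := (totalPartialVariation lam f).toReal
  have hstep : ∀ (x : Fin d → ℝ) (i : Fin d) (r : ℝ),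
      ‖f (Function.update x i r) - f (Function.update x i 0)‖ ≤ 2 * V * lam 1 := by
    intro x i r
    obtain ⟨z, s, hs, rfl⟩ := exists_int_mul_two_pi_add r
    have hper := hf.2.1.periodic_update x i
    have h := ((intervalVarLE_of_mem_PBV h1 hmono hf i x).orderedVarLE h1 hmono hper 0).1 {0}
      (fun _ => 0) (fun _ => s) (by simpa using hs) (by simp)
    simp only [zero_add, Finset.sum_singleton] at h
    rw [div_le_iff₀ (by linarith)] at h
    have e : f (Function.update x i (z * (2 * Real.pi) + s)) = f (Function.update x i s) := by
      have := hper.int_mul z s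
      simpa [add_comm] using this
    rw [e]
    exact h
  refine ⟨‖f 0‖ + d * (2 * V * lam 1), fun x => ?_⟩
  have key : ∀ A : Finset (Fin d), ‖f (A.piecewise x 0) - f 0‖ ≤ A.card * (2 * V * lam 1) := by
    intro A
    induction A using Finset.induction_on with
    | empty => simp
    | insert i A hi ih =>
      rw [Finset.card_insert_of_notMem hi, Finset.piecewise_insert]
      have h := hstep (A.piecewise x 0) i (x i)
      have e : Function.update (A.piecewise x 0) i 0 = A.piecewise x 0 := by
        rw [Function.update_eq_self_iff, Finset.piecewise_eq_of_notMem _ _ _ hi]; rfl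
      rw [e] at h
      have := norm_sub_le_norm_sub_add_norm_sub (f (Function.update (A.piecewise x 0) i (x i)))
        (f (A.piecewise x 0)) (f 0)
      push_cast
      linarith
  have := key Finset.univ
  rw [Finset.piecewise_univ, Finset.card_univ, Fintype.card_fin] at this
  have h' := norm_sub_norm_le (f x) (f 0)
  linarith

theorem orderedVarLE_reflect {n : ℕ} {lam : ℕ → ℝ} (h1 : 1 < lam 1)
    (hmono : MonotoneOn lam (Ici 1)) {f : (Fin (n + 1) → ℝ) → ℂ} (hf : f ∈ PBV (n + 1) lam)
    (x : Fin (n + 1) → ℝ) (s : Fin (n + 1) → Bool) (l : ℂ) (i : Fin (n + 1)) (y : Fin n → ℝ) :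
    OrderedVarLE lam (2 * (totalPartialVariation lam f).toReal)
      (fun u => f (x + reflect s (i.insertNth u y)) - l) := by
  set z : Fin (n + 1) → ℝ := x + reflect s (i.insertNth 0 y)
  have hz : ∀ u : ℝ, x + reflect s (i.insertNth u y) =
      Function.update z i (if s i = true then x i + u else x i - u) := by
    intro u
    ext j
    rcases eq_or_ne j i with rfl | h
    · simp only [reflect, Pi.add_apply, Fin.insertNth_apply_same, Function.update_self]
      split_ifs <;> ring
    · obtain ⟨k, rfl⟩ := Fin.exists_succAbove_eq h
      simp [z, reflect]
  have h := (intervalVarLE_of_mem_PBV h1 hmono hf i z).orderedVarLE h1 hmono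
    (hf.2.1.periodic_update z i) (x i)
  intro S u v huv hd
  simp only [sub_sub_sub_cancel_right, hz]
  by_cases hs : s i = true
  · simpa only [hs, if_true] using h.1 S u v huv hd
  · simpa only [hs, Bool.false_eq_true, if_false] using h.2 S u v huv hd

/-! ### Orthant limits and the convergence theorem -/

theorem tendsto_add_reflect {d : ℕ} (x : Fin d → ℝ) (s : Fin d → Bool) :
    Tendsto (fun r : ℝ => x + reflect s fun _ => r) (𝓝[>] 0) (orthantNhds x s) := by
  refine tendsto_nhdsWithin_iff.2 ⟨?_, ?_⟩
  · have : Continuous fun r : ℝ => x + reflect s fun _ => r := by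
      refine continuous_const.add (continuous_pi fun j => ?_)
      unfold reflect
      split_ifs <;> fun_prop
    have h := (this.tendsto 0).mono_left (nhdsWithin_le_nhds (s := Ioi 0))
    convert! h using 2
    ext j
    simp [reflect]
  · filter_upwards [self_mem_nhdsWithin] with r hr j
    have : (0 : ℝ) < r := hr
    by_cases h : s j = true <;> simp [reflect, h, this]

instance neBot_orthantNhds {d : ℕ} (x : Fin d → ℝ) (s : Fin d → Bool) : (orthantNhds x s).NeBot :=
  (tendsto_add_reflect x s).neBot

theorem exists_delta_of_tendsto_orthantNhds {d : ℕ} {f : (Fin d → ℝ) → ℂ} {x : Fin d → ℝ}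
    {s : Fin d → Bool} {l : ℂ} (h : Tendsto f (orthantNhds x s) (𝓝 l)) {ε : ℝ} (hε : 0 < ε) :
    ∃ δ > 0, ∀ t : Fin d → ℝ, (∀ j, 0 < t j ∧ t j < δ) → ‖f (x + reflect s t) - l‖ ≤ ε := by
  have h1 : ∀ᶠ y in orthantNhds x s, dist (f y) l < ε := Metric.tendsto_nhds.1 h ε hε
  obtain ⟨δ, hδ, hball⟩ := Metric.mem_nhdsWithin_iff.1 h1
  refine ⟨δ, hδ, fun t ht => ?_⟩
  rw [← dist_eq_norm]
  refine le_of_lt (hball ⟨?_, fun j => ?_⟩)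
  · rw [Metric.mem_ball, dist_pi_lt_iff hδ]
    intro j
    rw [Real.dist_eq, Pi.add_apply, add_sub_cancel_left]
    unfold reflect
    obtain ⟨h0, h1⟩ := ht j
    split_ifs
    · rwa [abs_of_pos h0]
    · rwa [abs_neg, abs_of_pos h0]
  · have := (ht j).1
    by_cases h : s j = true <;> simp [reflect, h, this]

theorem integral_prod_dirichletPos {d : ℕ} (N : Fin d → ℕ) :
    ∫ t : Fin d → ℝ, ∏ j, dirichletPos (N j) (t j) = Real.pi ^ d := by
  rw [integral_fintype_prod_volume_eq_prod (fun j u => dirichletPos (N j) u)]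
  simp [integral_dirichletPos]

/-- The product kernel has mass π^d on the positive orthant, so constants L s can be subtracted
under each orthant integral. -/
theorem rectPartialSum_sub_eq {d : ℕ} {f : (Fin d → ℝ) → ℂ} (hper : IsPeriodicEach f)
    (hf : AEStronglyMeasurable f volume) {B : ℝ} (hB : ∀ t, ‖f t‖ ≤ B)
    (N : Fin d → ℕ) (x : Fin d → ℝ) (L : (Fin d → Bool) → ℂ) :
    rectPartialSum f N x - (1 / (2 : ℂ) ^ d) * ∑ s, L s = (1 / (2 * (Real.pi : ℂ)) ^ d) *
      ∑ s : Fin d → Bool, ∫ t, (∏ j, dirichletPos (N j) (t j)) • (f (x + reflect s t) - L s) := by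
  have hpi : (Real.pi : ℂ) ≠ 0 := by exact_mod_cast Real.pi_ne_zero
  have hkey : ∀ s : Fin d → Bool,
      ∫ t, (∏ j, dirichletPos (N j) (t j)) • (f (x + reflect s t) - L s) =
      (∫ t, (∏ j, dirichletPos (N j) (t j)) • f (x + reflect s t)) - (Real.pi : ℂ) ^ d * L s := by
    intro s
    simp_rw [smul_sub]
    rw [integral_sub, integral_smul_const, integral_prod_dirichletPos, Complex.real_smul]
    · push_cast; rfl
    · exact integrable_prod_smul (aestronglyMeasurable_comp_reflect hf x s) (fun t => hB _)
        fun j => integrable_dirichletPos _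
    · exact (Integrable.fintype_prod (𝕜 := ℝ) fun j => integrable_dirichletPos (N j)).smul_const _
  simp_rw [hkey]
  rw [rectPartialSum_eq_sum_reflect hper hf hB, Finset.sum_sub_distrib, ← Finset.mul_sum, mul_sub,
    mul_pow]
  congr 1
  field_simp

section Convergence

variable {m : ℕ} {lam : ℕ → ℝ}

/-- The rectangular sums along a filter converge to the mean of the orthant limits, uniformly as
far as the orthant limits are attained uniformly. -/
theorem tendsto_rectPartialSum_sub {ι : Type*} {l : Filter ι} (h1 : 1 < lam 1)
    (hmono : MonotoneOn lam (Ici 1))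
    (hs : Summable fun n : ℕ => lam n * Real.log n ^ m / (n : ℝ) ^ 2)
    {f : (Fin (m + 2) → ℝ) → ℂ} (hf : f ∈ PBV (m + 2) lam)
    {x : ι → Fin (m + 2) → ℝ} {N : ι → Fin (m + 2) → ℕ} (hN : Tendsto N l atTop)
    {L : ι → (Fin (m + 2) → Bool) → ℂ} {B' : ℝ} (hL : ∀ a s, ‖L a s‖ ≤ B')
    (hlim : ∀ s, ∀ ε > 0, ∃ δ > 0, ∀ᶠ a in l, ∀ t : Fin (m + 2) → ℝ,
      (∀ j, 0 < t j ∧ t j < δ) → ‖f (x a + reflect s t) - L a s‖ ≤ ε) :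
    Tendsto (fun a => rectPartialSum f (N a) (x a) - (1 / (2 : ℂ) ^ (m + 2)) * ∑ s, L a s) l
      (𝓝 0) := by
  obtain ⟨B, hB⟩ := exists_bound_of_mem_PBV h1 hmono hf
  have hfm : AEStronglyMeasurable f volume := hf.1.aestronglyMeasurable
  have hsum := summable_dyadicRatio_mul_pow h1 hmono hs
  have hc := dyadicRatio_nonneg h1 hmono
  simp_rw [rectPartialSum_sub_eq hf.2.1 hfm hB]
  have hN' : ∀ j, Tendsto (fun a => N a j) l atTop := fun j =>
    tendsto_atTop.2 fun b => (tendsto_atTop.1 hN fun _ => b).mono fun _ h => h j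
  have key : ∀ s : Fin (m + 2) → Bool, Tendsto (fun a => ∫ t, (∏ j, dirichletPos (N a j) (t j)) •
      (f (x a + reflect s t) - L a s)) l (𝓝 0) := by
    intro s
    refine tendsto_integral_prod_dirichletPos (n := m + 1) (by omega) h1 hmono
      (summable_comp_sup hc hsum) (tendsto_of_summable_mul_pow hc hsum)
      (G := fun a t => f (x a + reflect s t) - L a s) (B := B + B')
      (fun a => (aestronglyMeasurable_comp_reflect hfm (x a) s).sub aestronglyMeasurable_const)
      (fun a t => (norm_sub_le _ _).trans (add_le_add (hB _) (hL a s)))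
      (fun a i y => orderedVarLE_reflect h1 hmono hf (x a) s (L a s) i y) hN' (hlim s)
  have := (tendsto_finsetSum Finset.univ fun s _ => key s).const_mul
    (1 / (2 * (Real.pi : ℂ)) ^ (m + 2))
  simpa using this

theorem isClassOfConvergence_PBV (h1 : 1 < lam 1) (hmono : MonotoneOn lam (Ici 1))
    (hs : Summable fun n : ℕ => lam n * Real.log n ^ m / (n : ℝ) ^ 2) :
    IsClassOfConvergence (PBV (m + 2) lam) := by
  intro f hf
  obtain ⟨B, hB⟩ := exists_bound_of_mem_PBV h1 hmono hf
  refine ⟨⟨hf.2.1, integrableOn_torusCube hf.1.aestronglyMeasurable hB⟩, fun x _ hreg => ?_,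
    fun K hK _ => ?_⟩
  · choose L hL using hreg
    have h := tendsto_rectPartialSum_sub (l := atTop) h1 hmono hs hf (x := fun _ => x)
      (N := fun N => N) tendsto_id (L := fun _ => L) (B' := ∑ s, ‖L s‖)
      (fun _ s => Finset.single_le_sum (f := fun s => ‖L s‖) (fun _ _ => norm_nonneg _)
        (Finset.mem_univ s))
      (fun s ε hε => by
        obtain ⟨δ, hδ, h⟩ := exists_delta_of_tendsto_orthantNhds (hL s) hε
        exact ⟨δ, hδ, Eventually.of_forall fun _ => h⟩)
    have e : regularValue f x = (1 / (2 : ℂ) ^ (m + 2)) * ∑ s, L s := by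
      unfold regularValue
      simp_rw [(hL _).limUnder_eq]
    rw [e]
    exact tendsto_sub_nhds_zero_iff.1 h
  · rintro ⟨U, hU, hKU, hfU⟩
    have hcont : ∀ x ∈ K, ContinuousAt f x := fun x hx =>
      hfU.continuousAt (hU.mem_nhds (hKU hx))
    have hval : ∀ x ∈ K, regularValue f x = (1 / (2 : ℂ) ^ (m + 2)) *
        ∑ _s : Fin (m + 2) → Bool, f x := by
      intro x hx
      unfold regularValue
      congr 1
      refine Finset.sum_congr rfl fun s _ => ?_
      have h : Tendsto f (orthantNhds x s) (𝓝 (f x)) :=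
        (hcont x hx).tendsto.mono_left nhdsWithin_le_nhds
      exact h.limUnder_eq
    -- Convergence along pairs (N, x), with x confined only to K, is uniform convergence on K.
    -- Compactness and continuity at the points of K give a δ valid for all x in K.
    have h := tendsto_rectPartialSum_sub (l := (atTop : Filter (Fin (m + 2) → ℕ)) ×ˢ 𝓟 K)
      h1 hmono hs hf (x := fun a => a.2) (N := fun a => a.1) tendsto_fst
      (L := fun a _ => f a.2) (B' := B) (fun a _ => hB _) (fun s ε hε => by
        have hu := hK.uniformContinuousAt_of_continuousAt f hcont (Metric.dist_mem_uniformity hε)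
        obtain ⟨δ, hδ, h⟩ := Metric.mem_uniformity_dist.1 hu
        refine ⟨δ, hδ, ?_⟩
        have hmem : ∀ᶠ a : (Fin (m + 2) → ℕ) × (Fin (m + 2) → ℝ) in atTop ×ˢ 𝓟 K, a.2 ∈ K :=
          tendsto_snd.eventually (mem_principal_self K)
        filter_upwards [hmem] with a ha t ht
        rw [← dist_eq_norm, dist_comm]
        refine le_of_lt (h ?_ ha)
        rw [dist_comm, dist_pi_lt_iff hδ]
        intro j
        rw [Real.dist_eq, Pi.add_apply, add_sub_cancel_left]
        unfold reflect
        obtain ⟨h0, h1⟩ := ht j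
        split_ifs
        · rwa [abs_of_pos h0]
        · rwa [abs_neg, abs_of_pos h0])
    rw [Metric.tendstoUniformlyOn_iff]
    intro ε hε
    have h2 := Metric.tendsto_nhds.1 h ε hε
    rw [eventually_prod_principal_iff] at h2
    filter_upwards [h2] with N hN x hx
    have := hN x hx
    rw [dist_zero_right] at this
    rwa [hval x hx, dist_comm, dist_eq_norm]

end Convergence

/-! ### Scales for the counterexample -/

theorem sum_Ico_inv_le {a b : ℕ} (ha : 1 ≤ a) :
    ∑ k ∈ Finset.Ico a b, (k : ℝ)⁻¹ ≤ 1 + Real.log b := by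
  refine le_trans ?_ (harmonic_le_one_add_log b)
  rw [harmonic_eq_sum_Icc]
  push_cast
  refine Finset.sum_le_sum_of_subset_of_nonneg (fun k hk => ?_) fun _ _ _ => by positivity
  rw [Finset.mem_Ico] at hk
  rw [Finset.mem_Icc]
  omega

/-- The right side is at least (δ-1) log n - log 2, and half of (δ-1) log n eventually absorbs log
2. -/
theorem log_floor_rpow_ratio {δ : ℝ} (hδ : 1 < δ) :
    ∀ᶠ n : ℕ in atTop, (δ - 1) / 2 * Real.log n ≤
      Real.log (((⌊(n : ℝ) ^ δ⌋₊ : ℝ) + 1) / ((n : ℝ) + 1)) := by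
  have h := (Real.tendsto_log_atTop.comp tendsto_natCast_atTop_atTop).eventually_ge_atTop
    (Real.log 2 / ((δ - 1) / 2))
  filter_upwards [h, eventually_ge_atTop 1] with n hn hn1
  have hn1' : (1 : ℝ) ≤ n := by exact_mod_cast hn1
  have hn0 : (0 : ℝ) < n := by linarith
  simp only [Function.comp_apply] at hn
  rw [div_le_iff₀ (by linarith)] at hn
  have h1 : (n : ℝ) ^ δ / (2 * n) ≤ ((⌊(n : ℝ) ^ δ⌋₊ : ℝ) + 1) / ((n : ℝ) + 1) := by
    gcongr
    · exact (Nat.lt_floor_add_one _).le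
    · linarith
  have h2 := Real.log_le_log (by positivity) h1
  rw [Real.log_div (by positivity) (by positivity), Real.log_rpow hn0,
    Real.log_mul (by norm_num) (by positivity)] at h2
  linarith

/-- Scales `n_0 < n_1 < ⋯` and amplitudes `a_s` adapted to a sequence `Λ` for which
`∑ λ_n log^m n / n²` diverges. -/
theorem exists_scales {m : ℕ} {lam : ℕ → ℝ} (h1 : 1 < lam 1) (hmono : MonotoneOn lam (Ici 1))
    (hanti : AntitoneOn (fun n : ℕ => lam n / (n : ℝ)) (Ici 1)) {δ : ℝ} (hδ : 1 < δ)
    (hO : (fun n : ℕ => lam n / (n : ℝ)) =O[atTop]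
      (fun n : ℕ => lam ⌊(n : ℝ) ^ δ⌋₊ / (⌊(n : ℝ) ^ δ⌋₊ : ℝ)))
    (hs : ¬ Summable fun n : ℕ => lam n * Real.log n ^ m / (n : ℝ) ^ 2) :
    ∃ (n : ℕ → ℕ) (a : ℕ → ℝ) (C : ℝ), StrictMono n ∧ 1 ≤ n 0 ∧ (∀ s, 0 ≤ a s) ∧
      (∀ s, a s * (2 * (1 + Real.log (n (s + 1))) + 2 * Real.pi) ≤
        C * (lam (n (s + 1)) / n (s + 1))) ∧
      ¬ Summable fun s => a s * Real.log (((n (s + 1) : ℝ) + 1) / ((n s : ℝ) + 1)) ^ (m + 2) := by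
  have hpi := Real.pi_pos
  obtain ⟨C₁, hC₁, hO⟩ := hO.exists_pos
  obtain ⟨N, hN⟩ := eventually_atTop.1 (hO.bound.and ((log_floor_rpow_ratio hδ).and
    (eventually_ge_atTop 3)))
  set rho : ℕ → ℝ := fun n => lam n / n with hrho
  have hlam : ∀ k : ℕ, 1 ≤ k → 0 < lam k := fun k hk => by
    linarith [hmono (mem_Ici.2 le_rfl) (mem_Ici.2 hk) hk]
  have hrho0 : ∀ k : ℕ, 1 ≤ k → 0 < rho k := fun k hk =>
    div_pos (hlam k hk) (by exact_mod_cast hk)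
  have hbase : ∀ k ≥ N, 1 ≤ Real.log k ∧ k < ⌊(k : ℝ) ^ δ⌋₊ ∧ rho k ≤ C₁ * rho ⌊(k : ℝ) ^ δ⌋₊ ∧
      (δ - 1) / 2 * Real.log k ≤ Real.log (((⌊(k : ℝ) ^ δ⌋₊ : ℝ) + 1) / ((k : ℝ) + 1)) ∧
      Real.log ⌊(k : ℝ) ^ δ⌋₊ ≤ δ * Real.log k := by
    intro k hk
    obtain ⟨hk1, hk2, hk3⟩ := hN k hk
    have hk3' : (3 : ℝ) ≤ k := by exact_mod_cast hk3
    have hk0 : (0 : ℝ) < k := by linarith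
    have hlog : 1 ≤ Real.log k := by
      rw [Real.le_log_iff_exp_le hk0]
      exact (Real.exp_one_lt_d9.le.trans (by norm_num)).trans hk3'
    have hlt : k < ⌊(k : ℝ) ^ δ⌋₊ := by
      by_contra hcon
      push Not at hcon
      have hc' : (⌊(k : ℝ) ^ δ⌋₊ : ℝ) ≤ k := by exact_mod_cast hcon
      have : Real.log (((⌊(k : ℝ) ^ δ⌋₊ : ℝ) + 1) / ((k : ℝ) + 1)) ≤ 0 := by
        refine Real.log_nonpos (by positivity) ?_
        rw [div_le_one (by positivity)]
        linarith
      nlinarith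
    refine ⟨hlog, hlt, ?_, hk2, ?_⟩
    · rwa [Real.norm_of_nonneg (hrho0 k (by omega)).le,
        Real.norm_of_nonneg (hrho0 _ (by omega)).le] at hk1
    · rw [← Real.log_rpow hk0]
      refine Real.log_le_log (by exact_mod_cast (by omega : 0 < ⌊(k : ℝ) ^ δ⌋₊)) ?_
      exact Nat.floor_le (by positivity)
  set n : ℕ → ℕ := fun s => (fun k : ℕ => ⌊(k : ℝ) ^ δ⌋₊)^[s] (max N 1) with hn
  have hsucc : ∀ s, n (s + 1) = ⌊(n s : ℝ) ^ δ⌋₊ := fun s => by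
    rw [hn]; exact Function.iterate_succ_apply' _ _ _
  have hge : ∀ s, max N 1 ≤ n s := by
    intro s
    induction s with
    | zero => exact le_rfl
    | succ s ih =>
      rw [hsucc]
      exact ih.trans (hbase _ ((le_max_left _ _).trans ih)).2.1.le
  have hge1 : ∀ s, 1 ≤ n s := fun s => (le_max_right N 1).trans (hge s)
  have hb := fun s => hbase (n s) ((le_max_left N 1).trans (hge s))
  simp only [← hsucc] at hb
  have hmon : StrictMono n := strictMono_nat_of_lt_succ fun s => (hb s).2.1
  -- The amplitude λ_{n_s}/(n_s log n_s) is matched to the Λ-variation of a bump at scale n_{s+1}.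
  -- The constant collects log n_s ≥ 1, log n_{s+1} ≤ δ log n_s and the growth hypothesis, which
  -- compares λ_n/n at n_s and n_{s+1}.
  refine ⟨n, fun s => rho (n s) / Real.log (n s), C₁ * (2 + 2 * Real.pi + 2 * δ), hmon, hge1 0,
    fun s => div_nonneg (hrho0 _ (hge1 s)).le (by linarith [(hb s).1]), fun s => ?_, fun hcon => ?_⟩
  · obtain ⟨hl, -, hr, -, hl'⟩ := hb s
    have hr0 := hrho0 _ (hge1 s)
    rw [div_mul_eq_mul_div, div_le_iff₀ (by linarith)]
    have h3 : 2 * (1 + Real.log (n (s + 1))) + 2 * Real.pi ≤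
        (2 + 2 * Real.pi + 2 * δ) * Real.log (n s) := by nlinarith
    calc rho (n s) * (2 * (1 + Real.log (n (s + 1))) + 2 * Real.pi)
        ≤ (C₁ * rho (n (s + 1))) * ((2 + 2 * Real.pi + 2 * δ) * Real.log (n s)) := by
          refine mul_le_mul hr h3 ?_ (hr0.le.trans hr)
          have := Real.log_natCast_nonneg (n (s + 1))
          positivity
      _ = _ := by simp only [hrho]; ring
  · apply hs
    have hc : 0 < (δ - 1) / 2 := by linarith
    -- Since log((n_{s+1}+1)/(n_s+1)) is at least (δ-1)/2 times log n_s, its power m+2 divided by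
    -- the log n_s in the amplitude leaves log^{m+1} n_s.
    have hS : Summable fun s => rho (n s) * Real.log (n s) ^ (m + 1) := by
      refine Summable.of_nonneg_of_le (fun s => ?_) (fun s => ?_)
        (hcon.mul_left (((δ - 1) / 2) ^ (m + 2))⁻¹)
      · exact mul_nonneg (hrho0 _ (hge1 s)).le (pow_nonneg (Real.log_natCast_nonneg _) _)
      · obtain ⟨hl, -, -, hr, -⟩ := hb s
        have hl0 : 0 < Real.log (n s) := by linarith
        have h2 := pow_le_pow_left₀ (by positivity) hr (m + 2)
        rw [mul_pow] at h2
        rw [inv_mul_eq_div, le_div_iff₀ (by positivity)]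
        have := mul_le_mul_of_nonneg_left h2
          (div_nonneg (hrho0 _ (hge1 s)).le hl0.le : 0 ≤ rho (n s) / Real.log (n s))
        refine le_trans (le_of_eq ?_) this
        rw [pow_succ _ (m + 1)]
        field_simp
        ring
    set g : ℕ → ℝ := fun k => lam k * Real.log k ^ m / (k : ℝ) ^ 2 with hg
    have hg0 : ∀ k, 1 ≤ k → 0 ≤ g k := fun k hk =>
      div_nonneg (mul_nonneg (hlam k hk).le (pow_nonneg (Real.log_natCast_nonneg k) m))
        (by positivity)
    -- Between consecutive scales λ_k/k is largest at n_s, log k ≤ δ log n_s, and the harmonic sum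
    -- supplies one more logarithm.
    have hblock : ∀ s, ∑ k ∈ Finset.Ico (n s) (n (s + 1)), g k ≤
        δ ^ m * (1 + δ) * (rho (n s) * Real.log (n s) ^ (m + 1)) := by
      intro s
      obtain ⟨hl, hlt, -, -, hl'⟩ := hb s
      have hr0 := hrho0 _ (hge1 s)
      have hterm : ∀ k ∈ Finset.Ico (n s) (n (s + 1)),
          g k ≤ rho (n s) * (δ * Real.log (n s)) ^ m * (k : ℝ)⁻¹ := by
        intro k hk
        rw [Finset.mem_Ico] at hk
        have hk1 : 1 ≤ k := (hge1 s).trans hk.1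
        have hk0 : (0 : ℝ) < k := by exact_mod_cast hk1
        have e : g k = rho k * Real.log k ^ m * (k : ℝ)⁻¹ := by
          simp only [hg, hrho]; field_simp
        rw [e]
        have h1 : rho k ≤ rho (n s) := hanti (mem_Ici.2 (hge1 s)) (mem_Ici.2 hk1) hk.1
        have h2 : Real.log k ≤ δ * Real.log (n s) :=
          (Real.log_le_log hk0 (by exact_mod_cast hk.2.le)).trans hl'
        have h3 := Real.log_natCast_nonneg k
        gcongr
      refine (Finset.sum_le_sum hterm).trans ?_
      rw [← Finset.mul_sum]
      have h4 : ∑ k ∈ Finset.Ico (n s) (n (s + 1)), (k : ℝ)⁻¹ ≤ (1 + δ) * Real.log (n s) :=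
        (sum_Ico_inv_le (hge1 s)).trans (by nlinarith)
      calc _ ≤ rho (n s) * (δ * Real.log (n s)) ^ m * ((1 + δ) * Real.log (n s)) := by gcongr
        _ = _ := by rw [mul_pow, pow_succ]; ring
    rw [← summable_nat_add_iff (n 0)]
    refine summable_of_sum_range_le
      (c := δ ^ m * (1 + δ) * ∑' s, rho (n s) * Real.log (n s) ^ (m + 1))
      (fun k => hg0 _ (by have := hge1 0; omega)) fun P => ?_
    have hsumIco : ∀ P : ℕ, ∑ k ∈ Finset.Ico (n 0) (n P), g k =
        ∑ s ∈ Finset.range P, ∑ k ∈ Finset.Ico (n s) (n (s + 1)), g k := by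
      intro P
      induction P with
      | zero => simp
      | succ P ih =>
        rw [Finset.sum_range_succ, ← ih, Finset.sum_Ico_consecutive]
        · exact hmon.monotone (Nat.zero_le P)
        · exact hmon.monotone (Nat.le_succ P)
    have hP : n 0 + P ≤ n P := by
      clear_value n
      induction P with
      | zero => simp
      | succ P ih => have := hmon (Nat.lt_succ_self P); simp only [Nat.succ_eq_add_one] at this; omega
    calc ∑ k ∈ Finset.range P, g (k + n 0) = ∑ k ∈ Finset.Ico (n 0) (n 0 + P), g k := by
          rw [Finset.sum_Ico_eq_sum_range, Nat.add_sub_cancel_left]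
          exact Finset.sum_congr rfl fun k _ => by rw [add_comm]
      _ ≤ ∑ k ∈ Finset.Ico (n 0) (n P), g k := by
          refine Finset.sum_le_sum_of_subset_of_nonneg
            (Finset.Ico_subset_Ico le_rfl hP) fun k hk _ => hg0 k ?_
          exact (hge1 0).trans (Finset.mem_Ico.1 hk).1
      _ ≤ ∑ s ∈ Finset.range P, δ ^ m * (1 + δ) * (rho (n s) * Real.log (n s) ^ (m + 1)) := by
          rw [hsumIco]; exact Finset.sum_le_sum fun s _ => hblock s
      _ ≤ _ := by
          rw [← Finset.mul_sum]
          refine mul_le_mul_of_nonneg_left (hS.sum_le_tsum _ fun s _ => ?_) (by positivity)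
          exact mul_nonneg (hrho0 _ (hge1 s)).le (pow_nonneg (Real.log_natCast_nonneg _) _)

/-! ### Sine bumps and their variation -/

/-- A monotone map sends nonoverlapping intervals to intervals with disjoint interiors inside [g(0),
g(2π)]; compare lengths. -/
theorem sum_sub_le_of_isIntervalCollection {m : ℕ} {a b : Fin m → ℝ}
    (h : IsIntervalCollection a b) {g : ℝ → ℝ} (hg : Monotone g) :
    ∑ k, (g (b k) - g (a k)) ≤ g (2 * Real.pi) - g 0 := by
  have hle : ∀ k, g (a k) ≤ g (b k) := fun k => hg (h.lt k).le
  have hdisj : Pairwise (Function.onFun Disjoint fun k => Ioo (g (a k)) (g (b k))) := by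
    intro k l hkl
    have key : b k ≤ a l ∨ b l ≤ a k := by
      by_contra hcon
      push Not at hcon
      have h1 : max (a k) (a l) < min (b k) (b l) :=
        max_lt (lt_min (h.lt k) hcon.2) (lt_min hcon.1 (h.lt l))
      have h2 := le_max_left (a k) (a l)
      have h3 := le_max_right (a k) (a l)
      have h4 := min_le_left (b k) (b l)
      have h5 := min_le_right (b k) (b l)
      obtain ⟨x, hx1, hx2⟩ := exists_between h1
      exact Set.disjoint_left.1 (h.disjoint k l hkl) ⟨by linarith, by linarith⟩
        ⟨by linarith, by linarith⟩
    rw [Function.onFun, Set.disjoint_left]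
    intro x hx hx'
    rcases key with h' | h'
    · linarith [hx.2, hx'.1, hg h']
    · linarith [hx.1, hx'.2, hg h']
  have hsub : (⋃ k, Ioo (g (a k)) (g (b k))) ⊆ Icc (g 0) (g (2 * Real.pi)) := by
    refine iUnion_subset fun k x hx => ⟨?_, ?_⟩
    · exact (hg (h.subset k).1).trans hx.1.le
    · exact hx.2.le.trans (hg (h.subset k).2)
  have h1 := measureReal_mono (μ := volume) hsub measure_Icc_lt_top.ne
  rw [measureReal_iUnion_fintype hdisj (fun _ => measurableSet_Ioo)
    (fun _ => measure_Ioo_lt_top.ne), Real.volume_real_Icc_of_le (hg Real.two_pi_pos.le)] at h1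
  refine le_trans (le_of_eq (Finset.sum_congr rfl fun k _ => ?_)) h1
  rw [Real.volume_real_Ioo_of_le (hle k)]

/-- The projection of `u` to `[aπ / (N + 1/2), bπ / (N + 1/2)]`. -/
noncomputable def cellClamp (N a b : ℕ) (u : ℝ) : ℝ :=
  max (a * Real.pi / (N + 1 / 2)) (min (b * Real.pi / (N + 1 / 2)) u)

/-- The even `2π`-periodic function equal to `sin ((N + 1/2) t)` on
`[aπ / (N + 1/2), bπ / (N + 1/2)]` and to zero on the rest of `[0, π]`. -/
noncomputable def sineBump (N a b : ℕ) (t : ℝ) : ℝ :=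
  Real.sin ((N + 1 / 2) * cellClamp N a b (Real.arccos (Real.cos t)))

theorem monotone_cellClamp (N a b : ℕ) : Monotone (cellClamp N a b) := fun _ _ h =>
  max_le_max_left _ (min_le_min_left _ h)

theorem abs_sineBump_le_one (N a b : ℕ) (t : ℝ) : |sineBump N a b t| ≤ 1 := Real.abs_sin_le_one _

theorem continuous_sineBump (N a b : ℕ) : Continuous (sineBump N a b) := by
  unfold sineBump cellClamp
  have := Real.continuous_arccos
  fun_prop

theorem sineBump_add_two_pi (N a b : ℕ) (t : ℝ) :
    sineBump N a b (t + 2 * Real.pi) = sineBump N a b t := by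
  simp [sineBump]

theorem sineBump_neg (N a b : ℕ) (t : ℝ) : sineBump N a b (-t) = sineBump N a b t := by
  simp [sineBump]

theorem arccos_cos_mem_of_sineBump_ne_zero {N a b : ℕ} {t : ℝ} (h : sineBump N a b t ≠ 0) :
    Real.arccos (Real.cos t) ∈ Ioo (a * Real.pi / (N + 1 / 2)) (b * Real.pi / (N + 1 / 2)) := by
  have hM : (0 : ℝ) < N + 1 / 2 := by positivity
  have hz : ∀ k : ℕ, Real.sin ((N + 1 / 2) * (k * Real.pi / (N + 1 / 2))) = 0 := by
    intro k
    rw [mul_div_cancel₀ _ hM.ne', Real.sin_nat_mul_pi]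
  by_contra hcon
  apply h
  unfold sineBump cellClamp
  rw [mem_Ioo, not_and_or, not_lt, not_lt] at hcon
  rcases le_total (b * Real.pi / (N + 1 / 2)) (Real.arccos (Real.cos t)) with h1 | h1
  · rw [min_eq_left h1]
    rcases max_choice (a * Real.pi / ((N : ℝ) + 1 / 2)) (b * Real.pi / (N + 1 / 2)) with h2 | h2 <;>
      rw [h2, hz]
  · rw [min_eq_right h1]
    rcases hcon with h2 | h2
    · rw [max_eq_left h2, hz]
    · rw [le_antisymm h1 h2]
      rcases max_choice (a * Real.pi / ((N : ℝ) + 1 / 2)) (b * Real.pi / (N + 1 / 2)) with h2 | h2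
        <;> rw [h2, hz]

theorem arccos_cos_of_le {t : ℝ} (h0 : 0 ≤ t) (h1 : t ≤ Real.pi) :
    Real.arccos (Real.cos t) = t := Real.arccos_cos h0 h1

theorem arccos_cos_of_ge {t : ℝ} (h0 : Real.pi ≤ t) (h1 : t ≤ 2 * Real.pi) :
    Real.arccos (Real.cos t) = 2 * Real.pi - t := by
  rw [← Real.cos_two_pi_sub, Real.arccos_cos (by linarith) (by linarith)]

/-- Sine is 1-Lipschitz, and the clamped folded variable rises on [0, π] and falls on [π, 2π].
Unfolding the fall gives a monotone g that controls all increments and grows by at most 2bπ/(N+1/2)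
in total. -/
theorem sum_abs_sineBump_sub_le (N : ℕ) {a b : ℕ} (hab : a ≤ b) {m : ℕ} {u v : Fin m → ℝ}
    (h : IsIntervalCollection u v) :
    ∑ k, |sineBump N a b (v k) - sineBump N a b (u k)| ≤ 2 * Real.pi * b := by
  have hpi := Real.pi_pos
  have hM : (0 : ℝ) < N + 1 / 2 := by positivity
  have hC := monotone_cellClamp N a b
  set g : ℝ → ℝ := fun t => cellClamp N a b (min t Real.pi) -
    cellClamp N a b (2 * Real.pi - max t Real.pi) with hg
  have hgm : Monotone g := by
    intro s t hst
    have h1 := hC (min_le_min_right Real.pi hst)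
    have h2 := hC (sub_le_sub_left (max_le_max_right Real.pi hst) (2 * Real.pi))
    simp only [hg]
    linarith
  have hstep : ∀ k, |sineBump N a b (v k) - sineBump N a b (u k)| ≤
      (N + 1 / 2) * (g (v k) - g (u k)) := by
    intro k
    have hk := h.lt k
    obtain ⟨hk0, hk1⟩ := h.subset k
    have hsin : ∀ x y : ℝ, |Real.sin ((N + 1 / 2) * x) - Real.sin ((N + 1 / 2) * y)| ≤
        (N + 1 / 2) * |x - y| := by
      intro x y
      refine (Real.abs_sin_sub_sin_le _ _).trans (le_of_eq ?_)
      rw [← mul_sub, abs_mul, abs_of_pos hM]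
    unfold sineBump
    refine (hsin _ _).trans (mul_le_mul_of_nonneg_left ?_ hM.le)
    simp only [hg]
    rcases le_total (v k) Real.pi with h1 | h1
    · rw [arccos_cos_of_le (by linarith) h1, arccos_cos_of_le hk0 (by linarith), min_eq_left h1,
        min_eq_left (by linarith), max_eq_right h1, max_eq_right (by linarith),
        abs_of_nonneg (sub_nonneg.2 (hC hk.le))]
      linarith
    · rw [arccos_cos_of_ge h1 hk1, min_eq_right h1, max_eq_left h1]
      rcases le_total (u k) Real.pi with h2 | h2
      · rw [arccos_cos_of_le hk0 h2, min_eq_left h2, max_eq_right h2, two_mul, add_sub_cancel_right]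
        have h3 := hC (by linarith : Real.pi + Real.pi - v k ≤ Real.pi)
        have h4 := hC h2
        rw [abs_le]
        constructor <;> linarith
      · rw [arccos_cos_of_ge h2 (by linarith), min_eq_right h2, max_eq_left h2]
        have h3 := hC (by linarith : 2 * Real.pi - v k ≤ 2 * Real.pi - u k)
        rw [abs_of_nonpos (by linarith)]
        linarith
  refine (Finset.sum_le_sum fun k _ => hstep k).trans ?_
  rw [← Finset.mul_sum]
  refine (mul_le_mul_of_nonneg_left (sum_sub_le_of_isIntervalCollection h hgm) hM.le).trans ?_
  have hab' : (a : ℝ) * Real.pi / (N + 1 / 2) ≤ b * Real.pi / (N + 1 / 2) := by gcongr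
  have e1 : ∀ u, cellClamp N a b u ≤ b * Real.pi / (N + 1 / 2) := fun u =>
    max_le hab' (min_le_left _ _)
  have e2 : ∀ u, 0 ≤ cellClamp N a b u := fun u => le_max_of_le_left (by positivity)
  have h1 : g (2 * Real.pi) - g 0 ≤ 2 * (b * Real.pi / (N + 1 / 2)) := by
    simp only [hg]
    have := e1 (min (2 * Real.pi) Real.pi)
    have := e2 (2 * Real.pi - max (2 * Real.pi) Real.pi)
    have := e2 (min 0 Real.pi)
    have := e1 (2 * Real.pi - max 0 Real.pi)
    linarith
  refine (mul_le_mul_of_nonneg_left h1 hM.le).trans (le_of_eq ?_)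
  field_simp

/-- Up to index L use x_k ≤ 2 and λ_k ≥ k λ_L/L, which sums to a logarithm; beyond L use λ_k ≥ λ_L
and the bound on the total of x. -/
theorem sum_div_lam_le {lam : ℕ → ℝ} (h1 : 1 < lam 1) (hmono : MonotoneOn lam (Ici 1))
    (hanti : AntitoneOn (fun n : ℕ => lam n / (n : ℝ)) (Ici 1)) {L : ℕ} (hL : 1 ≤ L) {m : ℕ}
    {x : Fin m → ℝ} (hx0 : ∀ k, 0 ≤ x k) (hx2 : ∀ k, x k ≤ 2)
    (hx : ∑ k, x k ≤ 2 * Real.pi * L) :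
    ∑ k : Fin m, x k / lam ((k : ℕ) + 1) ≤
      (2 * (1 + Real.log L) + 2 * Real.pi) / (lam L / L) := by
  have hlam : ∀ k : ℕ, 1 ≤ k → 0 < lam k := fun k hk => by
    linarith [hmono (mem_Ici.2 le_rfl) (mem_Ici.2 hk) hk]
  have hL0 : (0 : ℝ) < L := by exact_mod_cast hL
  have hr : 0 < lam L / L := div_pos (hlam L hL) hL0
  have hsmall : ∀ k ∈ Finset.Icc 1 L, 2 / lam k ≤ 2 / (lam L / L) * (k : ℝ)⁻¹ := by
    intro k hk
    rw [Finset.mem_Icc] at hk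
    have hk0 : (0 : ℝ) < k := by exact_mod_cast hk.1
    have h2 : lam L / L ≤ lam k / k := hanti (mem_Ici.2 hk.1) (mem_Ici.2 hL) hk.2
    have h3 : (lam L / L) * k ≤ lam k := by rwa [le_div_iff₀ hk0] at h2
    rw [div_mul_eq_mul_div, ← div_eq_mul_inv, div_div, mul_comm (k : ℝ)]
    exact div_le_div_of_nonneg_left (by norm_num) (by positivity) h3
  have hpt : ∀ k : Fin m, x k / lam ((k : ℕ) + 1) ≤
      (if (k : ℕ) + 1 ≤ L then 2 / lam ((k : ℕ) + 1) else 0) + x k / lam L := by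
    intro k
    have hk := hlam ((k : ℕ) + 1) (by omega)
    have hLp := hlam L hL
    split_ifs with h
    · have a1 : x k / lam ((k : ℕ) + 1) ≤ 2 / lam ((k : ℕ) + 1) := by gcongr; exact hx2 k
      have a2 : 0 ≤ x k / lam L := div_nonneg (hx0 k) hLp.le
      linarith
    · rw [zero_add]
      exact div_le_div_of_nonneg_left (hx0 k) hLp
        (hmono (mem_Ici.2 hL) (mem_Ici.2 (by omega)) (by omega))
  refine (Finset.sum_le_sum fun k _ => hpt k).trans ?_
  rw [Finset.sum_add_distrib, ← Finset.sum_div, add_div]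
  refine add_le_add ?_ ?_
  · rw [← Finset.sum_filter]
    have : ∑ k ∈ Finset.univ.filter (fun k : Fin m => (k : ℕ) + 1 ≤ L), 2 / lam ((k : ℕ) + 1) =
        ∑ k ∈ (Finset.univ.filter (fun k : Fin m => (k : ℕ) + 1 ≤ L)).image
          (fun k : Fin m => (k : ℕ) + 1), 2 / lam k := by
      rw [Finset.sum_image]
      intro k _ l _ hkl
      exact Fin.ext (by simpa using hkl)
    rw [this]
    calc _ ≤ ∑ k ∈ Finset.Icc 1 L, 2 / lam k := by
          refine Finset.sum_le_sum_of_subset_of_nonneg (fun k hk => ?_) fun k hk _ =>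
            (div_pos two_pos (hlam k (Finset.mem_Icc.1 hk).1)).le
          obtain ⟨l, hl, rfl⟩ := Finset.mem_image.1 hk
          exact Finset.mem_Icc.2 ⟨by omega, (Finset.mem_filter.1 hl).2⟩
      _ ≤ ∑ k ∈ Finset.Icc 1 L, 2 / (lam L / L) * (k : ℝ)⁻¹ := Finset.sum_le_sum hsmall
      _ ≤ 2 / (lam L / L) * (1 + Real.log L) := by
          rw [← Finset.mul_sum]
          refine mul_le_mul_of_nonneg_left ?_ (by positivity)
          have h := harmonic_le_one_add_log L
          rw [harmonic_eq_sum_Icc] at h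
          push_cast at h
          exact h
      _ = _ := by ring
  · rw [div_le_div_iff₀ (hlam L hL) hr]
    calc (∑ k, x k) * (lam L / L) ≤ 2 * Real.pi * L * (lam L / L) := by gcongr
      _ = _ := by field_simp

theorem log_div_le_sum_Ico (a b : ℕ) (hab : a ≤ b) :
    Real.log (((b : ℝ) + 1) / ((a : ℝ) + 1)) ≤ ∑ k ∈ Finset.Ico a b, 1 / ((k : ℝ) + 1) := by
  have h := sum_Ico_sub_succ (fun k => -Real.log ((k : ℝ) + 1)) hab
  rw [Real.log_div (by positivity) (by positivity)]
  have e : Real.log ((b : ℝ) + 1) - Real.log ((a : ℝ) + 1) =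
      -Real.log ((a : ℝ) + 1) - -Real.log ((b : ℝ) + 1) := by ring
  rw [e, ← h]
  refine Finset.sum_le_sum fun k _ => ?_
  have h1 : (0 : ℝ) < (k : ℝ) + 1 := by positivity
  have h2 := Real.log_le_sub_one_of_pos (x := (((k + 1 : ℕ) : ℝ) + 1) / ((k : ℝ) + 1))
    (by positivity)
  rw [Real.log_div (by positivity) (by positivity)] at h2
  have h3 : (((k + 1 : ℕ) : ℝ) + 1) / ((k : ℝ) + 1) - 1 = 1 / ((k : ℝ) + 1) := by
    push_cast; field_simp; ring
  rw [h3] at h2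
  linarith

theorem dirichletPos_mul_sineBump_nonneg (N a b : ℕ) (t : ℝ) :
    0 ≤ dirichletPos N t * sineBump N a b t := by
  by_cases ht : t ∈ Ioc 0 Real.pi
  · by_cases h : sineBump N a b t = 0
    · rw [h, mul_zero]
    · have h1 := arccos_cos_mem_of_sineBump_ne_zero h
      have h2 : sineBump N a b t = Real.sin ((N + 1 / 2) * t) := by
        rw [arccos_cos_of_le ht.1.le ht.2] at h1
        unfold sineBump cellClamp
        rw [arccos_cos_of_le ht.1.le ht.2, min_eq_right h1.2.le, max_eq_right h1.1.le]
      rw [h2, dirichletPos_eq, mul_right_comm]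
      exact mul_nonneg (mul_self_nonneg _) (cosecWeight_nonneg t)
  · rw [dirichletPos, indicator_of_notMem ht, zero_mul]

theorem integrable_dirichletPos_mul_sineBump (N a b : ℕ) :
    Integrable fun t => dirichletPos N t * sineBump N a b t :=
  (integrable_dirichletPos N).mul_bdd (c := 1) (continuous_sineBump N a b).aestronglyMeasurable
    (ae_of_all _ fun t => abs_sineBump_le_one N a b t)

theorem integral_sin_sq_cell (N k : ℕ) :
    ∫ t in (k * Real.pi / ((N : ℝ) + 1 / 2))..((k + 1 : ℕ) * Real.pi / ((N : ℝ) + 1 / 2)),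
      Real.sin ((N + 1 / 2) * t) ^ 2 = Real.pi / (2 * (N + 1 / 2)) := by
  have hM : (0 : ℝ) < N + 1 / 2 := by positivity
  rw [intervalIntegral.integral_comp_mul_left (fun x => Real.sin x ^ 2) hM.ne',
    mul_div_cancel₀ _ hM.ne', mul_div_cancel₀ _ hM.ne', integral_sin_sq, Real.sin_nat_mul_pi,
    Real.sin_nat_mul_pi, smul_eq_mul]
  push_cast
  field_simp
  ring

/-- On the cell between zeros k and k+1 the integrand is sin²((N+1/2)t)/sin(t/2), and 1/sin(t/2) ≥
2/t. The cell thus contributes at least 1/(k+1). The condition b ≤ N keeps the cells inside (0, π].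
-/
theorem log_le_integral_dirichletPos_mul_sineBump {N a b : ℕ} (hab : a ≤ b) (hbN : b ≤ N) :
    Real.log (((b : ℝ) + 1) / ((a : ℝ) + 1)) ≤ ∫ t, dirichletPos N t * sineBump N a b t := by
  have hpi := Real.pi_pos
  have hM : (0 : ℝ) < N + 1 / 2 := by positivity
  set node : ℕ → ℝ := fun k => k * Real.pi / ((N : ℝ) + 1 / 2) with hnode
  have hnm : Monotone node := fun k l hkl => by
    have : (k : ℝ) ≤ l := by exact_mod_cast hkl
    simp only [hnode]; gcongr
  have hint := integrable_dirichletPos_mul_sineBump N a b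
  have h1 : ∫ t in node a..node b, dirichletPos N t * sineBump N a b t ≤
      ∫ t, dirichletPos N t * sineBump N a b t := by
    rw [intervalIntegral.integral_of_le (hnm hab)]
    exact setIntegral_le_integral hint
      (ae_of_all _ fun t => dirichletPos_mul_sineBump_nonneg N a b t)
  refine (log_div_le_sum_Ico a b hab).trans (le_trans ?_ h1)
  rw [← intervalIntegral.sum_integral_adjacent_intervals_Ico hab
    fun k _ => hint.intervalIntegrable]
  refine Finset.sum_le_sum fun k hk => ?_
  rw [Finset.mem_Ico] at hk
  have hcell : ∀ t ∈ Ioo (node k) (node (k + 1)),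
      2 * (N + 1 / 2) / ((k + 1) * Real.pi) * Real.sin ((N + 1 / 2) * t) ^ 2 ≤
        dirichletPos N t * sineBump N a b t := by
    intro t ht
    have hk0 : 0 ≤ node k := by simp only [hnode]; positivity
    have ht0 : 0 < t := hk0.trans_lt ht.1
    have hta : node a ≤ t := (hnm hk.1).trans ht.1.le
    have htb : t ≤ node b := ht.2.le.trans (hnm hk.2)
    have htpi : t ≤ Real.pi := by
      refine htb.trans ?_
      simp only [hnode]
      rw [div_le_iff₀ hM]
      have : (b : ℝ) ≤ N := by exact_mod_cast hbN
      nlinarith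
    have e : sineBump N a b t = Real.sin ((N + 1 / 2) * t) := by
      unfold sineBump cellClamp
      rw [arccos_cos_of_le ht0.le htpi, min_eq_right htb, max_eq_right hta]
    rw [e, dirichletPos_eq, mul_right_comm, ← sq, mul_comm]
    refine mul_le_mul_of_nonneg_left ?_ (sq_nonneg _)
    unfold cosecWeight
    rw [indicator_of_mem (show t ∈ Ioc 0 Real.pi from ⟨ht0, htpi⟩)]
    have hs := sin_half_pos ht0 htpi
    have hs' : Real.sin (t / 2) ≤ t / 2 := Real.sin_le (by linarith)
    have ht2 : t ≤ (k + 1) * Real.pi / (N + 1 / 2) := by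
      have := ht.2.le
      simp only [hnode] at this
      push_cast at this
      exact this
    rw [← inv_div]
    refine inv_anti₀ hs (hs'.trans ?_)
    calc t / 2 ≤ (k + 1) * Real.pi / (N + 1 / 2) / 2 := by linarith
      _ = _ := by field_simp
  have h2 := intervalIntegral.integral_mono_on_of_le_Ioo (μ := volume) (hnm (Nat.le_succ k))
    (f := fun t => 2 * (N + 1 / 2) / ((k + 1) * Real.pi) * Real.sin ((N + 1 / 2) * t) ^ 2)
    (g := fun t => dirichletPos N t * sineBump N a b t)
    (Continuous.intervalIntegrable (by fun_prop) _ _) hint.intervalIntegrable hcell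
  refine le_trans (le_of_eq ?_) h2
  rw [intervalIntegral.integral_const_mul]
  rw [show ∫ t in node k..node k.succ, Real.sin ((N + 1 / 2) * t) ^ 2 = _ from
    integral_sin_sq_cell N k]
  field_simp

/-! ### Linearity of partial sums and condensation of singularities -/

section RectPartialSum

variable {d : ℕ}

theorem integrable_mul_prod_dirichletKer {f : (Fin d → ℝ) → ℂ}
    (hf : IntegrableOn f (torusCube d)) (N : Fin d → ℕ) (x : Fin d → ℝ) :
    IntegrableOn (fun y => f y * ∏ j, (dirichletKer (N j) (x j - y j) : ℂ)) (torusCube d) := by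
  refine Integrable.mul_bdd (c := ∏ j, (2 * (N j : ℝ) + 1)) hf ?_ (ae_of_all _ fun y => ?_)
  · refine Continuous.aestronglyMeasurable (continuous_finsetProd _ fun j _ => ?_)
    have := continuous_dirichletKer (N j)
    fun_prop
  · rw [norm_prod]
    refine Finset.prod_le_prod (fun _ _ => norm_nonneg _) fun j _ => ?_
    rw [Complex.norm_real]
    exact abs_dirichletKer_le _ _

theorem rectPartialSum_add {f g : (Fin d → ℝ) → ℂ} (hf : IntegrableOn f (torusCube d))
    (hg : IntegrableOn g (torusCube d)) (N : Fin d → ℕ) (x : Fin d → ℝ) :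
    rectPartialSum (fun y => f y + g y) N x = rectPartialSum f N x + rectPartialSum g N x := by
  rw [rectPartialSum_eq_integral (f := fun y => f y + g y) (hf.add hg),
    rectPartialSum_eq_integral hf,
    rectPartialSum_eq_integral hg, ← mul_add, ← integral_add
    (integrable_mul_prod_dirichletKer hf N x) (integrable_mul_prod_dirichletKer hg N x)]
  simp_rw [add_mul]

theorem rectPartialSum_const_mul {f : (Fin d → ℝ) → ℂ} (hf : IntegrableOn f (torusCube d))
    (c : ℂ) (N : Fin d → ℕ) (x : Fin d → ℝ) :
    rectPartialSum (fun y => c * f y) N x = c * rectPartialSum f N x := by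
  rw [rectPartialSum_eq_integral (hf.const_mul c), rectPartialSum_eq_integral hf]
  simp_rw [mul_assoc]
  rw [integral_const_mul]
  ring

/-- For fixed N and x the partial sum is bounded in the sup norm, which makes it a continuous
functional of the ℓ¹ coefficients. -/
theorem exists_norm_rectPartialSum_le (N : Fin d → ℕ) (x : Fin d → ℝ) :
    ∃ K, ∀ (f : (Fin d → ℝ) → ℂ), AEStronglyMeasurable f volume → ∀ B, (∀ y, ‖f y‖ ≤ B) →
      ‖rectPartialSum f N x‖ ≤ K * B := by
  refine ⟨‖1 / (2 * (Real.pi : ℂ)) ^ d‖ * ((∏ j, (2 * (N j : ℝ) + 1)) *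
    volume.real (torusCube d)), fun f hf B hB => ?_⟩
  rw [rectPartialSum_eq_integral (integrableOn_torusCube hf hB), norm_mul, mul_assoc]
  refine mul_le_mul_of_nonneg_left ?_ (norm_nonneg _)
  have := norm_setIntegral_le_of_norm_le_const (μ := volume)
    (f := fun y => f y * ∏ j, (dirichletKer (N j) (x j - y j) : ℂ)) (measure_torusCube_lt_top d)
    (C := B * ∏ j, (2 * (N j : ℝ) + 1)) fun y _ => by
      rw [norm_mul, norm_prod]
      refine mul_le_mul (hB y) (Finset.prod_le_prod (fun _ _ => norm_nonneg _) fun j _ => ?_)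
        (Finset.prod_nonneg fun _ _ => norm_nonneg _) ((norm_nonneg _).trans (hB y))
      rw [Complex.norm_real]
      exact abs_dirichletKer_le _ _
  refine this.trans (le_of_eq ?_)
  ring

end RectPartialSum

theorem lp_one_summable_norm (c : lp (fun _ : ℕ => ℝ) 1) : Summable fun S => ‖c S‖ := by
  have := (memℓp_gen_iff (p := 1) (by simp)).1 (lp.memℓp c)
  simpa using this

theorem lp_one_norm_eq (c : lp (fun _ : ℕ => ℝ) 1) : ‖c‖ = ∑' S, ‖c S‖ := by
  have := lp.norm_eq_tsum_rpow (p := 1) (by simp) c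
  simpa using this

section Condensation

variable {d : ℕ} {lam : ℕ → ℝ} {F : ℕ → (Fin d → ℝ) → ℝ} {A C : ℝ}

/-- The function `∑ c_S F_S`. -/
noncomputable def synthesis (F : ℕ → (Fin d → ℝ) → ℝ) (c : lp (fun _ : ℕ => ℝ) 1)
    (x : Fin d → ℝ) : ℝ := ∑' S, c S * F S x

theorem summable_synthesis (hA : ∀ S x, |F S x| ≤ A) (c : lp (fun _ : ℕ => ℝ) 1)
    (x : Fin d → ℝ) : Summable fun S => c S * F S x := by
  refine Summable.of_norm_bounded ((lp_one_summable_norm c).mul_right A) fun S => ?_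
  rw [norm_mul]
  exact mul_le_mul_of_nonneg_left (hA S x) (norm_nonneg _)

theorem norm_synthesis_le (hA : ∀ S x, |F S x| ≤ A) (c : lp (fun _ : ℕ => ℝ) 1)
    (x : Fin d → ℝ) : ‖synthesis F c x‖ ≤ A * ‖c‖ := by
  rw [mul_comm, lp_one_norm_eq, ← tsum_mul_right]
  refine tsum_of_norm_bounded ((lp_one_summable_norm c).mul_right A).hasSum fun S => ?_
  rw [norm_mul]
  exact mul_le_mul_of_nonneg_left (hA S x) (norm_nonneg _)

theorem continuous_synthesis (hF : ∀ S, Continuous (F S)) (hA : ∀ S x, |F S x| ≤ A)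
    (c : lp (fun _ : ℕ => ℝ) 1) : Continuous (synthesis F c) := by
  refine continuous_tsum (fun S => continuous_const.mul (hF S))
    ((lp_one_summable_norm c).mul_right A) fun S x => ?_
  rw [norm_mul]
  exact mul_le_mul_of_nonneg_left (hA S x) (norm_nonneg _)

/-- The variation is subadditive: exchanging the finite sum over intervals with the series bounds
each line by C Σ|c_S|. -/
theorem synthesis_mem_PBV (hlam : ∀ k, 1 ≤ k → 0 < lam k) (hF : ∀ S, Continuous (F S))
    (hA : ∀ S x, |F S x| ≤ A)
    (hper : ∀ S (x : Fin d → ℝ) j, F S (Function.update x j (x j + 2 * Real.pi)) = F S x)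
    (hC : ∀ S (x : Fin d → ℝ) (i : Fin d) (m : ℕ) (u v : Fin m → ℝ), IsIntervalCollection u v →
      ∑ k, |F S (Function.update x i (v k)) - F S (Function.update x i (u k))| /
        lam ((k : ℕ) + 1) ≤ C) (c : lp (fun _ : ℕ => ℝ) 1) :
    (fun x => (synthesis F c x : ℂ)) ∈ PBV d lam := by
  have hcont := continuous_synthesis hF hA c
  refine ⟨(Complex.continuous_ofReal.comp hcont).aemeasurable, fun x j => ?_, ?_⟩
  · unfold synthesis
    simp_rw [hper]
  · refine ENNReal.sum_lt_top.2 fun i _ => ?_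
    refine lt_of_le_of_lt (b := ENNReal.ofReal (∑' S, ‖c S‖ * C)) ?_ ENNReal.ofReal_lt_top
    unfold partialVariation
    refine iSup_le fun x => iSup_le fun _ => iSup_le fun m => iSup_le fun u => iSup_le fun v =>
      iSup_le fun huv => ?_
    have hl : ∀ k : Fin m, 0 < lam ((k : ℕ) + 1) := fun k => hlam _ (by omega)
    rw [← ENNReal.ofReal_sum_of_nonneg fun (k : Fin m) _ =>
      div_nonneg (norm_nonneg _) (hl k).le]
    refine ENNReal.ofReal_le_ofReal ?_
    set D : ℕ → Fin m → ℝ := fun S k =>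
      |F S (Function.update x i (v k)) - F S (Function.update x i (u k))| with hD
    have hsD : ∀ k, Summable fun S => ‖c S‖ * D S k := by
      intro k
      refine Summable.of_norm_bounded ((lp_one_summable_norm c).mul_right (2 * A)) fun S => ?_
      rw [norm_mul, norm_norm, Real.norm_of_nonneg (abs_nonneg _ : 0 ≤ D S k)]
      refine mul_le_mul_of_nonneg_left ((abs_sub _ _).trans ?_) (norm_nonneg _)
      linarith [hA S (Function.update x i (v k)), hA S (Function.update x i (u k))]
    have hstep : ∀ k : Fin m, ‖(synthesis F c (Function.update x i (v k)) : ℂ) -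
        (synthesis F c (Function.update x i (u k)) : ℂ)‖ / lam ((k : ℕ) + 1) ≤
        ∑' S, ‖c S‖ * D S k / lam ((k : ℕ) + 1) := by
      intro k
      rw [tsum_div_const]
      refine div_le_div_of_nonneg_right ?_ (hl k).le
      rw [← Complex.ofReal_sub, Complex.norm_real]
      unfold synthesis
      rw [← (summable_synthesis hA c _).tsum_sub (summable_synthesis hA c _)]
      refine tsum_of_norm_bounded (hsD k).hasSum fun S => ?_
      rw [← mul_sub, norm_mul]
      rfl
    refine (Finset.sum_le_sum fun k _ => hstep k).trans ?_
    rw [← Summable.tsum_finsetSum fun k _ => (hsD k).div_const _]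
    refine Summable.tsum_le_tsum (fun S => ?_) (summable_sum fun k _ => (hsD k).div_const _)
      ((lp_one_summable_norm c).mul_right C)
    simp_rw [mul_div_assoc]
    rw [← Finset.mul_sum]
    exact mul_le_mul_of_nonneg_left (hC S x i m u v huv) (norm_nonneg _)

/-- Condensation of singularities: unbounded partial sums along a bounded sequence in `PBV_Λ` give
a continuous function in `PBV_Λ` with a divergent Fourier series. -/
theorem exists_divergent (hlam : ∀ k, 1 ≤ k → 0 < lam k) (hF : ∀ S, Continuous (F S))
    (hA : ∀ S x, |F S x| ≤ A)
    (hper : ∀ S (x : Fin d → ℝ) j, F S (Function.update x j (x j + 2 * Real.pi)) = F S x)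
    (hC : ∀ S (x : Fin d → ℝ) (i : Fin d) (m : ℕ) (u v : Fin m → ℝ), IsIntervalCollection u v →
      ∑ k, |F S (Function.update x i (v k)) - F S (Function.update x i (u k))| /
        lam ((k : ℕ) + 1) ≤ C)
    {n : ℕ → ℕ} (hn : Tendsto n atTop atTop)
    (hdiv : Tendsto (fun S => ‖rectPartialSum (fun x => (F S x : ℂ)) (fun _ => n S) 0‖)
      atTop atTop) :
    ∃ f : (Fin d → ℝ) → ℝ, Continuous f ∧ (fun x => (f x : ℂ)) ∈ PBV d lam ∧
      ¬ ∃ l : ℂ, Tendsto (fun N : Fin d → ℕ => rectPartialSum (fun x => (f x : ℂ)) N 0)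
        atTop (𝓝 l) := by
  have hA0 : 0 ≤ A := (abs_nonneg _).trans (hA 0 0)
  have haesm : ∀ c, AEStronglyMeasurable (fun x => (synthesis F c x : ℂ)) volume := fun c =>
    (Complex.continuous_ofReal.comp (continuous_synthesis hF hA c)).aestronglyMeasurable
  have hbd : ∀ c x, ‖(synthesis F c x : ℂ)‖ ≤ A * ‖c‖ := fun c x => by
    rw [Complex.norm_real]; exact norm_synthesis_le hA c x
  have hint : ∀ c, IntegrableOn (fun x => (synthesis F c x : ℂ)) (torusCube d) := fun c =>
    integrableOn_torusCube (haesm c) (hbd c)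
  choose K hK using fun S => exists_norm_rectPartialSum_le (fun _ : Fin d => n S) 0
  let T : ℕ → lp (fun _ : ℕ => ℝ) 1 →L[ℝ] ℂ := fun S => LinearMap.mkContinuous
    { toFun := fun c => rectPartialSum (fun x => (synthesis F c x : ℂ)) (fun _ => n S) 0
      map_add' := fun c c' => by
        rw [← rectPartialSum_add (hint c) (hint c')]
        congr 1
        ext x
        rw [← Complex.ofReal_add]
        unfold synthesis
        rw [← (summable_synthesis hA c x).tsum_add (summable_synthesis hA c' x)]
        simp_rw [← add_mul]
        rfl
      map_smul' := fun r c => by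
        rw [RingHom.id_apply, Complex.real_smul, ← rectPartialSum_const_mul (hint c)]
        congr 1
        ext x
        rw [← Complex.ofReal_mul]
        unfold synthesis
        rw [← tsum_mul_left]
        simp_rw [← mul_assoc]
        rfl } (K S * A) fun c => by
      have := hK S _ (haesm c) _ (hbd c)
      rw [mul_assoc]
      exact this
  have hT : ∀ S c, T S c = rectPartialSum (fun x => (synthesis F c x : ℂ)) (fun _ => n S) 0 :=
    fun _ _ => rfl
  have hunb : ¬ ∀ c, ∃ C', ∀ S, ‖T S c‖ ≤ C' := by
    intro hcon
    obtain ⟨C', hC'⟩ := banach_steinhaus hcon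
    obtain ⟨S, hS⟩ := (hdiv.eventually_gt_atTop C').exists
    -- The S-th unit vector has norm 1 and synthesises F S, so the norm of T S is at least the large
    -- partial sum of F S.
    have h1 := (T S).le_opNorm (lp.single 1 S (1 : ℝ))
    rw [lp.norm_single (by norm_num), norm_one, mul_one, hT] at h1
    have e : synthesis F (lp.single 1 S (1 : ℝ)) = F S := by
      ext x
      unfold synthesis
      rw [tsum_eq_single S]
      · simp
      · intro S' hS'
        simp [hS']
    rw [e] at h1
    linarith [hC' S]
  push Not at hunb
  obtain ⟨c, hc⟩ := hunb
  refine ⟨synthesis F c, continuous_synthesis hF hA c,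
    synthesis_mem_PBV hlam hF hA hper hC c, ?_⟩
  rintro ⟨l, hl⟩
  have hdiag : Tendsto (fun S => (fun _ : Fin d => n S)) atTop atTop :=
    tendsto_atTop.2 fun b => by
      have : ∀ᶠ S in atTop, ∀ j, b j ≤ n S := by
        rw [eventually_all]; exact fun j => hn.eventually_ge_atTop (b j)
      exact this
  obtain ⟨C', hC'⟩ := (Metric.isBounded_range_of_tendsto _ (hl.comp hdiag)).exists_norm_le
  obtain ⟨S, hS⟩ := hc C'
  exact absurd (hC' _ ⟨S, rfl⟩) (not_le.2 hS)

end Condensation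

/-! ### The test functions -/

/-- A sum of products of bumps over the diagonal blocks given by the scales `n_0 < ⋯ < n_S`. -/
noncomputable def bumpSum {d : ℕ} (n : ℕ → ℕ) (a : ℕ → ℝ) (S : ℕ) (x : Fin d → ℝ) : ℝ :=
  ∑ s ∈ Finset.range S, a s * ∏ j, sineBump (n S) (n s) (n (s + 1)) (x j)

section BumpSum

variable {d : ℕ} {n : ℕ → ℕ} {a : ℕ → ℝ}

theorem continuous_bumpSum (n : ℕ → ℕ) (a : ℕ → ℝ) (S : ℕ) :
    Continuous (bumpSum n a S : (Fin d → ℝ) → ℝ) := by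
  refine continuous_finsetSum _ fun s _ => continuous_const.mul
    (continuous_finsetProd _ fun j _ => ?_)
  have := continuous_sineBump (n S) (n s) (n (s + 1))
  fun_prop

theorem bumpSum_update_add (n : ℕ → ℕ) (a : ℕ → ℝ) (S : ℕ) (x : Fin d → ℝ) (j : Fin d) :
    bumpSum n a S (Function.update x j (x j + 2 * Real.pi)) = bumpSum n a S x := by
  unfold bumpSum
  refine Finset.sum_congr rfl fun s _ => ?_
  congr 1
  refine Finset.prod_congr rfl fun k _ => ?_
  rcases eq_or_ne k j with rfl | h
  · rw [Function.update_self, sineBump_add_two_pi]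
  · rw [Function.update_of_ne h]

theorem bumpSum_reflect (n : ℕ → ℕ) (a : ℕ → ℝ) (S : ℕ) (σ : Fin d → Bool) (x : Fin d → ℝ) :
    bumpSum n a S (reflect σ x) = bumpSum n a S x := by
  unfold bumpSum
  refine Finset.sum_congr rfl fun s _ => ?_
  congr 1
  refine Finset.prod_congr rfl fun k _ => ?_
  unfold reflect
  split_ifs
  · rfl
  · rw [sineBump_neg]

theorem sineBump_eq_zero_of_ne (hn : StrictMono n) (S : ℕ) {s r : ℕ} (hsr : s ≠ r) {t : ℝ}
    (h : sineBump (n S) (n s) (n (s + 1)) t ≠ 0) : sineBump (n S) (n r) (n (r + 1)) t = 0 := by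
  by_contra hr
  have h1 := arccos_cos_mem_of_sineBump_ne_zero h
  have h2 := arccos_cos_mem_of_sineBump_ne_zero hr
  have hmono : ∀ k l : ℕ, k ≤ l → (n k : ℝ) * Real.pi / (n S + 1 / 2) ≤
      n l * Real.pi / (n S + 1 / 2) := by
    intro k l hkl
    have : (n k : ℝ) ≤ n l := by exact_mod_cast hn.monotone hkl
    have := Real.pi_pos
    gcongr
  rcases lt_or_gt_of_ne hsr with h' | h'
  · linarith [hmono _ _ h', h1.2, h2.1]
  · linarith [hmono _ _ h', h2.2, h1.1]

/-- Along a line parallel to a coordinate axis, only one of the blocks contributes. -/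
theorem exists_bumpSum_update_eq (hd : 2 ≤ d) (hn : StrictMono n) (ha : ∀ s, 0 ≤ a s) (S : ℕ)
    (x : Fin d → ℝ) (i : Fin d) : ∃ (s : ℕ) (A : ℝ), |A| ≤ a s ∧ ∀ r,
      bumpSum n a S (Function.update x i r) = A * sineBump (n S) (n s) (n (s + 1)) r := by
  obtain ⟨j, hj⟩ : ∃ j : Fin d, j ≠ i := by
    have : Nontrivial (Fin d) := Fin.nontrivial_iff_two_le.2 hd
    exact exists_ne i
  have hline : ∀ s r, ∏ k, sineBump (n S) (n s) (n (s + 1)) (Function.update x i r k) =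
      (∏ k ∈ Finset.univ.erase i, sineBump (n S) (n s) (n (s + 1)) (x k)) *
        sineBump (n S) (n s) (n (s + 1)) r := by
    intro s r
    rw [← Finset.mul_prod_erase Finset.univ _ (Finset.mem_univ i), Function.update_self, mul_comm]
    congr 1
    exact Finset.prod_congr rfl fun k hk => by rw [Function.update_of_ne (Finset.ne_of_mem_erase hk)]
  have hjm : j ∈ Finset.univ.erase i := Finset.mem_erase.2 ⟨hj, Finset.mem_univ j⟩
  -- A second coordinate j, fixed along the line, lies in the support of at most one bump and
  -- thereby selects s; if it lies in none, the function vanishes on the whole line.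
  by_cases hex : ∃ s ∈ Finset.range S, sineBump (n S) (n s) (n (s + 1)) (x j) ≠ 0
  · obtain ⟨s, hs, hsj⟩ := hex
    refine ⟨s, a s * ∏ k ∈ Finset.univ.erase i, sineBump (n S) (n s) (n (s + 1)) (x k), ?_,
      fun r => ?_⟩
    · rw [abs_mul, abs_of_nonneg (ha s), Finset.abs_prod]
      exact mul_le_of_le_one_right (ha s) (Finset.prod_le_one (fun _ _ => abs_nonneg _)
        fun k _ => abs_sineBump_le_one _ _ _ _)
    · unfold bumpSum
      rw [Finset.sum_eq_single_of_mem s hs]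
      · rw [hline, mul_assoc]
      · intro s' _ hs'
        rw [hline, Finset.prod_eq_zero hjm (sineBump_eq_zero_of_ne hn S (Ne.symm hs') hsj), zero_mul,
          mul_zero]
  · push Not at hex
    refine ⟨0, 0, by simpa using ha 0, fun r => ?_⟩
    rw [zero_mul]
    unfold bumpSum
    refine Finset.sum_eq_zero fun s hs => ?_
    rw [hline, Finset.prod_eq_zero hjm (hex s hs), zero_mul, mul_zero]

/-- The function is even in each variable, so all 2^d orthants contribute equally and 2^d/(2π)^d =
π^{-d}; each product of bumps factors by Fubini. -/
theorem rectPartialSum_bumpSum (n : ℕ → ℕ) (a : ℕ → ℝ) (S : ℕ) {A : ℝ}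
    (hA : ∀ x : Fin d → ℝ, |bumpSum n a S x| ≤ A) (N : ℕ) :
    rectPartialSum (fun x : Fin d → ℝ => (bumpSum n a S x : ℂ)) (fun _ => N) 0 =
      ((∑ s ∈ Finset.range S, a s *
        ((∫ t, dirichletPos N t * sineBump (n S) (n s) (n (s + 1)) t) / Real.pi) ^ d : ℝ) : ℂ) := by
  have hpi : (Real.pi : ℂ) ≠ 0 := by exact_mod_cast Real.pi_ne_zero
  have hper : IsPeriodicEach fun x : Fin d → ℝ => (bumpSum n a S x : ℂ) := fun x j => by
    simp only [bumpSum_update_add]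
  rw [rectPartialSum_eq_sum_reflect hper
    (Complex.continuous_ofReal.comp (continuous_bumpSum n a S)).aestronglyMeasurable
    (B := A) (fun t => by rw [Complex.norm_real]; exact hA t)]
  simp_rw [zero_add, bumpSum_reflect]
  have hI : ∫ t : Fin d → ℝ, (∏ j, dirichletPos N (t j)) • (bumpSum n a S t : ℂ) =
      ((∑ s ∈ Finset.range S, a s *
        (∫ t, dirichletPos N t * sineBump (n S) (n s) (n (s + 1)) t) ^ d : ℝ) : ℂ) := by
    have e : ∀ t : Fin d → ℝ, (∏ j, dirichletPos N (t j)) • (bumpSum n a S t : ℂ) =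
        ((∑ s ∈ Finset.range S, a s *
          ∏ j, (dirichletPos N (t j) * sineBump (n S) (n s) (n (s + 1)) (t j)) : ℝ) : ℂ) := by
      intro t
      rw [Complex.real_smul, ← Complex.ofReal_mul]
      congr 1
      unfold bumpSum
      rw [Finset.mul_sum]
      refine Finset.sum_congr rfl fun s _ => ?_
      rw [Finset.prod_mul_distrib]
      ring
    simp_rw [e]
    rw [integral_complex_ofReal, integral_finsetSum]
    · congr 1
      refine Finset.sum_congr rfl fun s _ => ?_
      rw [integral_const_mul, integral_fintype_prod_volume_eq_prod
        (fun (_ : Fin d) u => dirichletPos N u * sineBump (n S) (n s) (n (s + 1)) u)]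
      simp
    · intro s _
      exact (Integrable.fintype_prod (𝕜 := ℝ) fun _ : Fin d =>
        (integrable_dirichletPos N).mul_bdd (c := 1)
          (continuous_sineBump (n S) (n s) (n (s + 1))).aestronglyMeasurable
          (ae_of_all _ fun t => abs_sineBump_le_one _ _ _ t)).const_mul _
  rw [Finset.sum_const, hI]
  simp only [Finset.card_univ, Fintype.card_fun, Fintype.card_bool, Fintype.card_fin, nsmul_eq_mul,
    div_pow, ← mul_div_assoc, ← Finset.sum_div]
  push_cast
  rw [mul_pow]
  field_simp

end BumpSum

/-! ### The divergence theorem and conclusion -/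

theorem exists_divergent_of_not_summable {m : ℕ} {lam : ℕ → ℝ} (h1 : 1 < lam 1)
    (hmono : MonotoneOn lam (Ici 1))
    (hanti : AntitoneOn (fun n : ℕ => lam n / (n : ℝ)) (Ici 1)) {δ : ℝ} (hδ : 1 < δ)
    (hO : (fun n : ℕ => lam n / (n : ℝ)) =O[atTop]
      (fun n : ℕ => lam ⌊(n : ℝ) ^ δ⌋₊ / (⌊(n : ℝ) ^ δ⌋₊ : ℝ)))
    (hs : ¬ Summable fun n : ℕ => lam n * Real.log n ^ m / (n : ℝ) ^ 2) :
    ∃ f : (Fin (m + 2) → ℝ) → ℝ, Continuous f ∧ (fun x => (f x : ℂ)) ∈ PBV (m + 2) lam ∧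
      ¬ ∃ l : ℂ, Tendsto (fun N : Fin (m + 2) → ℕ => rectPartialSum (fun x => (f x : ℂ)) N 0)
        atTop (𝓝 l) := by
  have hpi := Real.pi_pos
  have hlam : ∀ k : ℕ, 1 ≤ k → 0 < lam k := fun k hk => by
    linarith [hmono (mem_Ici.2 le_rfl) (mem_Ici.2 hk) hk]
  obtain ⟨n, a, C, hn, hn1, ha, haC, hns⟩ := exists_scales h1 hmono hanti hδ hO hs
  have hnk : ∀ k, 1 ≤ n k := fun k => hn1.trans (hn.monotone (Nat.zero_le k))
  have hr0 : ∀ k, 1 ≤ k → 0 < lam k / k := fun k hk => div_pos (hlam k hk) (by exact_mod_cast hk)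
  have hX : ∀ s, 2 ≤ 2 * (1 + Real.log (n (s + 1))) + 2 * Real.pi := fun s => by
    linarith [Real.log_natCast_nonneg (n (s + 1))]
  have hC0 : 0 ≤ C := by
    have := (mul_nonneg (ha 0) (by linarith [hX 0])).trans (haC 0)
    exact nonneg_of_mul_nonneg_left this (hr0 _ (hnk 1))
  -- The factor multiplying a s in the scale inequality is at least 2, and λ_n/n ≤ λ_1.
  have haA : ∀ s, a s ≤ C * lam 1 := by
    intro s
    have h2 : lam (n (s + 1)) / n (s + 1) ≤ lam 1 := by
      simpa using hanti (mem_Ici.2 le_rfl) (mem_Ici.2 (hnk (s + 1))) (hnk (s + 1))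
    have h3 := mul_le_mul_of_nonneg_left h2 hC0
    have h4 := mul_le_mul_of_nonneg_left (hX s) (ha s)
    linarith [haC s, ha s]
  have hA : ∀ (S : ℕ) (x : Fin (m + 2) → ℝ), |bumpSum n a S x| ≤ C * lam 1 := by
    intro S x
    obtain ⟨s, A, hA, hx⟩ := exists_bumpSum_update_eq (by omega) hn ha S x 0
    have := hx (x 0)
    rw [Function.update_eq_self] at this
    rw [this, abs_mul]
    exact (mul_le_of_le_one_right (abs_nonneg _) (abs_sineBump_le_one _ _ _ _)).trans
      (hA.trans (haA s))
  have hV : ∀ (S : ℕ) (x : Fin (m + 2) → ℝ) (i : Fin (m + 2)) (k : ℕ) (u v : Fin k → ℝ),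
      IsIntervalCollection u v →
      ∑ l, |bumpSum n a S (Function.update x i (v l)) - bumpSum n a S (Function.update x i (u l))| /
        lam ((l : ℕ) + 1) ≤ C := by
    intro S x i k u v huv
    obtain ⟨s, A, hA, hx⟩ := exists_bumpSum_update_eq (by omega) hn ha S x i
    simp_rw [hx, ← mul_sub, abs_mul, mul_div_assoc]
    rw [← Finset.mul_sum]
    have h2 := sum_div_lam_le h1 hmono hanti (hnk (s + 1))
      (x := fun l => |sineBump (n S) (n s) (n (s + 1)) (v l) -
        sineBump (n S) (n s) (n (s + 1)) (u l)|) (fun _ => abs_nonneg _)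
      (fun l => (abs_sub _ _).trans (by
        linarith [abs_sineBump_le_one (n S) (n s) (n (s + 1)) (v l),
          abs_sineBump_le_one (n S) (n s) (n (s + 1)) (u l)]))
      (sum_abs_sineBump_sub_le (n S) (hn.monotone (Nat.le_succ s)) huv)
    have h3 : 0 ≤ (2 * (1 + Real.log (n (s + 1))) + 2 * Real.pi) /
        (lam (n (s + 1)) / n (s + 1)) :=
      div_nonneg (by linarith [hX s]) (hr0 _ (hnk (s + 1))).le
    refine (mul_le_mul_of_nonneg_left h2 (abs_nonneg A)).trans
      ((mul_le_mul_of_nonneg_right hA h3).trans ?_)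
    rw [mul_div_assoc', div_le_iff₀ (hr0 _ (hnk (s + 1)))]
    exact haC s
  refine exists_divergent hlam (continuous_bumpSum n a) hA (bumpSum_update_add n a) hV
    hn.tendsto_atTop ?_
  set b : ℕ → ℝ := fun s =>
    a s * Real.log (((n (s + 1) : ℝ) + 1) / ((n s : ℝ) + 1)) ^ (m + 2) with hb
  have hlog : ∀ s, 0 ≤ Real.log (((n (s + 1) : ℝ) + 1) / ((n s : ℝ) + 1)) := by
    intro s
    refine Real.log_nonneg ?_
    rw [one_le_div (by positivity)]
    have : (n s : ℝ) ≤ n (s + 1) := by exact_mod_cast hn.monotone (Nat.le_succ s)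
    linarith
  have hb0 : ∀ s, 0 ≤ b s := fun s => mul_nonneg (ha s) (pow_nonneg (hlog s) _)
  have htend := ((not_summable_iff_tendsto_nat_atTop_of_nonneg hb0).1 hns).atTop_mul_const
    (by positivity : 0 < (Real.pi ^ (m + 2))⁻¹)
  refine tendsto_atTop_mono (fun S => ?_) htend
  rw [rectPartialSum_bumpSum n a S (hA S), Complex.norm_real]
  refine le_trans ?_ (le_abs_self _)
  rw [Finset.sum_mul]
  refine Finset.sum_le_sum fun s hs => ?_
  -- For s < S one has n_{s+1} ≤ n_S, so every bump fits in (0, π] at frequency n_S + 1/2.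
  have h2 := log_le_integral_dirichletPos_mul_sineBump (N := n S) (hn.monotone (Nat.le_succ s))
    (hn.monotone (Finset.mem_range.1 hs))
  rw [hb, mul_assoc, ← div_eq_mul_inv, ← div_pow]
  refine mul_le_mul_of_nonneg_left ?_ (ha s)
  have := hlog s
  gcongr

theorem theorem3 (d : ℕ) (hd : 2 ≤ d) (lam : ℕ → ℝ) (hlam_one : 1 < lam 1)
    (hlam_mono : MonotoneOn lam (Set.Ici 1)) (hlam_lim : Tendsto lam atTop atTop) :
    (Summable (fun n : ℕ => lam n * Real.log (n : ℝ) ^ (d - 2) / (n : ℝ) ^ 2) →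
      IsClassOfConvergence (PBV d lam)) ∧
    (AntitoneOn (fun n : ℕ => lam n / (n : ℝ)) (Set.Ici 1) →
      (∃ δ : ℝ, 1 < δ ∧
        (fun n : ℕ => lam n / (n : ℝ)) =O[atTop]
          (fun n : ℕ => lam ⌊(n : ℝ) ^ δ⌋₊ / (⌊(n : ℝ) ^ δ⌋₊ : ℝ))) →
      ¬ Summable (fun n : ℕ => lam n * Real.log (n : ℝ) ^ (d - 2) / (n : ℝ) ^ 2) →
      ∃ f : (Fin d → ℝ) → ℝ, Continuous f ∧ (fun x => (f x : ℂ)) ∈ PBV d lam ∧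
        ¬ ∃ l : ℂ, Tendsto (fun N : Fin d → ℕ => rectPartialSum (fun x => (f x : ℂ)) N 0)
          atTop (𝓝 l)) := by
  obtain ⟨m, rfl⟩ := Nat.exists_eq_add_of_le' hd
  rw [Nat.add_sub_cancel]
  refine ⟨isClassOfConvergence_PBV hlam_one hlam_mono, fun hanti hO hs => ?_⟩
  obtain ⟨δ, hδ, hO⟩ := hO
  exact exists_divergent_of_not_summable hlam_one hlam_mono hanti hδ hO hs
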